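/- For $m,n\ge 0$ let $ILP(A,b,w)$ be the covering integer program $\min\{w^{T}x : Ax\ge b,\ x\in\mathbb N^n\}$, where $A\in\mathbb R_{\ge0}^{m\times n}$, $b\in\mathbb R_{\ge 0}^m$, $w\in\mathbb R_{\ge 0}^n$. Let $f=f(A)$ and $\Delta=\Delta(A)$ be the maximum number of nonzero entries in a row, respectively a column, of $A$, and let $M=\max\{1,\max_{i,j:\,A_{i,j}\ne0} b_i/A_{i,j}\}$. The communication network is the bipartite graph with a variable node $x_j$ for every column, a constraint node $c_i$ for every row, and a link $\{x_j,c_i\}$ whenever $A_{i,j}\neq 0$. Initially $x_j$ knows $w_j$ and the $j$-th column of $A$, $c_i$ knows $b_i$ and its links, and every node knows its own name and $n,m,f,\varepsilon$. Computation is in the (deterministic) CONGEST model: synchronous rounds, in which neighbours exchange messages of $O(\log (n+m))$ bits and local computation is free. The entries of $A,b,w$ are assumed to be rationals whose numerators and denominators have $O(\log(n+m))$ bits. All logarithms are to base $2$. For a constant $\gamma>0$ let $$T_\gamma(f,\Delta,\varepsilon)= f\log\frac f\varepsilon+\frac{\log\Delta}{\log\log\Delta}+\min\Big\{\log\Delta,\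 f\log\frac f\varepsilon\,(\log\Delta)^{\gamma}\Big\}$$ (with $T_\gamma(0,\Delta,\varepsilon)=\log\Delta/\log\log\Delta$) be the bound on the round complexity of the primal-dual CONGEST algorithm MWHVC for $(f+\varepsilon)$-approximate minimum weight vertex cover in hypergraphs of rank $f$ and maximum degree $\Delta$. Here, and in the bound below, a degree $\Delta<3$ is replaced by $3$, and $\log n$ is replaced by $1$ if $n\le 1$. Claim. For every $\gamma>0$ there is a deterministic distributed CONGEST algorithm that, for every $\varepsilon\in(0,1]$ and every feasible covering program $ILP(A,b,w)$ as above, computes a feasible integral solution $x$ of cost at most $(f(A)+\varepsilon)$ times the integral optimum (each node $x_j$ outputs its value and all nodes halt), within $$O\Big(\big(1+\tfrac{f(A)}{\log n}\big)\cdot T_\gamma\big(f(A)\cdot(1+\log M),\ 2^{f(A)}\cdot M\cdot\Delta(A),\ \varepsilon\big)\Big)$$ rounds. If $\gamma\le 0.001$, then the number of rounds of the same algorithm is also $$O\Big(\big(1+\tfrac{f}{\log n}\big)\Big(\frac{\log\Delta}{\log\log\Delta}+\big(f\,(1+\log M)\big)^{1.01}\,(1+\log\varepsilon^{-1})\,(\log\Delta)^{0.01}\Big)\Big).$$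 The constants hidden in the $O$-terms (message size and rounds) depend only on $\gamma$ and on the constant in the bound on the input size. -/

import Mathlib

noncomputable section

/-- A covering integer linear program with `m` constraints and `n` variables:
minimise `wᵀ x` subject to `A x ≥ b`, `x ∈ ℕⁿ`, all data being non-negative. -/
structure CoveringILP (m n : ℕ) where
  A : Matrix (Fin m) (Fin n) ℝ
  b : Fin m → ℝ
  w : Fin n → ℝ
  A_nonneg : ∀ i j, 0 ≤ A i j
  b_nonneg : ∀ i, 0 ≤ b i
  w_nonneg : ∀ j, 0 ≤ w j

/-- `x` is a non-negative rational whose numerator and denominator have at most `k` bits each. -/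
def IsShort (k : ℕ) (x : ℝ) : Prop :=
  ∃ p q : ℕ, p < 2 ^ k ∧ 0 < q ∧ q < 2 ^ k ∧ x = (p : ℝ) / (q : ℝ)

namespace CoveringILP

variable {m n : ℕ}

/-- `x` is an integral feasible solution. -/
def Feasible (P : CoveringILP m n) (x : Fin n → ℕ) : Prop :=
  ∀ i, P.b i ≤ ∑ j, P.A i j * (x j : ℝ)

def cost (P : CoveringILP m n) (x : Fin n → ℕ) : ℝ :=
  ∑ j, P.w j * (x j : ℝ)

/-- `x` is a feasible integral solution of cost at most `ρ` times the integral optimum. -/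
def IsApprox (P : CoveringILP m n) (ρ : ℝ) (x : Fin n → ℕ) : Prop :=
  P.Feasible x ∧ ∀ y : Fin n → ℕ, P.Feasible y → P.cost x ≤ ρ * P.cost y

/-- `f(A)`: the maximum number of nonzero entries in a row of `A`. -/
def rank (P : CoveringILP m n) : ℕ :=
  Finset.univ.sup fun i : Fin m => Set.ncard {j : Fin n | P.A i j ≠ 0}

/-- `Δ(A)`: the maximum number of nonzero entries in a column of `A`. -/
def maxDegree (P : CoveringILP m n) : ℕ :=
  Finset.univ.sup fun j : Fin n => Set.ncard {i : Fin m | P.A i j ≠ 0}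

/-- `M = max {1, max {b_i / A_{i,j} : A_{i,j} ≠ 0}}`. -/
def maxRatio (P : CoveringILP m n) : ℝ :=
  max 1 (sSup {r : ℝ | ∃ i j, P.A i j ≠ 0 ∧ r = P.b i / P.A i j})

/-- Every number of the input is represented by (twice) at most `k` bits. -/
def InputShort (P : CoveringILP m n) (k : ℕ) : Prop :=
  (∀ i j, IsShort k (P.A i j)) ∧ (∀ i, IsShort k (P.b i)) ∧ ∀ j, IsShort k (P.w j)

/-- The communication network: variable nodes `Sum.inl j`, constraint nodes `Sum.inr i`, and a
link between `x_j` and `c_i` iff `A_{i,j} ≠ 0`. -/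
def network (P : CoveringILP m n) : SimpleGraph (Fin n ⊕ Fin m) :=
  SimpleGraph.fromRel fun u v =>
    ∃ (j : Fin n) (i : Fin m), u = Sum.inl j ∧ v = Sum.inr i ∧ P.A i j ≠ 0

end CoveringILP

/-- Bit strings of length at most `bw`. -/
abbrev Message (bw : ℕ) : Type := {l : List Bool // l.length ≤ bw}

/-- A deterministic synchronous message-passing program for the `n + m` nodes of the network of a
covering ILP, in which a message has at most `bw` bits. A variable node knows its name, its weight
and its column; a constraint node knows its name, its right-hand side and its links. Local
computation is free. A node halts when its state has an output. -/
structure CongestAlg (n m bw : ℕ) where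
  State : Type
  initVar : Fin n → ℝ → (Fin m → ℝ) → State
  initCon : Fin m → ℝ → Set (Fin n) → State
  /-- the message (if any) that is sent to a given neighbour -/
  send : State → Fin n ⊕ Fin m → Option (Message bw)
  /-- the new state, from the old one and the messages received -/
  recv : State → (Fin n ⊕ Fin m → Option (Message bw)) → State
  output : State → Option ℕ

namespace CongestAlg

variable {n m bw : ℕ}

def init (alg : CongestAlg n m bw) (P : CoveringILP m n) : Fin n ⊕ Fin m → alg.State
  | Sum.inl j => alg.initVar j (P.w j) fun i => P.A i j
  | Sum.inr i => alg.initCon i (P.b i) {j | P.A i j ≠ 0}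

open Classical in
/-- One synchronous round. Nodes that have halted keep their state and send nothing. -/
def round (alg : CongestAlg n m bw) (P : CoveringILP m n) (s : Fin n ⊕ Fin m → alg.State) :
    Fin n ⊕ Fin m → alg.State := fun v =>
  if (alg.output (s v)).isSome then s v
  else alg.recv (s v) fun u =>
    if P.network.Adj u v ∧ (alg.output (s u)).isNone then alg.send (s u) v else none

/-- The states of all nodes after `t` rounds. -/
def run (alg : CongestAlg n m bw) (P : CoveringILP m n) : ℕ → Fin n ⊕ Fin m → alg.State
  | 0 => alg.init P
  | t + 1 => alg.round P (alg.run P t)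

/-- After `t` rounds all nodes have halted, and the variable nodes have output `x`. -/
def HaltsWith (alg : CongestAlg n m bw) (P : CoveringILP m n) (t : ℕ) (x : Fin n → ℕ) : Prop :=
  (∀ v, (alg.output (alg.run P t v)).isSome) ∧
    ∀ j, alg.output (alg.run P t (Sum.inl j)) = some (x j)

end CongestAlg

/-- The round complexity
`T(f, Δ, ε) = f log (f/ε) + log Δ / log log Δ + min {log Δ, f log (f/ε) (log Δ)^γ}`
of the primal-dual algorithm for minimum weight vertex cover in hypergraphs of rank `f` and maximum
degree `Δ`, with parameter `γ`; degrees are taken to be at least `3`, so that `log log Δ > 0`. -/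
def mwhvcTime (γ f Δ ε : ℝ) : ℝ :=
  f * Real.logb 2 (f / ε)
    + Real.logb 2 (max 3 Δ) / Real.logb 2 (Real.logb 2 (max 3 Δ))
    + min (Real.logb 2 (max 3 Δ)) (f * Real.logb 2 (f / ε) * Real.logb 2 (max 3 Δ) ^ γ)

/-- The simplified bound
`log Δ / log log Δ + (f (1 + log M))^1.01 (1 + log ε⁻¹) (log Δ)^0.01`, again with `Δ ≥ 3`. -/
def simplifiedTime (f Δ M ε : ℝ) : ℝ :=
  Real.logb 2 (max 3 Δ) / Real.logb 2 (Real.logb 2 (max 3 Δ))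
    + (f * (1 + Real.logb 2 M)) ^ (1.01 : ℝ) * (1 + Real.logb 2 ε⁻¹)
      * Real.logb 2 (max 3 Δ) ^ (0.01 : ℝ)

end

/-!
Every violated constraint places one and the same bid on each of its variables, but at scales
`2 ^ k` that depend on the variable: raising every variable by its scale would just about satisfy
the constraint. The bid is an offer for raising the variable to its target, the next multiple of
`2 ^ k`. Offers accumulate, no target is ever overpaid, and a variable takes the largest value that
is paid for up to a fraction `β` of its price. If `y` is feasible, then a constraint violated by the
current values has a variable whose target is at most `y j`, since otherwise `y` would violate it as
well. So each bid occurs in the payments for `y`, and the bids sum up to at most the cost of `y`. As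
each bid is paid to at most `f` variables, the current values cost at most `f / (1 - β)` times as
much, which is `f + ε` times as much for `β = ε / (f + ε)`.

For the number of iterations, fix a constraint. In each iteration either all of its variables agree
to multiply its bid by `2 ^ a`, or the payments at one of them make progress of order `2 ^ (-a)`:
the logarithm of the unpaid fraction at some scale decreases, or the target of this scale moves on.
The residual decreases as targets move, so the total progress is at most of order
`G = f (1 + log M) log (1 / β)`; hence the bid can be raised by a factor of at most about
`M Δ 2 ^ G` in total, and it can be stuck only about `2 ^ a G` times. Alternating between the
factor `2` and a slowly growing factor of order `t ^ γ` balances the two bounds.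

Bids are powers of two, so the nodes exchange only exponents and values, which are short.
-/

noncomputable section

/-! ### Payments to a single variable -/

/-- The least multiple of `2 ^ k` that is larger than `x`: the value to which a variable of value
`x` is to be raised by the bids of scale `k`. -/
def target (k x : ℕ) : ℕ := (x / 2 ^ k + 1) * 2 ^ k

theorem lt_target (k x : ℕ) : x < target k x := by
  rw [target, mul_comm]
  exact Nat.lt_mul_div_succ x (by positivity)

theorem target_le (k x : ℕ) : target k x ≤ x + 2 ^ k := by
  rw [target, Nat.succ_mul]
  exact Nat.add_le_add_right (Nat.div_mul_le_self x _) _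

theorem target_le_of_dvd {k x T : ℕ} (h : 2 ^ k ∣ T) (hx : x < T) : target k x ≤ T := by
  obtain ⟨c, rfl⟩ := h
  rw [target, mul_comm]
  exact Nat.mul_le_mul_left _ (Nat.div_lt_of_lt_mul hx)

theorem dvd_target (k x : ℕ) : 2 ^ k ∣ target k x := Dvd.intro_left _ rfl

theorem target_mono_left {k l : ℕ} (h : k ≤ l) (x : ℕ) : target k x ≤ target l x :=
  target_le_of_dvd ((pow_dvd_pow 2 h).trans (dvd_target l x)) (lt_target l x)

theorem target_mono_right (k : ℕ) {x y : ℕ} (h : x ≤ y) : target k x ≤ target k y :=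
  target_le_of_dvd (dvd_target k y) (h.trans_lt (lt_target k y))

theorem target_eq_of_lt {k x y : ℕ} (h : x ≤ y) (hy : y < target k x) :
    target k y = target k x :=
  le_antisymm (target_le_of_dvd (dvd_target k x) hy) (target_mono_right k h)

theorem target_le_pow_mul {k l : ℕ} (h : k ≤ l) (x : ℕ) :
    target l x ≤ 2 ^ (l - k) * target k x := by
  refine target_le_of_dvd ?_
    ((lt_target k x).trans_le (Nat.le_mul_of_pos_left _ (by positivity)))
  rw [← Nat.sub_add_cancel h, pow_add, Nat.add_sub_cancel]
  exact mul_dvd_mul_left _ (dvd_target k x)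

theorem target_eq_iff_div_eq {k x y : ℕ} : target k x = target k y ↔ x / 2 ^ k = y / 2 ^ k := by
  rw [target, target, Nat.mul_left_inj (by positivity : 2 ^ k ≠ 0), Nat.add_left_inj]

theorem sum_two_zpow_mono {ι : Type*} {s t : Finset ι} (h : s ⊆ t) (e : ι → ℤ) :
    ∑ i ∈ s, (2 : ℝ) ^ e i ≤ ∑ i ∈ t, (2 : ℝ) ^ e i :=
  Finset.sum_le_sum_of_subset_of_nonneg h fun _ _ _ => by positivity

theorem sum_Ioc_quarter_pow_le (k N : ℕ) :
    ∑ l ∈ Finset.Ioc k N, (4 : ℝ)⁻¹ ^ (l - k) ≤ 1 / 2 := by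
  suffices h : ∀ d, ∑ l ∈ Finset.Ioc k (k + d), (4 : ℝ)⁻¹ ^ (l - k) = 1 / 3 * (1 - 4⁻¹ ^ d) by
    rcases le_total N k with hN | hN
    · rw [Finset.Ioc_eq_empty (by omega)]; norm_num
    · obtain ⟨d, rfl⟩ := Nat.exists_eq_add_of_le hN
      have : (0 : ℝ) ≤ 4⁻¹ ^ d := by positivity
      linarith [h d]
  intro d
  induction d with
  | zero => simp
  | succ d ih =>
    rw [← add_assoc, Finset.sum_Ioc_succ_top (by omega), ih, show k + d + 1 - k = d + 1 by omega]
    ring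

theorem half_pow_mul_two_pow_le (Z : ℕ) {d : ℕ} (hd : 1 ≤ d) :
    (2 : ℝ)⁻¹ ^ ((Z + 3) * d) * 2 ^ d ≤ 2⁻¹ ^ Z * 4⁻¹ ^ d := by
  have hexp : (2 : ℝ)⁻¹ ^ ((Z + 3) * d) * 2 ^ d = 2⁻¹ ^ (Z * d) * 4⁻¹ ^ d := by
    have h4 : (4 : ℝ)⁻¹ = 2⁻¹ ^ 2 := by norm_num
    rw [h4, add_mul, pow_add, mul_assoc, pow_mul _ 3 d, ← mul_pow]
    norm_num
  rw [hexp]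
  have : (2 : ℝ)⁻¹ ^ (Z * d) ≤ 2⁻¹ ^ Z :=
    pow_le_pow_of_le_one (by norm_num) (by norm_num) (Nat.le_mul_of_pos_right Z hd)
  gcongr

/-- The local view of a variable node in the bidding process: its weight `w` and value `x`; the
total `paid T` of all bids that it has received for a target at most `T`; a bound `topScale` on all
scales; the set `active` of its unsatisfied constraints; and for each of them the exponent of its
current bid `2 ^ bidExp i` and the scale of this bid. -/
structure VarView (m : ℕ) where
  w : ℝ
  x : ℕ
  paid : ℕ → ℝ
  topScale : ℕ
  active : Finset (Fin m)
  bidExp : Fin m → ℤ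
  scale : Fin m → ℕ

namespace VarView

variable {m : ℕ}

/-- The part of the price of the target at scale `k` that has not been paid yet. -/
def slack (V : VarView m) (k : ℕ) : ℝ := V.w * target k V.x - V.paid (target k V.x)

/-- The sum of the current bids of scale at most `k`. -/
def load (V : VarView m) (k : ℕ) : ℝ := ∑ i ∈ V.active with V.scale i ≤ k, (2 : ℝ) ^ V.bidExp i

/-- Constraint `i` may not multiply its bid by `2 ^ a`: at some scale that its bid affects, too
little slack is left if all bids do so. -/
def Stuck (V : VarView m) (a : ℕ) (i : Fin m) : Prop :=
  ∃ k, V.scale i ≤ k ∧ k ≤ V.topScale ∧ V.slack k < 8 * 2 ^ a * V.load k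

open Classical in
/-- The view after the constraints in `r` have multiplied their bids by `2 ^ a`. -/
def raise (V : VarView m) (a : ℕ) (r : Fin m → Prop) : VarView m :=
  { V with bidExp := fun i => if i ∈ V.active ∧ r i then V.bidExp i + a else V.bidExp i }

/-- The cumulative payments after every active constraint has paid its current bid. -/
def paidAfter (V : VarView m) (T : ℕ) : ℝ :=
  V.paid T + ∑ i ∈ V.active with target (V.scale i) V.x ≤ T, (2 : ℝ) ^ V.bidExp i

/-- The view after all bids have been paid and the variable has been raised to the largest value
that is paid for up to a fraction `β` of its price. For `w = 0` this supremum is the junk value `0`,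
hence the maximum with the old value. -/
def settle (V : VarView m) (β : ℝ) : VarView m :=
  { V with
    paid := V.paidAfter
    x := max V.x (sSup {T : ℕ | (1 - β) * V.w * T ≤ V.paidAfter T}) }

/-- How often the bids that affect scale `k` are to be halved so that they fit into the slack. -/
def halvings (V : VarView m) (Z k : ℕ) : ℕ :=
  min (Z + 1) (Nat.clog 2 ⌈8 * V.load k / V.slack k⌉₊)

/-- The largest number of halvings of the bid of constraint `i` required by a scale it affects. -/
def maxHalvings (V : VarView m) (Z : ℕ) (i : Fin m) : ℕ :=
  (Finset.Icc (V.scale i) V.topScale).sup fun k => V.halvings Z k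

/-- The invariant of the bidding process. No target is overpaid (`paid_le`), payments jump only at
the current targets (`flat`), the current bids of each scale use at most a quarter of its slack
(`safe`), and the value is the largest one that is paid for up to a fraction `β` of its price
(`unsat` and `sat`). -/
structure Valid (V : VarView m) (β : ℝ) : Prop where
  w_nonneg : 0 ≤ V.w
  paid_mono : Monotone V.paid
  paid_nonneg : ∀ T, 0 ≤ V.paid T
  paid_le : ∀ T, V.paid T ≤ V.w * T
  flat : ∀ ⦃T₁ T₂⦄, T₁ ≤ T₂ → V.x ≤ T₁ →
    (∀ k ≤ V.topScale, target k V.x ≤ T₂ → target k V.x ≤ T₁) → V.paid T₁ = V.paid T₂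
  safe : ∀ k ≤ V.topScale, 4 * V.load k ≤ V.slack k
  unsat : 0 < V.w → ∀ T, V.x < T → V.paid T < (1 - β) * V.w * T
  sat : (1 - β) * V.w * V.x ≤ V.paid V.x
  scale_le_topScale : ∀ i ∈ V.active, V.scale i ≤ V.topScale
  w_pos : V.active.Nonempty → 0 < V.w

/-- `V'` may follow `V` in the bidding process: all bids of `V` are settled, and then each remaining
bid is halved `maxHalvings` times and another `Z + 3` times for each unit by which its scale
drops. -/
structure IsSuccessor (V : VarView m) (β : ℝ) (Z : ℕ) (V' : VarView m) : Prop where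
  w_eq : V'.w = V.w
  x_eq : V'.x = (V.settle β).x
  paid_eq : V'.paid = V.paidAfter
  topScale_eq : V'.topScale = V.topScale
  active_subset : V'.active ⊆ V.active
  scale_le : ∀ i ∈ V'.active, V'.scale i ≤ V.scale i
  bidExp_le : ∀ i ∈ V'.active, V'.bidExp i ≤
    V.bidExp i - (V.settle β).maxHalvings Z i - ((Z : ℤ) + 3) * ((V.scale i : ℤ) - V'.scale i)

variable {V V' : VarView m} {β : ℝ} {a Z : ℕ} {r : Fin m → Prop}

theorem load_nonneg (V : VarView m) (k : ℕ) : 0 ≤ V.load k :=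
  Finset.sum_nonneg fun _ _ => by positivity

theorem le_load {i : Fin m} (hi : i ∈ V.active) {k : ℕ} (hk : V.scale i ≤ k) :
    (2 : ℝ) ^ V.bidExp i ≤ V.load k :=
  Finset.single_le_sum (f := fun i => (2 : ℝ) ^ V.bidExp i) (fun _ _ => by positivity)
    (Finset.mem_filter.2 ⟨hi, hk⟩)

theorem load_le_load_raise (V : VarView m) (a : ℕ) (r : Fin m → Prop) (k : ℕ) :
    V.load k ≤ (V.raise a r).load k := by
  refine Finset.sum_le_sum fun i _ => zpow_le_zpow_right₀ one_le_two ?_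
  dsimp only [raise]
  split_ifs <;> omega

theorem load_raise_le (V : VarView m) (a : ℕ) (r : Fin m → Prop) (k : ℕ) :
    (V.raise a r).load k ≤ 2 ^ a * V.load k := by
  rw [load, load, Finset.mul_sum]
  refine Finset.sum_le_sum fun i _ => ?_
  rw [← zpow_natCast, ← zpow_add₀ two_ne_zero]
  refine zpow_le_zpow_right₀ one_le_two ?_
  dsimp only [raise]
  split_ifs <;> omega

theorem load_raise_eq_of_forall_not {k : ℕ} (hk : ∀ i ∈ V.active, V.scale i ≤ k → ¬r i) :
    (V.raise a r).load k = V.load k := by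
  refine Finset.sum_congr rfl fun i hi => ?_
  obtain ⟨hi, hik⟩ := Finset.mem_filter.1 hi
  exact congrArg _ (if_neg fun hr => hk i hi hik hr.2)

theorem Valid.raise (h : V.Valid β) (hr : ∀ i ∈ V.active, r i → ¬V.Stuck a i) :
    (V.raise a r).Valid β where
  __ := h
  safe k hk := by
    change 4 * _ ≤ V.slack k
    by_cases hex : ∃ i ∈ V.active, V.scale i ≤ k ∧ r i
    · obtain ⟨i, hi, hik, hri⟩ := hex
      have hslack : 8 * 2 ^ a * V.load k ≤ V.slack k :=
        not_lt.1 fun hlt => hr i hi hri ⟨k, hik, hk, hlt⟩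
      linarith [load_raise_le V a r k, load_nonneg (V.raise a r) k]
    · push Not at hex
      rw [load_raise_eq_of_forall_not hex]
      exact h.safe k hk

theorem Valid.slack_le (h : V.Valid β) (k : ℕ) : V.slack k ≤ V.w * target k V.x :=
  sub_le_self _ (h.paid_nonneg _)

theorem Valid.slack_nonneg (h : V.Valid β) (k : ℕ) : 0 ≤ V.slack k :=
  sub_nonneg.2 (h.paid_le _)

theorem Valid.lt_slack (h : V.Valid β) (hw : 0 < V.w) (k : ℕ) :
    β * (V.w * target k V.x) < V.slack k := by
  have := h.unsat hw _ (lt_target k V.x)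
  unfold slack
  linarith

theorem paid_le_paidAfter (V : VarView m) (T : ℕ) : V.paid T ≤ V.paidAfter T :=
  le_add_of_nonneg_right (Finset.sum_nonneg fun _ _ => by positivity)

theorem paid_add_load_le_paidAfter (V : VarView m) (k : ℕ) :
    V.paid (target k V.x) + V.load k ≤ V.paidAfter (target k V.x) :=
  add_le_add_right (sum_two_zpow_mono
    (Finset.monotone_filter_right _ fun _ _ hi => target_mono_left hi _) _) _

theorem Valid.paidAfter_mono (h : V.Valid β) : Monotone V.paidAfter := fun _ _ hT =>
  add_le_add (h.paid_mono hT) (sum_two_zpow_mono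
    (Finset.monotone_filter_right _ fun _ _ hi => hi.trans hT) _)

theorem Valid.paidAfter_eq (h : V.Valid β) {T₁ T₂ : ℕ} (hT : T₁ ≤ T₂) (hx : V.x ≤ T₁)
    (hk : ∀ k ≤ V.topScale, target k V.x ≤ T₂ → target k V.x ≤ T₁) :
    V.paidAfter T₁ = V.paidAfter T₂ := by
  unfold paidAfter
  rw [h.flat hT hx hk, Finset.filter_congr fun i hi =>
    ⟨fun hi₁ => hi₁.trans hT, hk _ (h.scale_le_topScale i hi)⟩]

theorem Valid.paidAfter_le_add_slack (h : V.Valid β) {k : ℕ} (hk : k ≤ V.topScale) :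
    V.paidAfter (target k V.x) ≤ V.paid (target k V.x) + V.slack k / 4 := by
  -- Bids of a larger scale than `k` may have the same target: take the largest scale `l` with it.
  set l := Nat.findGreatest (fun l => target l V.x ≤ target k V.x) V.topScale
  have hkl : k ≤ l := Nat.le_findGreatest hk le_rfl
  have hltop : l ≤ V.topScale := Nat.findGreatest_le _
  have htarget : target l V.x = target k V.x :=
    le_antisymm (Nat.findGreatest_spec (P := fun l => target l V.x ≤ target k V.x) hk le_rfl)
      (target_mono_left hkl _)
  have hslack : V.slack l = V.slack k := by rw [slack, slack, htarget]
  have hload : ∑ i ∈ V.active with target (V.scale i) V.x ≤ target k V.x, (2 : ℝ) ^ V.bidExp i ≤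
      V.load l := by
    refine sum_two_zpow_mono (fun i hi => ?_) _
    rw [Finset.mem_filter] at hi ⊢
    exact ⟨hi.1, Nat.le_findGreatest (h.scale_le_topScale i hi.1) hi.2⟩
  have := h.safe l hltop
  unfold paidAfter
  linarith

theorem Valid.paidAfter_le (h : V.Valid β) (T : ℕ) : V.paidAfter T ≤ V.w * T := by
  rcases lt_or_ge V.x T with hT | hT
  · set l := Nat.findGreatest (fun k => target k V.x ≤ T) V.topScale
    have hltop : l ≤ V.topScale := Nat.findGreatest_le _
    have hlT : target l V.x ≤ T :=
      Nat.findGreatest_spec (P := fun k => target k V.x ≤ T) (Nat.zero_le _) (by simpa [target])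
    have heq : V.paidAfter (target l V.x) = V.paidAfter T :=
      h.paidAfter_eq hlT (lt_target l V.x).le fun k hk hkT =>
        target_mono_left (Nat.le_findGreatest hk hkT) _
    calc V.paidAfter T = V.paidAfter (target l V.x) := heq.symm
      _ ≤ V.paid (target l V.x) + V.slack l / 4 := h.paidAfter_le_add_slack hltop
      _ ≤ V.paid (target l V.x) + V.slack l := by linarith [h.slack_nonneg l]
      _ = V.w * target l V.x := add_sub_cancel _ _
      _ ≤ V.w * T := mul_le_mul_of_nonneg_left (by exact_mod_cast hlT) h.w_nonneg
  · have hnone : V.paidAfter T = V.paid T := by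
      rw [paidAfter, Finset.filter_false_of_mem, Finset.sum_empty, add_zero]
      exact fun i _ => not_le.2 (hT.trans_lt (lt_target _ _))
    exact hnone.trans_le (h.paid_le T)

theorem Valid.bddAbove_paidAfter (h : V.Valid β) (hw : 0 < V.w) (hβ : β < 1) :
    BddAbove {T : ℕ | (1 - β) * V.w * T ≤ V.paidAfter T} := by
  set B := V.paidAfter (target V.topScale V.x)
  have hbound : ∀ T, V.paidAfter T ≤ B := by
    intro T
    rcases le_total T (target V.topScale V.x) with hT | hT
    · exact h.paidAfter_mono hT
    · exact (h.paidAfter_eq hT (lt_target _ _).le fun k hk _ => target_mono_left hk _).ge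
  have hp : 0 < (1 - β) * V.w := mul_pos (by linarith) hw
  refine ⟨⌈B / ((1 - β) * V.w)⌉₊, fun T hT => ?_⟩
  rw [Set.mem_ofPred_eq] at hT
  have hTB : (T : ℝ) ≤ B / ((1 - β) * V.w) := by
    rw [le_div_iff₀ hp]
    linarith [hbound T]
  exact_mod_cast hTB.trans (Nat.le_ceil _)

theorem le_settle_x (V : VarView m) (β : ℝ) : V.x ≤ (V.settle β).x := le_max_left _ _

theorem slack_settle {k : ℕ} (hT : target k (V.settle β).x = target k V.x) :
    (V.settle β).slack k = V.w * target k V.x - V.paidAfter (target k V.x) := by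
  rw [slack, hT]
  rfl

theorem settle_slack_le {k : ℕ} (hT : target k (V.settle β).x = target k V.x) :
    (V.settle β).slack k ≤ V.slack k - V.load k := by
  rw [slack_settle hT, slack]
  linarith [paid_add_load_le_paidAfter V k]

theorem Valid.le_settle_slack (h : V.Valid β) {k : ℕ} (hk : k ≤ V.topScale)
    (hT : target k (V.settle β).x = target k V.x) :
    3 / 4 * V.slack k ≤ (V.settle β).slack k := by
  have := h.paidAfter_le_add_slack hk
  rw [slack_settle hT]
  unfold slack at this ⊢
  linarith

theorem Valid.paidAfter_lt_of_settle_x_lt (h : V.Valid β) (hβ : β < 1) (hw : 0 < V.w) {T : ℕ}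
    (hT : (V.settle β).x < T) : V.paidAfter T < (1 - β) * V.w * T := by
  by_contra! hc
  exact hT.not_ge ((le_csSup (h.bddAbove_paidAfter hw hβ) hc).trans (le_max_right _ _))

theorem Valid.le_paidAfter_settle_x (h : V.Valid β) (hβ : β < 1) :
    (1 - β) * V.w * (V.settle β).x ≤ V.paidAfter (V.settle β).x := by
  rcases h.w_nonneg.eq_or_lt with hw | hw
  · rw [← hw, mul_zero, zero_mul]
    exact (h.paid_nonneg _).trans (paid_le_paidAfter V _)
  · have hx : V.x ∈ {T : ℕ | (1 - β) * V.w * T ≤ V.paidAfter T} :=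
      h.sat.trans (paid_le_paidAfter V _)
    have hbdd := h.bddAbove_paidAfter hw hβ
    have hsup : (V.settle β).x = sSup {T : ℕ | (1 - β) * V.w * T ≤ V.paidAfter T} :=
      max_eq_right (le_csSup hbdd hx)
    rw [hsup]
    exact Nat.sSup_mem ⟨_, hx⟩ hbdd

theorem Valid.paidAfter_flat (h : V.Valid β) ⦃T₁ T₂ : ℕ⦄ (hT : T₁ ≤ T₂)
    (hx : (V.settle β).x ≤ T₁)
    (hk : ∀ k ≤ V.topScale, target k (V.settle β).x ≤ T₂ → target k (V.settle β).x ≤ T₁) :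
    V.paidAfter T₁ = V.paidAfter T₂ := by
  have hle := le_settle_x V β
  refine h.paidAfter_eq hT (hle.trans hx) fun k hkt hk₂ => ?_
  by_contra! hk₁
  have heq : target k (V.settle β).x = target k V.x := target_eq_of_lt hle (by omega)
  exact hk₁.not_ge (heq ▸ hk k hkt (heq ▸ hk₂))

theorem Valid.lt_settle_slack (h : V.Valid β) (hβ : β < 1) (hw : 0 < V.w) (k : ℕ) :
    β * (V.w * target k (V.settle β).x) < (V.settle β).slack k := by
  have := h.paidAfter_lt_of_settle_x_lt hβ hw (lt_target k (V.settle β).x)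
  change _ < V.w * _ - V.paidAfter _
  linarith

theorem Valid.half_pow_mul_le_settle_slack (h : V.Valid β) (hβ : β < 1)
    (hZ : (2 : ℝ)⁻¹ ^ Z ≤ β) (hw : 0 < V.w) (k : ℕ) :
    2⁻¹ ^ Z * (V.w * target k V.x) ≤ (V.settle β).slack k := by
  have hβ0 : 0 < β := lt_of_lt_of_le (by positivity) hZ
  have hT : (target k V.x : ℝ) ≤ target k (V.settle β).x := by
    exact_mod_cast target_mono_right k (le_settle_x V β)
  exact le_trans (by gcongr) (h.lt_settle_slack hβ hw k).le

theorem Valid.load_le_two_pow_halvings (h : V.Valid β) (hβ : β < 1) (hZ : (2 : ℝ)⁻¹ ^ Z ≤ β)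
    (hw : 0 < V.w) {k : ℕ} (hk : k ≤ V.topScale) :
    V.load k ≤ 2 ^ (V.settle β).halvings Z k * ((V.settle β).slack k / 8) := by
  have hcap := h.half_pow_mul_le_settle_slack hβ hZ hw k
  have hs : 0 < (V.settle β).slack k := by
    have : 0 < target k V.x := Nat.zero_lt_of_lt (lt_target k V.x)
    exact lt_of_lt_of_le (by positivity) hcap
  set q := 8 * V.load k / (V.settle β).slack k with hq
  have hq_le : q ≤ 2 ^ (Z + 1) := by
    rw [inv_pow, inv_mul_le_iff₀ (by positivity)] at hcap
    rw [hq, div_le_iff₀ hs, pow_succ]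
    linarith [h.safe k hk, h.slack_le k]
  have hcut : (V.settle β).halvings Z k = Nat.clog 2 ⌈q⌉₊ :=
    min_eq_right (Nat.clog_le_of_le_pow (Nat.ceil_le.2 (by exact_mod_cast hq_le)))
  have hpow : q ≤ 2 ^ Nat.clog 2 ⌈q⌉₊ :=
    (Nat.le_ceil _).trans (by exact_mod_cast Nat.le_pow_clog one_lt_two _)
  rw [hq, div_le_iff₀ hs] at hpow
  rw [hcut]
  linarith

theorem Valid.sum_bids_of_scale_le (h : V.Valid β) (hβ : β < 1) (hZ : (2 : ℝ)⁻¹ ^ Z ≤ β)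
    (hw : 0 < V.w) {k l : ℕ} (hkl : k < l) (hl : l ≤ V.topScale) :
    ∑ i ∈ V.active with V.scale i = l, (2 : ℝ) ^ (V.bidExp i - ((Z : ℤ) + 3) * ((l : ℤ) - k)) ≤
      (V.settle β).slack k / 4 * 4⁻¹ ^ (l - k) := by
  set d := l - k
  have hd1 : 1 ≤ d := Nat.sub_pos_of_lt hkl
  have hcast : (l : ℤ) - k = d := (Nat.cast_sub hkl.le).symm
  have hload : ∑ i ∈ V.active with V.scale i = l,
      (2 : ℝ) ^ (V.bidExp i - ((Z : ℤ) + 3) * ((l : ℤ) - k)) ≤ 2⁻¹ ^ ((Z + 3) * d) * V.load l := by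
    have hfactor : ∀ i, (2 : ℝ) ^ (V.bidExp i - ((Z : ℤ) + 3) * ((l : ℤ) - k)) =
        2⁻¹ ^ ((Z + 3) * d) * 2 ^ V.bidExp i := fun i => by
      rw [hcast, zpow_sub₀ two_ne_zero, div_eq_inv_mul, inv_pow, ← zpow_natCast]
      push_cast
      rfl
    rw [Finset.sum_congr rfl fun i _ => hfactor i, ← Finset.mul_sum]
    exact mul_le_mul_of_nonneg_left (sum_two_zpow_mono
      (Finset.monotone_filter_right _ fun _ _ hi => hi.le) _) (by positivity)
  have hload_le : V.load l ≤ 2 ^ d * (V.w * target k V.x) / 4 := by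
    have htarget : (target l V.x : ℝ) ≤ 2 ^ d * target k V.x := by
      exact_mod_cast target_le_pow_mul hkl.le V.x
    linarith [h.safe l hl, h.slack_le l, mul_le_mul_of_nonneg_left htarget hw.le]
  calc _ ≤ 2⁻¹ ^ ((Z + 3) * d) * V.load l := hload
    _ ≤ 2⁻¹ ^ ((Z + 3) * d) * (2 ^ d * (V.w * target k V.x) / 4) := by gcongr
    _ = (2⁻¹ ^ ((Z + 3) * d) * 2 ^ d) * (V.w * target k V.x) / 4 := by ring
    _ ≤ (2⁻¹ ^ Z * 4⁻¹ ^ d) * (V.w * target k V.x) / 4 := by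
      gcongr ?_ * _ / 4
      exact half_pow_mul_two_pow_le Z hd1
    _ = (2⁻¹ ^ Z * (V.w * target k V.x)) / 4 * 4⁻¹ ^ d := by ring
    _ ≤ _ := by
      gcongr
      exact h.half_pow_mul_le_settle_slack hβ hZ hw k

theorem Valid.sum_bids_of_scale_gt_le (h : V.Valid β) (hβ : β < 1) (hZ : (2 : ℝ)⁻¹ ^ Z ≤ β)
    (hw : 0 < V.w) (k : ℕ) :
    ∑ i ∈ V.active with k < V.scale i,
        (2 : ℝ) ^ (V.bidExp i - ((Z : ℤ) + 3) * ((V.scale i : ℤ) - k)) ≤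
      (V.settle β).slack k / 8 := by
  have hmaps : ∀ i ∈ V.active.filter (fun i => k < V.scale i),
      V.scale i ∈ Finset.Ioc k V.topScale := fun i hi => by
    rw [Finset.mem_filter] at hi
    exact Finset.mem_Ioc.2 ⟨hi.2, h.scale_le_topScale i hi.1⟩
  have hscale : ∀ l ∈ Finset.Ioc k V.topScale,
      ∑ i ∈ V.active.filter (fun i => k < V.scale i) with V.scale i = l,
        (2 : ℝ) ^ (V.bidExp i - ((Z : ℤ) + 3) * ((V.scale i : ℤ) - k)) ≤
      (V.settle β).slack k / 4 * 4⁻¹ ^ (l - k) := by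
    intro l hl
    obtain ⟨hkl, hl⟩ := Finset.mem_Ioc.1 hl
    refine le_trans (le_of_eq ?_) (h.sum_bids_of_scale_le hβ hZ hw hkl hl)
    rw [Finset.filter_filter, Finset.filter_congr fun i _ =>
      (⟨And.right, fun hi => ⟨hi ▸ hkl, hi⟩⟩ : k < V.scale i ∧ V.scale i = l ↔ V.scale i = l)]
    exact Finset.sum_congr rfl fun i hi => by rw [(Finset.mem_filter.1 hi).2]
  have hs : 0 ≤ (V.settle β).slack k :=
    le_trans (by positivity) (h.half_pow_mul_le_settle_slack hβ hZ hw k)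
  calc _ ≤ ∑ l ∈ Finset.Ioc k V.topScale, (V.settle β).slack k / 4 * 4⁻¹ ^ (l - k) := by
        rw [← Finset.sum_fiberwise_of_maps_to hmaps]
        exact Finset.sum_le_sum hscale
    _ ≤ (V.settle β).slack k / 4 * (1 / 2) := by
        rw [← Finset.mul_sum]
        exact mul_le_mul_of_nonneg_left (sum_Ioc_quarter_pow_le k V.topScale) (by positivity)
    _ = _ := by ring

theorem IsSuccessor.slack_eq (hV : V.IsSuccessor β Z V') (k : ℕ) :
    V'.slack k = (V.settle β).slack k := by
  rw [slack, hV.w_eq, hV.x_eq, hV.paid_eq]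
  rfl

theorem IsSuccessor.load_le (hV : V.IsSuccessor β Z V') {k : ℕ} (hk : k ≤ V.topScale) :
    V'.load k ≤ (2 ^ (V.settle β).halvings Z k)⁻¹ * V.load k +
      ∑ i ∈ V.active with k < V.scale i,
        (2 : ℝ) ^ (V.bidExp i - ((Z : ℤ) + 3) * ((V.scale i : ℤ) - k)) := by
  rw [load, ← Finset.sum_filter_add_sum_filter_not _ (fun i => V.scale i ≤ k)]
  refine add_le_add ?_ ?_
  · rw [load, Finset.mul_sum]
    refine (Finset.sum_le_sum fun i hi => ?_).trans
      (Finset.sum_le_sum_of_subset_of_nonneg (fun i hi => ?_) fun _ _ _ => by positivity)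
    · simp only [Finset.mem_filter] at hi
      have hcut : (V.settle β).halvings Z k ≤ (V.settle β).maxHalvings Z i :=
        Finset.le_sup (f := fun k => (V.settle β).halvings Z k) (Finset.mem_Icc.2 ⟨hi.2, hk⟩)
      have hdrop : 0 ≤ ((Z : ℤ) + 3) * ((V.scale i : ℤ) - V'.scale i) :=
        mul_nonneg (by omega) (by have := hV.scale_le i hi.1.1; omega)
      rw [← zpow_natCast, ← zpow_neg, ← zpow_add₀ two_ne_zero]
      refine zpow_le_zpow_right₀ one_le_two ?_
      have := hV.bidExp_le i hi.1.1
      omega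
    · simp only [Finset.mem_filter] at hi ⊢
      exact ⟨hV.active_subset hi.1.1, hi.2⟩
  · refine (Finset.sum_le_sum fun i hi => zpow_le_zpow_right₀ one_le_two ?_).trans
      (sum_two_zpow_mono (fun i hi => ?_) _)
    · simp only [Finset.mem_filter] at hi
      have hdrop : ((Z : ℤ) + 3) * ((V.scale i : ℤ) - k) ≤
          ((Z : ℤ) + 3) * ((V.scale i : ℤ) - V'.scale i) :=
        mul_le_mul_of_nonneg_left (by omega) (by omega)
      have := hV.bidExp_le i hi.1.1
      omega
    · simp only [Finset.mem_filter, not_le] at hi ⊢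
      exact ⟨hV.active_subset hi.1.1, hi.2⟩

theorem Valid.safe_of_isSuccessor (h : V.Valid β) (hβ : β < 1) (hZ : (2 : ℝ)⁻¹ ^ Z ≤ β)
    (hV : V.IsSuccessor β Z V') {k : ℕ} (hk : k ≤ V.topScale) : 4 * V'.load k ≤ V'.slack k := by
  rcases V'.active.eq_empty_or_nonempty with hempty | hne
  · have hload : V'.load k = 0 := by rw [load, hempty, Finset.filter_empty, Finset.sum_empty]
    rw [hload, mul_zero, slack, hV.w_eq, hV.paid_eq]
    exact sub_nonneg.2 (h.paidAfter_le _)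
  · have hw : 0 < V.w := h.w_pos (hne.mono hV.active_subset)
    have hstay : (2 ^ (V.settle β).halvings Z k)⁻¹ * V.load k ≤ (V.settle β).slack k / 8 := by
      rw [inv_mul_le_iff₀ (by positivity)]
      exact h.load_le_two_pow_halvings hβ hZ hw hk
    rw [hV.slack_eq]
    linarith [hV.load_le hk, h.sum_bids_of_scale_gt_le hβ hZ hw k]

theorem Valid.of_isSuccessor (h : V.Valid β) (hβ : β < 1) (hZ : (2 : ℝ)⁻¹ ^ Z ≤ β)
    (hV : V.IsSuccessor β Z V') : V'.Valid β where
  w_nonneg := hV.w_eq ▸ h.w_nonneg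
  paid_mono := hV.paid_eq ▸ h.paidAfter_mono
  paid_nonneg T := by
    rw [hV.paid_eq]
    exact (h.paid_nonneg T).trans (paid_le_paidAfter V T)
  paid_le := by
    rw [hV.paid_eq, hV.w_eq]
    exact h.paidAfter_le
  flat := by
    rw [hV.paid_eq, hV.x_eq, hV.topScale_eq]
    exact h.paidAfter_flat
  safe k hk := h.safe_of_isSuccessor hβ hZ hV (hV.topScale_eq ▸ hk)
  unsat := by
    rw [hV.w_eq, hV.paid_eq, hV.x_eq]
    exact fun hw T hT => h.paidAfter_lt_of_settle_x_lt hβ hw hT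
  sat := by
    rw [hV.w_eq, hV.paid_eq, hV.x_eq]
    exact h.le_paidAfter_settle_x hβ
  scale_le_topScale i hi := by
    rw [hV.topScale_eq]
    exact (hV.scale_le i hi).trans (h.scale_le_topScale i (hV.active_subset hi))
  w_pos hne := hV.w_eq ▸ h.w_pos (hne.mono hV.active_subset)

end VarView

/-! ### The bidding process -/

/-- Parameters of the bidding process: a bound `F` on the rank, the tolerance `β ≥ 2 ^ (-Z)`, and
the number `K` of bits of the input numbers. -/
structure BidParams where
  F : ℕ
  Z : ℕ
  K : ℕ
  β : ℝ

/-- The global state of the bidding process: the values of the variables, the total payments to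
each variable for targets up to a given one, and the exponents of the current bids. -/
structure BidState (n m : ℕ) where
  x : Fin n → ℕ
  paid : Fin n → ℕ → ℝ
  bidExp : Fin m → ℤ

/-- The scale at which a constraint of residual `ρ` bids for a variable with coefficient `a`: if
all its at most `F` variables are raised by `2 ^ scaleOf F ρ a`, the constraint is about to be
satisfied. -/
def scaleOf (F : ℕ) (ρ a : ℝ) : ℕ := Nat.log 2 ⌊ρ / (F * a)⌋₊

/-- The initial value of a variable of weight `w`. A variable that costs nothing starts at a value
that satisfies all its constraints. -/
def startValue (K : ℕ) (w : ℝ) : ℕ := if w = 0 then 2 ^ (2 * K) else 0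

/-- How often a bid `2 ^ K` is to be halved so that `deg` of them use up at most a quarter of the
weight `w`. -/
def startReduction (K deg : ℕ) (w : ℝ) : ℕ := Nat.clog 2 ⌈4 * deg * 2 ^ K / w⌉₊

theorem le_two_pow_startReduction (K deg : ℕ) (w : ℝ) :
    4 * deg * 2 ^ K / w ≤ (2 : ℝ) ^ startReduction K deg w := by
  unfold startReduction
  exact (Nat.le_ceil _).trans (mod_cast Nat.le_pow_clog one_lt_two ⌈4 * deg * 2 ^ K / w⌉₊)

theorem scaleOf_mono {F : ℕ} {ρ ρ' a : ℝ} (ha : 0 ≤ a) (h : ρ ≤ ρ') :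
    scaleOf F ρ a ≤ scaleOf F ρ' a :=
  Nat.log_mono_right (Nat.floor_mono (by gcongr))

theorem lt_two_pow_scaleOf {F : ℕ} {ρ a : ℝ} (hF : 0 < F) (ha : 0 < a) :
    ρ < 2 ^ (scaleOf F ρ a + 1) * (F * a) := by
  rw [← div_lt_iff₀ (by positivity)]
  exact (Nat.lt_floor_add_one _).trans_le
    (by exact_mod_cast Nat.lt_pow_succ_log_self one_lt_two _)

theorem two_pow_scaleOf_le_max (F : ℕ) (ρ a : ℝ) :
    (2 : ℝ) ^ scaleOf F ρ a ≤ max 1 (ρ / (F * a)) := by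
  rcases Nat.eq_zero_or_pos ⌊ρ / (F * a)⌋₊ with h0 | hpos
  · rw [scaleOf, h0, Nat.log_zero_right, pow_zero]
    exact le_max_left _ _
  · refine le_max_of_le_right (le_trans ?_ (Nat.floor_le (Nat.pos_of_floor_pos hpos).le))
    exact_mod_cast Nat.pow_log_le_self 2 hpos.ne'

theorem mul_two_pow_scaleOf_sub_one_lt {F : ℕ} {ρ a : ℝ} (hF : 0 < F) (ha : 0 < a) (hρ : 0 < ρ) :
    a * (2 ^ scaleOf F ρ a - 1) < ρ / F := by
  have hdiv : ρ / F = a * (ρ / (F * a)) := by field_simp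
  have hratio : 0 < ρ / (F * a) := by positivity
  rw [hdiv]
  gcongr
  exact sub_lt_iff_lt_add.2 ((two_pow_scaleOf_le_max F ρ a).trans_lt
    (max_lt (by linarith) (by linarith)))

theorem two_pow_scaleOf_le {F : ℕ} {ρ a M : ℝ} (hF : 0 < F) (hρ : ρ / a ≤ M) (hM : 1 ≤ M) :
    (2 : ℝ) ^ scaleOf F ρ a ≤ M := by
  refine (two_pow_scaleOf_le_max F ρ a).trans (max_le hM ?_)
  rw [mul_comm, ← div_div]
  exact div_le_of_le_mul₀ (by positivity) (by linarith)
    (hρ.trans (le_mul_of_one_le_right (by linarith) (by exact_mod_cast hF)))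

namespace CoveringILP

variable {n m : ℕ}

/-- The amount by which `x` violates constraint `i`; the constraint is active as long as it is
positive. -/
def residual (P : CoveringILP m n) (x : Fin n → ℕ) (i : Fin m) : ℝ :=
  P.b i - ∑ j, P.A i j * (x j : ℝ)

/-- The variables of constraint `i`. -/
def row (P : CoveringILP m n) (i : Fin m) : Finset (Fin n) := {j | P.A i j ≠ 0}

/-- The constraints of variable `j`. -/
def col (P : CoveringILP m n) (j : Fin n) : Finset (Fin m) := {i | P.A i j ≠ 0}

/-- The scale at which constraint `i` bids for variable `j` when the values are `x`. -/
def scale (P : CoveringILP m n) (θ : BidParams) (x : Fin n → ℕ) (i : Fin m) (j : Fin n) : ℕ :=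
  scaleOf θ.F (P.residual x i) (P.A i j)

/-- The active constraints of variable `j`. -/
def active (P : CoveringILP m n) (x : Fin n → ℕ) (j : Fin n) : Finset (Fin m) :=
  {i | P.A i j ≠ 0 ∧ 0 < P.residual x i}

/-- The initial state of the bidding process. -/
def start (P : CoveringILP m n) (θ : BidParams) : BidState n m where
  x j := startValue θ.K (P.w j)
  paid _ _ := 0
  bidExp i := θ.K - ((P.row i).sup fun j => startReduction θ.K (P.col j).card (P.w j) : ℕ)

/-- The largest scale at which a constraint ever bids for variable `j`. -/
def topScale (P : CoveringILP m n) (θ : BidParams) (j : Fin n) : ℕ :=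
  (P.active (P.start θ).x j).sup fun i => P.scale θ (P.start θ).x i j

/-- What variable `j` sees of the global state. The entries of satisfied constraints are `0`, so
that two views are equal as soon as they agree on the active constraints. -/
def view (P : CoveringILP m n) (θ : BidParams) (g : BidState n m) (j : Fin n) : VarView m where
  w := P.w j
  x := g.x j
  paid := g.paid j
  topScale := P.topScale θ j
  active := P.active g.x j
  bidExp i := if i ∈ P.active g.x j then g.bidExp i else 0
  scale i := if i ∈ P.active g.x j then P.scale θ g.x i j else 0

/-- Constraint `i` multiplies its bid by `2 ^ a`, as none of its variables objects. -/
def Raises (P : CoveringILP m n) (θ : BidParams) (g : BidState n m) (a : ℕ) (i : Fin m) : Prop :=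
  ∀ j ∈ P.row i, ¬(P.view θ g j).Stuck a i

open Classical in
/-- The exponent of the bid that constraint `i` pays in an iteration. -/
def bid (P : CoveringILP m n) (θ : BidParams) (g : BidState n m) (a : ℕ) (i : Fin m) : ℤ :=
  if P.Raises θ g a i then g.bidExp i + a else g.bidExp i

/-- The view of variable `j` when the bids have been raised. -/
def raised (P : CoveringILP m n) (θ : BidParams) (g : BidState n m) (a : ℕ) (j : Fin n) :
    VarView m :=
  (P.view θ g j).raise a (P.Raises θ g a)

/-- The view of variable `j` when the bids have been raised and paid. -/
def settled (P : CoveringILP m n) (θ : BidParams) (g : BidState n m) (a : ℕ) (j : Fin n) :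
    VarView m :=
  (P.raised θ g a j).settle θ.β

/-- How often constraint `i` halves its bid because the slack of a variable has become too small. -/
def rowHalvings (P : CoveringILP m n) (θ : BidParams) (g : BidState n m) (a : ℕ) (i : Fin m) : ℕ :=
  (P.row i).sup fun j => (P.settled θ g a j).maxHalvings θ.Z i

/-- One iteration of the bidding process: the bids are multiplied by `2 ^ a` where possible and
paid, and then lowered as much as the slacks and the scales require. -/
def step (P : CoveringILP m n) (θ : BidParams) (a : ℕ) (g : BidState n m) : BidState n m where
  x j := (P.settled θ g a j).x
  paid j := (P.settled θ g a j).paid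
  bidExp i := P.bid θ g a i - P.rowHalvings θ g a i - ((θ.Z : ℤ) + 3) * ∑ j ∈ P.row i,
    ((P.scale θ g.x i j : ℤ) - P.scale θ (fun j => (P.settled θ g a j).x) i j)

/-- The bidding process in which iteration `t` tries to multiply all bids by `2 ^ a t`. -/
def bidRun (P : CoveringILP m n) (θ : BidParams) (a : ℕ → ℕ) : ℕ → BidState n m
  | 0 => P.start θ
  | t + 1 => P.step θ (a t) (P.bidRun θ a t)

/-- The sum of all bids paid in the first `t` iterations. -/
def totalPaid (P : CoveringILP m n) (θ : BidParams) (a : ℕ → ℕ) (t : ℕ) : ℝ :=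
  ∑ s ∈ Finset.range t, ∑ i with 0 < P.residual (P.bidRun θ a s).x i,
    (2 : ℝ) ^ P.bid θ (P.bidRun θ a s) (a s) i

/-- The parameters fit the covering program. -/
structure Fits (P : CoveringILP m n) (θ : BidParams) : Prop where
  F_pos : 0 < θ.F
  row_card_le : ∀ i, (P.row i).card ≤ θ.F
  β_lt : θ.β < 1
  Z_le : (2 : ℝ)⁻¹ ^ θ.Z ≤ θ.β
  b_le : ∀ i j, P.A i j ≠ 0 → P.b i ≤ P.A i j * 2 ^ (2 * θ.K)
  w_le : ∀ j, P.w j ≤ 2 ^ θ.K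

variable {P : CoveringILP m n} {θ : BidParams} {a : ℕ → ℕ}

theorem A_pos (P : CoveringILP m n) {i : Fin m} {j : Fin n} (h : P.A i j ≠ 0) : 0 < P.A i j :=
  (P.A_nonneg i j).lt_of_ne' h

theorem mem_row {i : Fin m} {j : Fin n} : j ∈ P.row i ↔ P.A i j ≠ 0 := by simp [row]

theorem mem_col {i : Fin m} {j : Fin n} : i ∈ P.col j ↔ P.A i j ≠ 0 := by simp [col]

theorem mem_active {x : Fin n → ℕ} {i : Fin m} {j : Fin n} :
    i ∈ P.active x j ↔ P.A i j ≠ 0 ∧ 0 < P.residual x i := by simp [active]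

theorem residual_anti {x y : Fin n → ℕ} (h : x ≤ y) (i : Fin m) :
    P.residual y i ≤ P.residual x i :=
  sub_le_sub_left (Finset.sum_le_sum fun j _ =>
    mul_le_mul_of_nonneg_left (by exact_mod_cast h j) (P.A_nonneg i j)) _

theorem residual_le_sub (P : CoveringILP m n) (x : Fin n → ℕ) (i : Fin m) (j : Fin n) :
    P.residual x i ≤ P.b i - P.A i j * x j :=
  sub_le_sub_left (Finset.single_le_sum (f := fun j => P.A i j * (x j : ℝ))
    (fun j _ => mul_nonneg (P.A_nonneg i j) (Nat.cast_nonneg _)) (Finset.mem_univ j)) _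

theorem residual_le (P : CoveringILP m n) (x : Fin n → ℕ) (i : Fin m) : P.residual x i ≤ P.b i :=
  sub_le_self _ (Finset.sum_nonneg fun j _ => mul_nonneg (P.A_nonneg i j) (Nat.cast_nonneg _))

theorem scale_anti {x y : Fin n → ℕ} (h : x ≤ y) (i : Fin m) (j : Fin n) :
    P.scale θ y i j ≤ P.scale θ x i j :=
  scaleOf_mono (P.A_nonneg i j) (residual_anti h i)

theorem active_anti {x y : Fin n → ℕ} (h : x ≤ y) (j : Fin n) : P.active y j ⊆ P.active x j := by
  intro i
  simp only [mem_active]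
  exact And.imp_right fun hi => hi.trans_le (residual_anti h i)

theorem le_step_x (P : CoveringILP m n) (θ : BidParams) (a : ℕ) (g : BidState n m) :
    g.x ≤ (P.step θ a g).x :=
  fun j => VarView.le_settle_x (P.raised θ g a j) θ.β

theorem bidRun_x_mono (P : CoveringILP m n) (θ : BidParams) (a : ℕ → ℕ) :
    Monotone fun t => (P.bidRun θ a t).x :=
  monotone_nat_of_le_succ fun t => P.le_step_x θ (a t) (P.bidRun θ a t)

theorem view_bidExp {g : BidState n m} {j : Fin n} {i : Fin m} (hi : i ∈ P.active g.x j) :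
    (P.view θ g j).bidExp i = g.bidExp i := if_pos hi

theorem view_scale {g : BidState n m} {j : Fin n} {i : Fin m} (hi : i ∈ P.active g.x j) :
    (P.view θ g j).scale i = P.scale θ g.x i j := if_pos hi

open Classical in
theorem raised_bidExp {g : BidState n m} {j : Fin n} {i : Fin m} (hi : i ∈ P.active g.x j) (a : ℕ) :
    (P.raised θ g a j).bidExp i = P.bid θ g a i := by
  change (if i ∈ P.active g.x j ∧ P.Raises θ g a i then _ else _) = _
  rw [view_bidExp hi, bid]
  exact if_congr (and_iff_right hi) rfl rfl

theorem raised_scale {g : BidState n m} {j : Fin n} {i : Fin m} (hi : i ∈ P.active g.x j) (a : ℕ) :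
    (P.raised θ g a j).scale i = P.scale θ g.x i j := view_scale hi

theorem Fits.w_pos (h : P.Fits θ) {x : Fin n → ℕ} (hx : (P.start θ).x ≤ x) {i : Fin m} {j : Fin n}
    (hi : i ∈ P.active x j) : 0 < P.w j := by
  rw [mem_active] at hi
  refine (P.w_nonneg j).lt_of_ne' fun hw => ?_
  have hstart : ((P.start θ).x j : ℝ) = 2 ^ (2 * θ.K) := by simp [start, startValue, hw]
  have hres := P.residual_le_sub (P.start θ).x i j
  rw [hstart] at hres
  linarith [hi.2, h.b_le i j hi.1, residual_anti hx i (P := P)]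

theorem start_bid_le {i : Fin m} {j : Fin n} (hij : P.A i j ≠ 0) (hw : 0 < P.w j) :
    (2 : ℝ) ^ (P.start θ).bidExp i ≤ P.w j / (4 * (P.col j).card) := by
  have hdeg : (0 : ℝ) < (P.col j).card := by
    exact_mod_cast Finset.card_pos.2 ⟨i, mem_col.2 hij⟩
  have hsup : startReduction θ.K (P.col j).card (P.w j) ≤
      (P.row i).sup fun j => startReduction θ.K (P.col j).card (P.w j) :=
    Finset.le_sup (f := fun j => startReduction θ.K (P.col j).card (P.w j)) (mem_row.2 hij)
  calc (2 : ℝ) ^ (P.start θ).bidExp i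
      ≤ (2 : ℝ) ^ ((θ.K : ℤ) - (startReduction θ.K (P.col j).card (P.w j) : ℕ)) := by
        refine zpow_le_zpow_right₀ one_le_two ?_
        dsimp only [start]
        omega
    _ = 2 ^ θ.K / 2 ^ startReduction θ.K (P.col j).card (P.w j) := by
        rw [zpow_sub₀ two_ne_zero, zpow_natCast, zpow_natCast]
    _ ≤ P.w j / (4 * (P.col j).card) := by
        have := le_two_pow_startReduction θ.K (P.col j).card (P.w j)
        rw [div_le_iff₀ hw] at this
        rw [div_le_div_iff₀ (by positivity) (by positivity)]
        linarith

theorem Fits.start_load_le (h : P.Fits θ) (j : Fin n) (k : ℕ) :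
    (P.view θ (P.start θ) j).load k ≤ P.w j / 4 := by
  have hbid : ∀ i ∈ P.active (P.start θ).x j,
      (2 : ℝ) ^ (P.view θ (P.start θ) j).bidExp i ≤ P.w j / (4 * (P.col j).card) := fun i hi => by
    rw [view_bidExp hi]
    exact start_bid_le (mem_active.1 hi).1 (h.w_pos le_rfl hi)
  have hw := P.w_nonneg j
  calc (P.view θ (P.start θ) j).load k
      ≤ ∑ i ∈ P.active (P.start θ).x j, (2 : ℝ) ^ (P.view θ (P.start θ) j).bidExp i :=
        sum_two_zpow_mono (Finset.filter_subset _ _) _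
    _ ≤ ∑ i ∈ P.active (P.start θ).x j, P.w j / (4 * (P.col j).card) := Finset.sum_le_sum hbid
    _ ≤ ∑ i ∈ P.col j, P.w j / (4 * (P.col j).card) :=
        Finset.sum_le_sum_of_subset_of_nonneg
          (fun i hi => mem_col.2 (mem_active.1 hi).1) fun _ _ _ => by positivity
    _ = P.w j / 4 * ((P.col j).card / (P.col j).card) := by
        rw [Finset.sum_const, nsmul_eq_mul, ← div_div]
        ring
    _ ≤ P.w j / 4 := mul_le_of_le_one_right (by positivity) (div_self_le_one _)

theorem Fits.valid_start (h : P.Fits θ) (j : Fin n) : (P.view θ (P.start θ) j).Valid θ.β where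
  w_nonneg := P.w_nonneg j
  paid_mono _ _ _ := le_rfl
  paid_nonneg _ := le_rfl
  paid_le T := mul_nonneg (P.w_nonneg j) (Nat.cast_nonneg T)
  flat _ _ _ _ _ := rfl
  safe k _ := by
    have htarget : (1 : ℝ) ≤ target k ((P.start θ).x j) := by
      exact_mod_cast Nat.zero_lt_of_lt (lt_target k _)
    change _ ≤ P.w j * (target k ((P.start θ).x j) : ℝ) - 0
    linarith [h.start_load_le j k, le_mul_of_one_le_right (P.w_nonneg j) htarget]
  unsat hw T hT := by
    have hT : (0 : ℝ) < T := by exact_mod_cast Nat.zero_lt_of_lt hT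
    exact mul_pos (mul_pos (sub_pos.2 h.β_lt) hw) hT
  sat := by
    change (1 - θ.β) * P.w j * (startValue θ.K (P.w j) : ℝ) ≤ 0
    unfold startValue
    split_ifs with hw <;> simp [hw]
  scale_le_topScale i hi := by
    rw [view_scale hi]
    exact Finset.le_sup (f := fun i => P.scale θ (P.start θ).x i j) hi
  w_pos := fun ⟨_, hi⟩ => h.w_pos le_rfl hi

theorem valid_raised {g : BidState n m} {j : Fin n} (h : (P.view θ g j).Valid θ.β) (a : ℕ) :
    (P.raised θ g a j).Valid θ.β :=
  h.raise fun _ hi hr => hr j (mem_row.2 (mem_active.1 hi).1)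

theorem isSuccessor_view_step (P : CoveringILP m n) (θ : BidParams) (g : BidState n m) (a : ℕ)
    (j : Fin n) : (P.raised θ g a j).IsSuccessor θ.β θ.Z (P.view θ (P.step θ a g) j) where
  w_eq := rfl
  x_eq := rfl
  paid_eq := rfl
  topScale_eq := rfl
  active_subset := active_anti (P.le_step_x θ a g) j
  scale_le i hi := by
    rw [raised_scale (active_anti (P.le_step_x θ a g) j hi), view_scale hi]
    exact scale_anti (P.le_step_x θ a g) i j
  bidExp_le i hi := by
    have hij : j ∈ P.row i := mem_row.2 (mem_active.1 hi).1
    have hi' := active_anti (P.le_step_x θ a g) j hi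
    rw [raised_scale hi', raised_bidExp hi', view_scale hi, view_bidExp hi]
    have hhalvings : (P.settled θ g a j).maxHalvings θ.Z i ≤ P.rowHalvings θ g a i :=
      Finset.le_sup (f := fun j => (P.settled θ g a j).maxHalvings θ.Z i) hij
    have hdrop : (P.scale θ g.x i j : ℤ) - P.scale θ (P.step θ a g).x i j ≤
        ∑ j ∈ P.row i, ((P.scale θ g.x i j : ℤ) - P.scale θ (P.step θ a g).x i j) :=
      Finset.single_le_sum (f := fun j => (P.scale θ g.x i j : ℤ) - P.scale θ (P.step θ a g).x i j)
        (fun j _ => sub_nonneg.2 (by exact_mod_cast scale_anti (P.le_step_x θ a g) i j)) hij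
    change P.bid θ g a i - (P.rowHalvings θ g a i : ℤ) - _ ≤
      _ - ((P.settled θ g a j).maxHalvings θ.Z i : ℤ) - _
    gcongr
    exact hdrop

theorem Fits.valid (h : P.Fits θ) (a : ℕ → ℕ) (t : ℕ) (j : Fin n) :
    (P.view θ (P.bidRun θ a t) j).Valid θ.β := by
  induction t with
  | zero => exact h.valid_start j
  | succ t ih =>
    exact (valid_raised ih (a t)).of_isSuccessor h.β_lt h.Z_le (P.isSuccessor_view_step θ _ _ j)

theorem step_paid (P : CoveringILP m n) (θ : BidParams) (g : BidState n m) (a : ℕ) (j : Fin n)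
    (T : ℕ) : (P.step θ a g).paid j T = g.paid j T +
      ∑ i ∈ P.active g.x j with target (P.scale θ g.x i j) (g.x j) ≤ T,
        (2 : ℝ) ^ P.bid θ g a i := by
  change g.paid j T + ∑ i ∈ P.active g.x j with target ((P.raised θ g a j).scale i) (g.x j) ≤ T,
    (2 : ℝ) ^ (P.raised θ g a j).bidExp i = _
  rw [Finset.filter_congr fun i hi => by rw [raised_scale hi],
    Finset.sum_congr rfl fun i hi => by rw [raised_bidExp (Finset.mem_filter.1 hi).1]]

theorem sum_step_paid (P : CoveringILP m n) (θ : BidParams) (g : BidState n m) (a : ℕ)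
    (T : Fin n → ℕ) : ∑ j, (P.step θ a g).paid j (T j) = ∑ j, g.paid j (T j) +
      ∑ i with 0 < P.residual g.x i,
        ((P.row i).filter fun j => target (P.scale θ g.x i j) (g.x j) ≤ T j).card *
          (2 : ℝ) ^ P.bid θ g a i := by
  simp only [step_paid, Finset.sum_add_distrib, active, row, Finset.filter_filter,
    ← nsmul_eq_mul, ← Finset.sum_const]
  congr 1
  exact Finset.sum_comm' (by simp only [Finset.mem_univ, Finset.mem_filter, true_and]; tauto)

theorem totalPaid_succ (P : CoveringILP m n) (θ : BidParams) (a : ℕ → ℕ) (t : ℕ) :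
    P.totalPaid θ a (t + 1) = P.totalPaid θ a t +
      ∑ i with 0 < P.residual (P.bidRun θ a t).x i,
        (2 : ℝ) ^ P.bid θ (P.bidRun θ a t) (a t) i :=
  Finset.sum_range_succ _ _

theorem Fits.sum_scale_lt_residual (h : P.Fits θ) {x : Fin n → ℕ} {i : Fin m}
    (hx : 0 < P.residual x i) :
    ∑ j ∈ P.row i, P.A i j * ((2 : ℝ) ^ P.scale θ x i j - 1) < P.residual x i := by
  rcases (P.row i).eq_empty_or_nonempty with he | hne
  · rwa [he, Finset.sum_empty]
  · have hF : (0 : ℝ) < θ.F := by exact_mod_cast h.F_pos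
    calc _ < ∑ _j ∈ P.row i, P.residual x i / θ.F :=
          Finset.sum_lt_sum_of_nonempty hne fun _ hj =>
            mul_two_pow_scaleOf_sub_one_lt h.F_pos (P.A_pos (mem_row.1 hj)) hx
      _ = (P.row i).card * (P.residual x i / θ.F) := by rw [Finset.sum_const, nsmul_eq_mul]
      _ ≤ θ.F * (P.residual x i / θ.F) := by
          have : ((P.row i).card : ℝ) ≤ θ.F := by exact_mod_cast h.row_card_le i
          gcongr
      _ = P.residual x i := mul_div_cancel₀ _ hF.ne'

theorem Fits.exists_target_le (h : P.Fits θ) {x y : Fin n → ℕ} {i : Fin m}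
    (hx : 0 < P.residual x i) (hy : P.residual y i ≤ 0) :
    ∃ j ∈ P.row i, target (P.scale θ x i j) (x j) ≤ y j := by
  by_contra! hc
  have hsum : ∑ j, P.A i j * (y j : ℝ) ≤ ∑ j, P.A i j * (x j : ℝ) +
      ∑ j ∈ P.row i, P.A i j * ((2 : ℝ) ^ P.scale θ x i j - 1) := by
    rw [row, Finset.sum_filter, ← Finset.sum_add_distrib]
    refine Finset.sum_le_sum fun j _ => ?_
    split_ifs with hj
    · have hyj : (y j : ℝ) + 1 ≤ x j + 2 ^ P.scale θ x i j := by
        exact_mod_cast (hc j (mem_row.2 hj)).trans_le (target_le (P.scale θ x i j) (x j))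
      rw [← mul_add]
      exact mul_le_mul_of_nonneg_left (by linarith) (P.A_nonneg i j)
    · simp [not_not.1 hj]
  have := h.sum_scale_lt_residual hx
  unfold residual at hx hy this
  linarith

theorem Fits.totalPaid_le (h : P.Fits θ) {y : Fin n → ℕ} (hy : P.Feasible y) (t : ℕ) :
    P.totalPaid θ a t ≤ ∑ j, (P.bidRun θ a t).paid j (y j) := by
  induction t with
  | zero => simp [totalPaid, bidRun, start]
  | succ t ih =>
    rw [totalPaid_succ, bidRun, sum_step_paid]
    refine add_le_add ih (Finset.sum_le_sum fun i hi => ?_)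
    obtain ⟨j, hj, hjy⟩ := h.exists_target_le (y := y) (Finset.mem_filter.1 hi).2
      (sub_nonpos.2 (hy i))
    refine le_mul_of_one_le_left (by positivity) ?_
    exact_mod_cast Finset.card_pos.2 ⟨j, Finset.mem_filter.2 ⟨hj, hjy⟩⟩

theorem Fits.sum_paid_le (h : P.Fits θ) (T : Fin n → ℕ) (t : ℕ) :
    ∑ j, (P.bidRun θ a t).paid j (T j) ≤ θ.F * P.totalPaid θ a t := by
  induction t with
  | zero => simp [totalPaid, bidRun, start]
  | succ t ih =>
    rw [totalPaid_succ, bidRun, sum_step_paid, mul_add, Finset.mul_sum]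
    refine add_le_add ih (Finset.sum_le_sum fun i _ => ?_)
    gcongr
    exact (Finset.card_filter_le _ _).trans (h.row_card_le i)

theorem Fits.cost_le (h : P.Fits θ) (a : ℕ → ℕ) {y : Fin n → ℕ} (hy : P.Feasible y) (t : ℕ) :
    (1 - θ.β) * P.cost (P.bidRun θ a t).x ≤ θ.F * P.cost y := by
  unfold cost
  calc (1 - θ.β) * ∑ j, P.w j * ((P.bidRun θ a t).x j : ℝ)
      = ∑ j, (1 - θ.β) * P.w j * ((P.bidRun θ a t).x j : ℝ) := by
        simp only [Finset.mul_sum, mul_assoc]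
    _ ≤ ∑ j, (P.bidRun θ a t).paid j ((P.bidRun θ a t).x j) :=
        Finset.sum_le_sum fun j _ => (h.valid a t j).sat
    _ ≤ θ.F * P.totalPaid θ a t := h.sum_paid_le _ t
    _ ≤ θ.F * ∑ j, (P.bidRun θ a t).paid j (y j) := by
        gcongr
        exact h.totalPaid_le hy t
    _ ≤ θ.F * ∑ j, P.w j * (y j : ℝ) := by
        gcongr with j
        exact (h.valid a t j).paid_le (y j)

end CoveringILP

/-! ### Progress of the payments -/

theorem sum_ite_sub_le {p : ℕ → Prop} [DecidablePred p] (hp : ∀ t, p t → p (t + 1))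
    {y : ℕ → ℝ} {B : ℝ} (h0 : ∀ t, 0 ≤ y t) (hB : ∀ t, y t ≤ B) (τ : ℕ) :
    ∑ t ∈ Finset.range τ, (if p t then y (t + 1) - y t else 0) ≤ B := by
  refine le_trans ?_ (hB τ)
  induction τ with
  | zero => simpa using h0 0
  | succ τ ih =>
    rw [Finset.sum_range_succ]
    by_cases h : p τ
    · rw [if_pos h]
      linarith
    · have hnot : ∀ t ∈ Finset.range τ, ¬p t := fun t ht hpt =>
        h (Nat.le_induction hpt (fun k _ => hp k) τ (Finset.mem_range.1 ht).le)
      rw [if_neg h, Finset.sum_eq_zero fun t ht => if_neg (hnot t ht), add_zero]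
      exact h0 _

theorem sum_ite_half_pow_le (s N : ℕ) :
    ∑ k ∈ Finset.range N, (if s ≤ k then ((2 : ℝ) ^ k)⁻¹ else 0) ≤ 2 * ((2 : ℝ) ^ s)⁻¹ := by
  suffices h : ∑ k ∈ Finset.range N, (if s ≤ k then ((2 : ℝ) ^ k)⁻¹ else 0) ≤
      2 * ((2 : ℝ) ^ s)⁻¹ - (if s ≤ N then 2 * ((2 : ℝ) ^ N)⁻¹ else 0) by
    refine h.trans (sub_le_self _ ?_)
    split_ifs <;> positivity
  induction N with
  | zero =>
    rcases Nat.eq_zero_or_pos s with rfl | hs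
    · simp
    · simp [hs.ne']
  | succ N ih =>
    rw [Finset.sum_range_succ]
    rcases le_or_gt s N with hs | hs
    · rw [if_pos hs] at ih
      rw [if_pos hs, if_pos (by omega), pow_succ, mul_inv]
      linarith
    · rw [Finset.sum_eq_zero fun k hk => if_neg (by have := Finset.mem_range.1 hk; omega),
        if_neg (by omega), add_zero]
      split_ifs with h
      · rw [show s = N + 1 by omega, sub_self]
      · rw [sub_zero]
        positivity

theorem sub_div_le_two_mul_log_sub_log {u v : ℝ} (hu : 1 ≤ u) (hv : 0 ≤ v) (hvu : v ≤ u) :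
    (u - v) / u ≤ 2 * (Real.log (1 + u) - Real.log (1 + v)) := by
  have hlog : 1 - ((1 + u) / (1 + v))⁻¹ ≤ Real.log (1 + u) - Real.log (1 + v) := by
    rw [← Real.log_div (by linarith) (by linarith)]
    exact Real.one_sub_inv_le_log_of_pos (by positivity)
  calc (u - v) / u ≤ 2 * (u - v) / (1 + u) := by
        rw [div_le_div_iff₀ (by linarith) (by linarith)]
        nlinarith
    _ = 2 * (1 - ((1 + u) / (1 + v))⁻¹) := by
        rw [inv_div, one_sub_div (by linarith), ← mul_div_assoc]
        ring
    _ ≤ _ := by linarith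

theorem log_one_add_le_one_add_logb {M : ℝ} (hM : 1 ≤ M) :
    Real.log (1 + M) ≤ 1 + Real.logb 2 M := by
  have hlog2 := Real.log_two_lt_d9
  have hlogM : Real.log M ≤ Real.logb 2 M :=
    le_div_self (Real.log_nonneg hM) (Real.log_pos one_lt_two) (by linarith)
  calc Real.log (1 + M) ≤ Real.log (2 * M) := Real.log_le_log (by linarith) (by linarith)
    _ = Real.log 2 + Real.log M := Real.log_mul two_ne_zero (by linarith)
    _ ≤ _ := by linarith

theorem log_div_mem_Icc {W s β : ℝ} {Z : ℕ} (hZ : (2 : ℝ)⁻¹ ^ Z ≤ β) (hW : 0 < W)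
    (hs : β * W < s) (hsW : s ≤ W) : Real.log (W / s) ∈ Set.Icc 0 (Z : ℝ) := by
  have hβ : 0 < β := lt_of_lt_of_le (by positivity) hZ
  have hs0 : 0 < s := lt_trans (by positivity) hs
  refine ⟨Real.log_nonneg ((one_le_div hs0).2 hsW), ?_⟩
  have hWs : W / s ≤ 2 ^ Z := by
    rw [div_le_iff₀ hs0, ← inv_mul_le_iff₀ (by positivity), ← inv_pow]
    exact (mul_le_mul_of_nonneg_right hZ hW.le).trans hs.le
  calc Real.log (W / s) ≤ Real.log (2 ^ Z) := Real.log_le_log (by positivity) hWs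
    _ = Z * Real.log 2 := Real.log_pow _ _
    _ ≤ Z := mul_le_of_le_one_right (Nat.cast_nonneg _) (by linarith [Real.log_two_lt_d9])

namespace VarView

variable {m : ℕ} {V : VarView m} {β : ℝ} {a Z k : ℕ}

/-- The logarithm of the inverse of the fraction of the price at scale `k` that is still unpaid. -/
def depth (V : VarView m) (k : ℕ) : ℝ := Real.log (V.w * target k V.x / V.slack k)

/-- Whether the target of scale `k` changes when the bids are settled. -/
def renewal (V : VarView m) (β : ℝ) (k : ℕ) : ℝ :=
  if target k (V.settle β).x = target k V.x then 0 else 1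

/-- The progress at scale `k` made by settling the bids: the change of the depth, where a renewal
of the target makes up for the loss of the depth reached so far and counts for `Z + 1` in
addition. -/
def progress (V : VarView m) (β : ℝ) (Z k : ℕ) : ℝ :=
  (V.settle β).depth k - V.depth k + V.renewal β k * (2 * Z + 1)

theorem price_pos (hw : 0 < V.w) (k : ℕ) : 0 < V.w * target k V.x :=
  mul_pos hw (by exact_mod_cast Nat.zero_lt_of_lt (lt_target k V.x))

theorem Valid.slack_pos (h : V.Valid β) (hβ : 0 ≤ β) (hw : 0 < V.w) (k : ℕ) : 0 < V.slack k :=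
  (mul_nonneg hβ (price_pos hw k).le).trans_lt (h.lt_slack hw k)

theorem Valid.settle_slack_pos (h : V.Valid β) (hβ : β < 1) (hβ0 : 0 ≤ β) (hw : 0 < V.w) (k : ℕ) :
    0 < (V.settle β).slack k :=
  (mul_nonneg hβ0 (price_pos (V := V.settle β) hw k).le).trans_lt (h.lt_settle_slack hβ hw k)

theorem Valid.depth_mem_Icc (h : V.Valid β) (hZ : (2 : ℝ)⁻¹ ^ Z ≤ β) (hw : 0 < V.w) (k : ℕ) :
    V.depth k ∈ Set.Icc 0 (Z : ℝ) :=
  log_div_mem_Icc hZ (price_pos hw k) (h.lt_slack hw k) (h.slack_le k)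

theorem Valid.settle_depth_nonneg (h : V.Valid β) (hβ : β < 1) (hβ0 : 0 ≤ β) (hw : 0 < V.w)
    (k : ℕ) : 0 ≤ (V.settle β).depth k :=
  Real.log_nonneg ((one_le_div (h.settle_slack_pos hβ hβ0 hw k)).2
    (sub_le_self _ ((h.paid_nonneg _).trans (paid_le_paidAfter V _))))

theorem progress_of_target_eq (hT : target k (V.settle β).x = target k V.x) :
    V.progress β Z k = (V.settle β).depth k - V.depth k := by
  rw [progress, renewal, if_pos hT, zero_mul, add_zero]

theorem Valid.load_div_slack_le_progress (h : V.Valid β) (hβ : β < 1) (hβ0 : 0 ≤ β) (hw : 0 < V.w)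
    (hT : target k (V.settle β).x = target k V.x) :
    V.load k / V.slack k ≤ V.progress β Z k := by
  have hs := h.slack_pos hβ0 hw k
  have hs' := h.settle_slack_pos hβ hβ0 hw k
  have hp := (price_pos hw k).ne'
  calc V.load k / V.slack k ≤ 1 - (V.slack k / (V.settle β).slack k)⁻¹ := by
        rw [inv_div, one_sub_div hs.ne']
        exact div_le_div_of_nonneg_right (by linarith [settle_slack_le hT]) hs.le
    _ ≤ Real.log (V.slack k / (V.settle β).slack k) :=
        Real.one_sub_inv_le_log_of_pos (div_pos hs hs')
    _ = V.progress β Z k := by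
        rw [progress_of_target_eq hT, depth, depth, hT]
        change _ = Real.log (V.w * _ / _) - _
        rw [Real.log_div hp hs'.ne', Real.log_div hp hs.ne', Real.log_div hs.ne' hs'.ne']
        ring

theorem Valid.add_one_le_progress (h : V.Valid β) (hβ : β < 1) (hZ : (2 : ℝ)⁻¹ ^ Z ≤ β)
    (hw : 0 < V.w) (hT : target k (V.settle β).x ≠ target k V.x) :
    Z + 1 ≤ V.progress β Z k := by
  have hβ0 : 0 ≤ β := le_trans (by positivity) hZ
  rw [progress, renewal, if_neg hT]
  linarith [(h.depth_mem_Icc hZ hw k).2, h.settle_depth_nonneg hβ hβ0 hw k]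

theorem Valid.progress_nonneg (h : V.Valid β) (hβ : β < 1) (hZ : (2 : ℝ)⁻¹ ^ Z ≤ β) (hw : 0 < V.w)
    (k : ℕ) : 0 ≤ V.progress β Z k := by
  have hβ0 : 0 ≤ β := le_trans (by positivity) hZ
  by_cases hT : target k (V.settle β).x = target k V.x
  · exact (div_nonneg (load_nonneg V k) (h.slack_nonneg k)).trans
      (h.load_div_slack_le_progress hβ hβ0 hw hT)
  · exact le_trans (by positivity) (h.add_one_le_progress hβ hZ hw hT)

theorem halvings_eq_zero (hs : 0 < V.slack k) (hl : 8 * V.load k ≤ V.slack k) :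
    V.halvings Z k = 0 := by
  have hceil : ⌈8 * V.load k / V.slack k⌉₊ ≤ 1 := by
    rwa [Nat.ceil_le, Nat.cast_one, div_le_one hs]
  rw [halvings, Nat.clog_of_right_le_one hceil, Nat.min_zero]

theorem halvings_le_two (hs : 0 < V.slack k) (hl : 2 * V.load k ≤ V.slack k) :
    V.halvings Z k ≤ 2 := by
  refine (min_le_right _ _).trans (Nat.clog_le_of_le_pow (Nat.ceil_le.2 ?_))
  rw [div_le_iff₀ hs]
  push_cast
  linarith

theorem Valid.halvings_le_progress (h : V.Valid β) (hβ : β < 1) (hZ : (2 : ℝ)⁻¹ ^ Z ≤ β)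
    (hw : 0 < V.w) (hk : k ≤ V.topScale) :
    ((V.settle β).halvings Z k : ℝ) ≤ 22 * V.progress β Z k := by
  have hβ0 : 0 ≤ β := le_trans (by positivity) hZ
  have hprogress := h.progress_nonneg hβ hZ hw k
  by_cases hT : target k (V.settle β).x = target k V.x
  · have hs := h.slack_pos hβ0 hw k
    have hs' := h.settle_slack_pos hβ hβ0 hw k
    have hslack := h.le_settle_slack hk hT
    rcases le_or_gt (8 * V.load k) ((V.settle β).slack k) with hl | hl
    · rw [halvings_eq_zero hs' hl, Nat.cast_zero]
      positivity
    · have htwo : (V.settle β).halvings Z k ≤ 2 :=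
        halvings_le_two hs' (show 2 * V.load k ≤ _ by linarith [h.safe k hk])
      have hratio : 3 / 32 ≤ V.load k / V.slack k := by
        rw [le_div_iff₀ hs]
        linarith
      calc ((V.settle β).halvings Z k : ℝ) ≤ 2 := by exact_mod_cast htwo
        _ ≤ 22 * (V.load k / V.slack k) := by linarith
        _ ≤ 22 * V.progress β Z k := by
            gcongr
            exact h.load_div_slack_le_progress hβ hβ0 hw hT
  · have hmin : (V.settle β).halvings Z k ≤ Z + 1 := min_le_left _ _
    have hmin : ((V.settle β).halvings Z k : ℝ) ≤ Z + 1 := by exact_mod_cast hmin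
    linarith [h.add_one_le_progress hβ hZ hw hT]

theorem Valid.inv_two_pow_le_progress (h : V.Valid β) (hβ : β < 1) (hZ : (2 : ℝ)⁻¹ ^ Z ≤ β)
    (hw : 0 < V.w) (hst : V.slack k < 8 * 2 ^ a * V.load k) :
    ((2 : ℝ) ^ a)⁻¹ ≤ 8 * V.progress β Z k := by
  have hβ0 : 0 ≤ β := le_trans (by positivity) hZ
  by_cases hT : target k (V.settle β).x = target k V.x
  · have hratio : ((2 : ℝ) ^ a)⁻¹ ≤ 8 * (V.load k / V.slack k) := by
      rw [inv_le_iff_one_le_mul₀ (by positivity), ← mul_div_assoc, mul_comm, mul_div_assoc',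
        le_div_iff₀ (h.slack_pos hβ0 hw k)]
      linarith
    linarith [h.load_div_slack_le_progress (Z := Z) hβ hβ0 hw hT]
  · have hpow : ((2 : ℝ) ^ a)⁻¹ ≤ 1 := inv_le_one_of_one_le₀ (one_le_pow₀ one_le_two)
    linarith [h.add_one_le_progress hβ hZ hw hT, Z.cast_nonneg (α := ℝ)]

end VarView

namespace CoveringILP

variable {n m : ℕ} {P : CoveringILP m n} {θ : BidParams} {a : ℕ → ℕ}

theorem one_le_maxRatio (P : CoveringILP m n) : 1 ≤ P.maxRatio := le_max_left _ _

theorem div_le_maxRatio (P : CoveringILP m n) {i : Fin m} {j : Fin n} (h : P.A i j ≠ 0) :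
    P.b i / P.A i j ≤ P.maxRatio := by
  have hfin : {r : ℝ | ∃ i j, P.A i j ≠ 0 ∧ r = P.b i / P.A i j}.Finite := by
    refine (Set.finite_range fun p : Fin m × Fin n => P.b p.1 / P.A p.1 p.2).subset ?_
    rintro _ ⟨i, j, -, rfl⟩
    exact ⟨(i, j), rfl⟩
  exact (le_csSup hfin.bddAbove ⟨i, j, h, rfl⟩).trans (le_max_right _ _)

theorem col_card_le_maxDegree (P : CoveringILP m n) (j : Fin n) :
    (P.col j).card ≤ P.maxDegree := by
  refine le_of_eq_of_le ?_ (Finset.le_sup (f := fun j => {i | P.A i j ≠ 0}.ncard)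
    (Finset.mem_univ j))
  rw [← Set.ncard_coe_finset, col, Finset.coe_filter_univ]

theorem logb_maxRatio_nonneg (P : CoveringILP m n) : 0 ≤ Real.logb 2 P.maxRatio :=
  Real.logb_nonneg one_lt_two P.one_le_maxRatio

/-- The rank of the vertex cover problem that arises when a variable is replaced by one vertex for
each of its at most `1 + log M` scales. -/
def expandedRank (P : CoveringILP m n) (θ : BidParams) : ℝ :=
  θ.F * (1 + Real.logb 2 P.maxRatio)

theorem expandedRank_nonneg (P : CoveringILP m n) (θ : BidParams) : 0 ≤ P.expandedRank θ :=
  mul_nonneg (Nat.cast_nonneg _) (by linarith [P.logb_maxRatio_nonneg])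

theorem Fits.sum_row_le_expandedRank (h : P.Fits θ) {i : Fin m} {g : Fin n → ℝ}
    (hg : ∀ j ∈ P.row i, g j ≤ 1 + Real.logb 2 P.maxRatio) :
    ∑ j ∈ P.row i, g j ≤ P.expandedRank θ := by
  have hcard : ((P.row i).card : ℝ) ≤ θ.F := by exact_mod_cast h.row_card_le i
  refine (Finset.sum_le_card_nsmul _ _ _ hg).trans ?_
  rw [nsmul_eq_mul]
  exact mul_le_mul_of_nonneg_right hcard (by linarith [P.logb_maxRatio_nonneg])

theorem two_pow_scale_le (P : CoveringILP m n) (hF : 0 < θ.F) (x : Fin n → ℕ) {i : Fin m}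
    {j : Fin n} (hij : P.A i j ≠ 0) : (2 : ℝ) ^ P.scale θ x i j ≤ P.maxRatio :=
  two_pow_scaleOf_le hF ((div_le_div_of_nonneg_right (P.residual_le x i) (P.A_nonneg i j)).trans
    (P.div_le_maxRatio hij)) P.one_le_maxRatio

theorem scale_le_logb (P : CoveringILP m n) (hF : 0 < θ.F) (x : Fin n → ℕ) {i : Fin m} {j : Fin n}
    (hij : P.A i j ≠ 0) : (P.scale θ x i j : ℝ) ≤ Real.logb 2 P.maxRatio := by
  rw [Real.le_logb_iff_rpow_le one_lt_two (by linarith [P.one_le_maxRatio]), Real.rpow_natCast]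
  exact P.two_pow_scale_le hF x hij

theorem topScale_le_logb (P : CoveringILP m n) (hF : 0 < θ.F) (j : Fin n) :
    (P.topScale θ j : ℝ) ≤ Real.logb 2 P.maxRatio := by
  rw [← Nat.le_floor_iff P.logb_maxRatio_nonneg]
  exact Finset.sup_le fun i hi => Nat.le_floor (P.scale_le_logb hF _ (mem_active.1 hi).1)

/-- The potential of constraint `i`, which decreases with its residual. -/
def potential (P : CoveringILP m n) (x : Fin n → ℕ) (i : Fin m) : ℝ :=
  Real.log (1 + P.maxRatio * P.residual x i / P.b i)

theorem b_pos {x : Fin n → ℕ} {i : Fin m} (hi : 0 < P.residual x i) : 0 < P.b i :=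
  hi.trans_le (P.residual_le x i)

theorem potential_nonneg {x : Fin n → ℕ} {i : Fin m} (hi : 0 < P.residual x i) :
    0 ≤ P.potential x i := by
  have hM := P.one_le_maxRatio
  have hb := b_pos hi
  exact Real.log_nonneg (le_add_of_nonneg_right (by positivity))

theorem potential_le {x : Fin n → ℕ} {i : Fin m} (hi : 0 < P.residual x i) :
    P.potential x i ≤ 1 + Real.logb 2 P.maxRatio := by
  have hM := P.one_le_maxRatio
  have hb := b_pos hi
  refine le_trans (Real.log_le_log (by positivity) ?_) (log_one_add_le_one_add_logb hM)
  rw [add_le_add_iff_left, div_le_iff₀ hb]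
  exact mul_le_mul_of_nonneg_left (P.residual_le x i) (by positivity)

theorem residual_sub_residual (P : CoveringILP m n) (x y : Fin n → ℕ) (i : Fin m) :
    P.residual x i - P.residual y i = ∑ j ∈ P.row i, P.A i j * ((y j : ℝ) - x j) := by
  rw [row, Finset.sum_filter_of_ne fun j _ => left_ne_zero_of_mul]
  simp only [residual, mul_sub, Finset.sum_sub_distrib]
  ring

theorem b_le_maxRatio_mul_residual_sub {x y : Fin n → ℕ} (hxy : x ≤ y) {i : Fin m}
    (hne : P.residual x i ≠ P.residual y i) :
    P.b i ≤ P.maxRatio * (P.residual x i - P.residual y i) := by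
  obtain ⟨j, hj, hlt⟩ : ∃ j ∈ P.row i, x j < y j := by
    by_contra! hle
    refine hne (sub_eq_zero.1 ((P.residual_sub_residual x y i).trans
      (Finset.sum_eq_zero fun j hj => ?_)))
    rw [(hxy j).antisymm (hle j hj), sub_self, mul_zero]
  have hA := P.A_pos (mem_row.1 hj)
  have hinc : (1 : ℝ) ≤ y j - x j := by
    rw [le_sub_iff_add_le']
    exact_mod_cast hlt
  have hterm : P.A i j * ((y j : ℝ) - x j) ≤ P.residual x i - P.residual y i := by
    rw [residual_sub_residual]
    exact Finset.single_le_sum (f := fun j => P.A i j * ((y j : ℝ) - x j)) (fun j _ =>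
      mul_nonneg (P.A_nonneg i j) (sub_nonneg.2 (by exact_mod_cast hxy j))) hj
  calc P.b i ≤ P.maxRatio * P.A i j := (div_le_iff₀ hA).1 (P.div_le_maxRatio (mem_row.1 hj))
    _ ≤ P.maxRatio * (P.residual x i - P.residual y i) := by
        gcongr
        · linarith [P.one_le_maxRatio]
        · exact (le_mul_of_one_le_right hA.le hinc).trans hterm

theorem residual_sub_div_le_potential_sub {x y : Fin n → ℕ} (hxy : x ≤ y) {i : Fin m}
    (hy : 0 < P.residual y i) :
    (P.residual x i - P.residual y i) / P.residual x i ≤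
      2 * (P.potential x i - P.potential y i) := by
  have hle := residual_anti (P := P) hxy i
  have hx := hy.trans_le hle
  have hb := b_pos hx
  have hM : 0 < P.maxRatio := by linarith [P.one_le_maxRatio]
  rcases eq_or_ne (P.residual x i) (P.residual y i) with heq | hne
  · simp [potential, heq]
  · have hstep := b_le_maxRatio_mul_residual_sub hxy hne
    have hu : 1 ≤ P.maxRatio * P.residual x i / P.b i := by
      rw [one_le_div hb]
      linarith [mul_pos hM hy]
    refine le_of_eq_of_le ?_ (sub_div_le_two_mul_log_sub_log hu
      (v := P.maxRatio * P.residual y i / P.b i) (by positivity) (by gcongr))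
    field_simp

/-- The depth of the payments to variable `j` at scale `k` before iteration `t`. -/
def depthAt (P : CoveringILP m n) (θ : BidParams) (a : ℕ → ℕ) (j : Fin n) (k t : ℕ) : ℝ :=
  (P.view θ (P.bidRun θ a t) j).depth k

/-- Whether the target of scale `k` at variable `j` changes in iteration `t`. -/
def renewal (P : CoveringILP m n) (θ : BidParams) (a : ℕ → ℕ) (j : Fin n) (k t : ℕ) : ℝ :=
  (P.raised θ (P.bidRun θ a t) (a t) j).renewal θ.β k

/-- The progress at scale `k` of variable `j` in iteration `t`. -/
def progress (P : CoveringILP m n) (θ : BidParams) (a : ℕ → ℕ) (j : Fin n) (k t : ℕ) : ℝ :=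
  (P.raised θ (P.bidRun θ a t) (a t) j).progress θ.β θ.Z k

/-- The total progress in iteration `t` at the scales that bids of constraint `i` affect. -/
def rowProgress (P : CoveringILP m n) (θ : BidParams) (a : ℕ → ℕ) (i : Fin m) (t : ℕ) : ℝ :=
  ∑ j ∈ P.row i, ∑ k ∈ Finset.range (P.topScale θ j + 1),
    if P.scale θ (P.bidRun θ a t).x i j ≤ k then P.progress θ a j k t else 0

theorem progress_eq (P : CoveringILP m n) (θ : BidParams) (a : ℕ → ℕ) (j : Fin n) (k t : ℕ) :
    P.progress θ a j k t =
      P.depthAt θ a j k (t + 1) - P.depthAt θ a j k t + P.renewal θ a j k t * (2 * θ.Z + 1) :=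
  rfl

theorem Fits.w_pos_of_mem_row (h : P.Fits θ) {t : ℕ} {i : Fin m}
    (hi : 0 < P.residual (P.bidRun θ a t).x i) {j : Fin n} (hj : j ∈ P.row i) : 0 < P.w j :=
  h.w_pos (P.bidRun_x_mono θ a (Nat.zero_le t)) (mem_active.2 ⟨mem_row.1 hj, hi⟩)

theorem Fits.ite_progress_nonneg (h : P.Fits θ) {t : ℕ} {i : Fin m}
    (hi : 0 < P.residual (P.bidRun θ a t).x i) {j : Fin n} (hj : j ∈ P.row i) (k : ℕ) :
    0 ≤ if P.scale θ (P.bidRun θ a t).x i j ≤ k then P.progress θ a j k t else 0 := by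
  split_ifs
  · exact (valid_raised (h.valid a t j) (a t)).progress_nonneg h.β_lt h.Z_le
      (h.w_pos_of_mem_row hi hj) k
  · exact le_rfl

theorem Fits.rowProgress_nonneg (h : P.Fits θ) {t : ℕ} {i : Fin m}
    (hi : 0 < P.residual (P.bidRun θ a t).x i) : 0 ≤ P.rowProgress θ a i t :=
  Finset.sum_nonneg fun _ hj => Finset.sum_nonneg fun k _ => h.ite_progress_nonneg hi hj k

theorem Fits.progress_le_rowProgress (h : P.Fits θ) {t : ℕ} {i : Fin m}
    (hi : 0 < P.residual (P.bidRun θ a t).x i) {j : Fin n} (hj : j ∈ P.row i) {k : ℕ}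
    (hk : k ≤ P.topScale θ j) (hs : P.scale θ (P.bidRun θ a t).x i j ≤ k) :
    P.progress θ a j k t ≤ P.rowProgress θ a i t := by
  calc P.progress θ a j k t
      = if P.scale θ (P.bidRun θ a t).x i j ≤ k then P.progress θ a j k t else 0 := (if_pos hs).symm
    _ ≤ ∑ k ∈ Finset.range (P.topScale θ j + 1),
        if P.scale θ (P.bidRun θ a t).x i j ≤ k then P.progress θ a j k t else 0 :=
        Finset.single_le_sum (f := fun k => if P.scale θ (P.bidRun θ a t).x i j ≤ k then
          P.progress θ a j k t else 0) (fun k _ => h.ite_progress_nonneg hi hj k)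
          (Finset.mem_range.2 (Nat.lt_succ_of_le hk))
    _ ≤ P.rowProgress θ a i t :=
        Finset.single_le_sum (f := fun j => ∑ k ∈ Finset.range (P.topScale θ j + 1),
          if P.scale θ (P.bidRun θ a t).x i j ≤ k then P.progress θ a j k t else 0)
          (fun _ hj => Finset.sum_nonneg fun k _ => h.ite_progress_nonneg hi hj k) hj

theorem Fits.rowHalvings_le (h : P.Fits θ) {t : ℕ} {i : Fin m}
    (hi : 0 < P.residual (P.bidRun θ a t).x i) :
    (P.rowHalvings θ (P.bidRun θ a t) (a t) i : ℝ) ≤ 22 * P.rowProgress θ a i t := by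
  rw [← Nat.le_floor_iff (mul_nonneg (by norm_num) (h.rowProgress_nonneg hi))]
  refine Finset.sup_le fun j hj => Finset.sup_le fun k hk => Nat.le_floor ?_
  obtain ⟨hsk, hk⟩ : P.scale θ (P.bidRun θ a t).x i j ≤ k ∧ k ≤ P.topScale θ j := by
    rw [← raised_scale (mem_active.2 ⟨mem_row.1 hj, hi⟩) (a t)]
    exact Finset.mem_Icc.1 hk
  exact ((valid_raised (h.valid a t j) (a t)).halvings_le_progress h.β_lt h.Z_le
    (h.w_pos_of_mem_row hi hj) hk).trans
    (mul_le_mul_of_nonneg_left (h.progress_le_rowProgress hi hj hk hsk) (by norm_num))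

theorem Fits.inv_two_pow_le (h : P.Fits θ) {t : ℕ} {i : Fin m}
    (hi : 0 < P.residual (P.bidRun θ a t).x i) (hr : ¬P.Raises θ (P.bidRun θ a t) (a t) i) :
    ((2 : ℝ) ^ a t)⁻¹ ≤ 8 * P.rowProgress θ a i t := by
  unfold Raises at hr
  push Not at hr
  obtain ⟨j, hj, k, hsk, hk, hstuck⟩ := hr
  rw [view_scale (mem_active.2 ⟨mem_row.1 hj, hi⟩)] at hsk
  have hload := (P.view θ (P.bidRun θ a t) j).load_le_load_raise (a t)
    (P.Raises θ (P.bidRun θ a t) (a t)) k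
  have hstuck' : (P.raised θ (P.bidRun θ a t) (a t) j).slack k <
      8 * 2 ^ a t * (P.raised θ (P.bidRun θ a t) (a t) j).load k :=
    hstuck.trans_le (mul_le_mul_of_nonneg_left hload (by positivity))
  exact ((valid_raised (h.valid a t j) (a t)).inv_two_pow_le_progress h.β_lt h.Z_le
    (h.w_pos_of_mem_row hi hj) hstuck').trans
    (mul_le_mul_of_nonneg_left (h.progress_le_rowProgress hi hj hk hsk) (by norm_num))

theorem renewal_le (P : CoveringILP m n) (θ : BidParams) (a : ℕ → ℕ) (j : Fin n) (k t : ℕ) :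
    P.renewal θ a j k t ≤ (((P.bidRun θ a (t + 1)).x j / 2 ^ k : ℕ) : ℝ) -
      (((P.bidRun θ a t).x j / 2 ^ k : ℕ) : ℝ) := by
  have hdiv : (P.bidRun θ a t).x j / 2 ^ k ≤ (P.bidRun θ a (t + 1)).x j / 2 ^ k :=
    Nat.div_le_div_right (P.bidRun_x_mono θ a (Nat.le_succ t) j)
  change (if target k ((P.bidRun θ a (t + 1)).x j) = target k ((P.bidRun θ a t).x j)
    then (0 : ℝ) else 1) ≤ _
  rw [le_sub_iff_add_le]
  split_ifs with heq
  · rw [target_eq_iff_div_eq.1 heq, zero_add]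
  · rw [add_comm]
    exact_mod_cast hdiv.lt_of_ne' (mt target_eq_iff_div_eq.2 heq)

theorem scale_le_succ (P : CoveringILP m n) (θ : BidParams) (a : ℕ → ℕ) (i : Fin m) (j : Fin n)
    (k t : ℕ) (h : P.scale θ (P.bidRun θ a t).x i j ≤ k) :
    P.scale θ (P.bidRun θ a (t + 1)).x i j ≤ k :=
  (scale_anti (P.bidRun_x_mono θ a (Nat.le_succ t)) i j).trans h

/-- The amount by which variable `j` is raised in iteration `t`. -/
def increment (P : CoveringILP m n) (θ : BidParams) (a : ℕ → ℕ) (j : Fin n) (t : ℕ) : ℝ :=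
  ((P.bidRun θ a (t + 1)).x j : ℝ) - (P.bidRun θ a t).x j

theorem increment_nonneg (P : CoveringILP m n) (θ : BidParams) (a : ℕ → ℕ) (j : Fin n) (t : ℕ) :
    0 ≤ P.increment θ a j t :=
  sub_nonneg.2 (by exact_mod_cast P.bidRun_x_mono θ a (Nat.le_succ t) j)

theorem sum_renewal_le (P : CoveringILP m n) (θ : BidParams) (a : ℕ → ℕ) (i : Fin m) (j : Fin n)
    (k τ : ℕ) :
    ∑ t ∈ Finset.range τ, (if P.scale θ (P.bidRun θ a t).x i j ≤ k then P.renewal θ a j k t else 0)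
      ≤ 1 + ∑ t ∈ Finset.range τ, P.increment θ a j t *
        (if P.scale θ (P.bidRun θ a t).x i j ≤ k then ((2 : ℝ) ^ k)⁻¹ else 0) := by
  -- Rounding `x / 2 ^ k` down changes a sum of consecutive differences by at most `1`.
  set y : ℕ → ℝ := fun t => (((P.bidRun θ a t).x j / 2 ^ k : ℕ) : ℝ) -
    ((P.bidRun θ a t).x j : ℝ) / (2 ^ k : ℕ) + 1 with hy
  have hy_mem : ∀ t, 0 ≤ y t ∧ y t ≤ 1 := fun t => by
    simp only [hy, ← Nat.floor_div_eq_div (K := ℝ)]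
    constructor
    · linarith [Nat.lt_floor_add_one (((P.bidRun θ a t).x j : ℝ) / (2 ^ k : ℕ))]
    · linarith [Nat.floor_le (a := ((P.bidRun θ a t).x j : ℝ) / (2 ^ k : ℕ)) (by positivity)]
  have htele := sum_ite_sub_le (p := fun t => P.scale θ (P.bidRun θ a t).x i j ≤ k)
    (P.scale_le_succ θ a i j k) (fun t => (hy_mem t).1) (fun t => (hy_mem t).2) τ
  rw [← sub_le_iff_le_add, ← Finset.sum_sub_distrib]
  refine le_trans (Finset.sum_le_sum fun t _ => ?_) htele
  split_ifs
  · simp only [hy, increment, Nat.cast_pow, Nat.cast_ofNat]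
    rw [← div_eq_mul_inv, sub_div]
    linarith [P.renewal_le θ a j k t]
  · simp

theorem Fits.sum_inv_two_pow_scale_le (h : P.Fits θ) {x : Fin n → ℕ} {i : Fin m} {j : Fin n}
    (hi : 0 < P.residual x i) (hj : j ∈ P.row i) (N : ℕ) :
    ∑ k ∈ Finset.range N, (if P.scale θ x i j ≤ k then ((2 : ℝ) ^ k)⁻¹ else 0) ≤
      4 * θ.F * P.A i j / P.residual x i := by
  refine (sum_ite_half_pow_le (P.scale θ x i j) N).trans ?_
  have hscale : P.residual x i < 2 ^ (P.scale θ x i j + 1) * (θ.F * P.A i j) :=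
    lt_two_pow_scaleOf h.F_pos (P.A_pos (mem_row.1 hj))
  rw [pow_succ] at hscale
  rw [← div_eq_mul_inv, div_le_div_iff₀ (by positivity) hi]
  linarith

theorem Fits.sum_renewal_le_of_mem_row (h : P.Fits θ) {i : Fin m} {j : Fin n} {τ : ℕ}
    (hi : ∀ t < τ, 0 < P.residual (P.bidRun θ a t).x i) (hj : j ∈ P.row i) :
    ∑ k ∈ Finset.range (P.topScale θ j + 1), ∑ t ∈ Finset.range τ,
      (if P.scale θ (P.bidRun θ a t).x i j ≤ k then P.renewal θ a j k t else 0) ≤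
      (1 + Real.logb 2 P.maxRatio) + ∑ t ∈ Finset.range τ,
        4 * θ.F * (P.A i j * P.increment θ a j t / P.residual (P.bidRun θ a t).x i) := by
  refine (Finset.sum_le_sum fun k _ => P.sum_renewal_le θ a i j k τ).trans ?_
  rw [Finset.sum_add_distrib, Finset.sum_const, Finset.card_range, nsmul_eq_mul, mul_one,
    Finset.sum_comm]
  refine add_le_add ?_ (Finset.sum_le_sum fun t ht => ?_)
  · push_cast
    linarith [P.topScale_le_logb h.F_pos j]
  · rw [← Finset.mul_sum]
    refine (mul_le_mul_of_nonneg_left (h.sum_inv_two_pow_scale_le (hi t (Finset.mem_range.1 ht)) hj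
      (P.topScale θ j + 1)) (P.increment_nonneg θ a j t)).trans_eq ?_
    ring

theorem sum_sum_increment_le {i : Fin m} {τ : ℕ}
    (hi : 0 < P.residual (P.bidRun θ a τ).x i) :
    ∑ t ∈ Finset.range τ, ∑ j ∈ P.row i,
      4 * θ.F * (P.A i j * P.increment θ a j t / P.residual (P.bidRun θ a t).x i) ≤
      8 * P.expandedRank θ := by
  have hmono := P.bidRun_x_mono θ a
  have hstep : ∀ t ∈ Finset.range τ, ∑ j ∈ P.row i,
      4 * θ.F * (P.A i j * P.increment θ a j t / P.residual (P.bidRun θ a t).x i) ≤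
      8 * θ.F * (P.potential (P.bidRun θ a t).x i - P.potential (P.bidRun θ a (t + 1)).x i) := by
    intro t ht
    have hdec := residual_sub_div_le_potential_sub (hmono (Nat.le_succ t))
      (hi.trans_le (residual_anti (hmono (Finset.mem_range.1 ht)) i))
    rw [residual_sub_residual] at hdec
    rw [← Finset.mul_sum, ← Finset.sum_div]
    refine (mul_le_mul_of_nonneg_left hdec (by positivity)).trans_eq ?_
    ring
  have hstart := hi.trans_le (residual_anti (hmono (Nat.zero_le τ)) i)
  calc _ ≤ 8 * θ.F * (P.potential (P.bidRun θ a 0).x i - P.potential (P.bidRun θ a τ).x i) := by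
        rw [← Finset.sum_range_sub' (fun t => P.potential (P.bidRun θ a t).x i) τ, Finset.mul_sum]
        exact Finset.sum_le_sum hstep
    _ ≤ 8 * θ.F * (1 + Real.logb 2 P.maxRatio) := by
        gcongr
        linarith [potential_le hstart, potential_nonneg hi]
    _ = 8 * P.expandedRank θ := mul_assoc _ _ _

theorem Fits.sum_sum_renewal_le (h : P.Fits θ) {i : Fin m} {τ : ℕ}
    (hi : 0 < P.residual (P.bidRun θ a τ).x i) :
    ∑ j ∈ P.row i, ∑ k ∈ Finset.range (P.topScale θ j + 1), ∑ t ∈ Finset.range τ,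
      (if P.scale θ (P.bidRun θ a t).x i j ≤ k then P.renewal θ a j k t else 0) ≤
      9 * P.expandedRank θ := by
  have hact : ∀ t < τ, 0 < P.residual (P.bidRun θ a t).x i := fun t ht =>
    hi.trans_le (residual_anti (P.bidRun_x_mono θ a ht.le) i)
  refine (Finset.sum_le_sum fun j hj => h.sum_renewal_le_of_mem_row hact hj).trans ?_
  rw [Finset.sum_add_distrib, Finset.sum_comm]
  linarith [sum_sum_increment_le hi, h.sum_row_le_expandedRank fun j (_ : j ∈ P.row i) =>
    le_refl (1 + Real.logb 2 P.maxRatio)]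

theorem Fits.sum_ite_progress_le (h : P.Fits θ) {i : Fin m} {j : Fin n} (hw : 0 < P.w j)
    (k τ : ℕ) :
    ∑ t ∈ Finset.range τ,
      (if P.scale θ (P.bidRun θ a t).x i j ≤ k then P.progress θ a j k t else 0) ≤
      θ.Z + (∑ t ∈ Finset.range τ,
        (if P.scale θ (P.bidRun θ a t).x i j ≤ k then P.renewal θ a j k t else 0)) *
          (2 * θ.Z + 1) := by
  have hdepth := fun t => (h.valid a t j).depth_mem_Icc h.Z_le hw k
  have htele := sum_ite_sub_le (p := fun t => P.scale θ (P.bidRun θ a t).x i j ≤ k)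
    (P.scale_le_succ θ a i j k) (y := P.depthAt θ a j k) (fun t => (hdepth t).1)
    (fun t => (hdepth t).2) τ
  rw [← sub_le_iff_le_add, Finset.sum_mul, ← Finset.sum_sub_distrib]
  refine le_trans (Finset.sum_le_sum fun t _ => ?_) htele
  split_ifs
  · rw [progress_eq, add_sub_cancel_right]
  · simp

theorem Fits.sum_rowProgress_le (h : P.Fits θ) {i : Fin m} {τ : ℕ}
    (hi : 0 < P.residual (P.bidRun θ a τ).x i) :
    ∑ t ∈ Finset.range τ, P.rowProgress θ a i t ≤ 19 * (θ.Z + 1) * P.expandedRank θ := by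
  have hsum : ∑ t ∈ Finset.range τ, P.rowProgress θ a i t ≤
      ∑ j ∈ P.row i, ∑ k ∈ Finset.range (P.topScale θ j + 1), ((θ.Z : ℝ) +
        (∑ t ∈ Finset.range τ, (if P.scale θ (P.bidRun θ a t).x i j ≤ k then
          P.renewal θ a j k t else 0)) * (2 * θ.Z + 1)) := by
    simp only [rowProgress]
    rw [Finset.sum_comm]
    refine Finset.sum_le_sum fun j hj => ?_
    rw [Finset.sum_comm]
    exact Finset.sum_le_sum fun k _ => h.sum_ite_progress_le (h.w_pos_of_mem_row hi hj) k τ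
  have hscales : ∑ j ∈ P.row i, ((P.topScale θ j + 1 : ℕ) : ℝ) ≤ P.expandedRank θ := by
    refine h.sum_row_le_expandedRank fun j _ => ?_
    push_cast
    linarith [P.topScale_le_logb h.F_pos j]
  simp only [Finset.sum_add_distrib, Finset.sum_const, Finset.card_range, nsmul_eq_mul,
    ← Finset.sum_mul] at hsum
  calc _ ≤ P.expandedRank θ * θ.Z + 9 * P.expandedRank θ * (2 * θ.Z + 1) := by
        refine hsum.trans ?_
        gcongr
        exact h.sum_sum_renewal_le hi
    _ ≤ _ := by linarith [P.expandedRank_nonneg θ]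

open Classical in
theorem bidRun_bidExp (P : CoveringILP m n) (θ : BidParams) (a : ℕ → ℕ) (i : Fin m) (τ : ℕ) :
    ((P.bidRun θ a τ).bidExp i : ℝ) = (P.start θ).bidExp i +
      ∑ t ∈ Finset.range τ, ((if P.Raises θ (P.bidRun θ a t) (a t) i then (a t : ℝ) else 0)
        - P.rowHalvings θ (P.bidRun θ a t) (a t) i)
      - ((θ.Z : ℝ) + 3) * ∑ j ∈ P.row i,
        ((P.scale θ (P.start θ).x i j : ℝ) - P.scale θ (P.bidRun θ a τ).x i j) := by
  induction τ with
  | zero => simp [bidRun]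
  | succ τ ih =>
    have hbid : (P.bid θ (P.bidRun θ a τ) (a τ) i : ℝ) = (P.bidRun θ a τ).bidExp i +
        if P.Raises θ (P.bidRun θ a τ) (a τ) i then (a τ : ℝ) else 0 := by
      unfold bid
      split_ifs <;> simp
    have hstep : (P.bidRun θ a (τ + 1)).bidExp i = P.bid θ (P.bidRun θ a τ) (a τ) i -
        P.rowHalvings θ (P.bidRun θ a τ) (a τ) i - ((θ.Z : ℤ) + 3) * ∑ j ∈ P.row i,
          ((P.scale θ (P.bidRun θ a τ).x i j : ℤ) - P.scale θ (P.bidRun θ a (τ + 1)).x i j) := rfl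
    rw [hstep, Finset.sum_range_succ]
    push_cast
    rw [hbid, ih]
    simp only [Finset.sum_sub_distrib]
    ring

theorem two_pow_startReduction_le {K deg : ℕ} {w : ℝ} (hw : 0 < w) (hwK : w ≤ 2 ^ K)
    (hdeg : 0 < deg) : (2 : ℝ) ^ startReduction K deg w ≤ 16 * deg * 2 ^ K / w := by
  have hdeg : (1 : ℝ) ≤ deg := by exact_mod_cast hdeg
  set q : ℝ := 4 * deg * 2 ^ K / w with hq
  have hq4 : 4 ≤ q := by
    rw [hq, le_div_iff₀ hw]
    nlinarith
  have hceil : 1 < ⌈q⌉₊ := Nat.lt_ceil.2 (by push_cast; linarith)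
  have hpred : (2 : ℝ) ^ (Nat.clog 2 ⌈q⌉₊ - 1) < ⌈q⌉₊ := by
    exact_mod_cast Nat.pow_pred_clog_lt_self one_lt_two hceil
  calc (2 : ℝ) ^ startReduction K deg w = 2 ^ (Nat.clog 2 ⌈q⌉₊ - 1) * 2 := by
        rw [← pow_succ, Nat.sub_add_cancel (Nat.clog_pos one_lt_two hceil)]
        rfl
    _ ≤ 4 * q := by linarith [Nat.ceil_lt_add_one (show 0 ≤ q by linarith)]
    _ = 16 * deg * 2 ^ K / w := by
        rw [hq]
        ring

theorem Fits.exists_le_two_pow_start_bidExp (h : P.Fits θ) {i : Fin m} (hne : (P.row i).Nonempty)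
    (hw : ∀ j ∈ P.row i, 0 < P.w j) :
    ∃ j ∈ P.row i, P.w j ≤ 16 * P.maxDegree * (2 : ℝ) ^ (P.start θ).bidExp i := by
  obtain ⟨j, hj, hmax⟩ := Finset.exists_mem_eq_sup (P.row i) hne
    (fun j => startReduction θ.K (P.col j).card (P.w j))
  have hpow := two_pow_startReduction_le (hw j hj) (h.w_le j)
    (Finset.card_pos.2 ⟨i, mem_col.2 (mem_row.1 hj)⟩)
  have hdeg : ((P.col j).card : ℝ) ≤ P.maxDegree := by exact_mod_cast P.col_card_le_maxDegree j
  refine ⟨j, hj, ?_⟩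
  rw [le_div_iff₀ (hw j hj)] at hpow
  dsimp only [start]
  rw [hmax, zpow_sub₀ two_ne_zero, zpow_natCast, zpow_natCast, ← mul_div_assoc,
    le_div_iff₀ (by positivity), mul_comm]
  exact hpow.trans (by gcongr)

theorem Fits.two_pow_bidExp_le (h : P.Fits θ) {i : Fin m} {j : Fin n} {τ : ℕ}
    (hi : 0 < P.residual (P.bidRun θ a τ).x i) (hj : j ∈ P.row i) :
    (2 : ℝ) ^ (P.bidRun θ a τ).bidExp i ≤ P.w j * P.maxRatio / 2 := by
  set x := (P.bidRun θ a τ).x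
  set k := P.scale θ x i j
  have hij := mem_row.1 hj
  have hact : i ∈ P.active x j := mem_active.2 ⟨hij, hi⟩
  have hvalid := h.valid a τ j
  have hk : (P.view θ (P.bidRun θ a τ) j).scale i = k := view_scale hact
  have hload := VarView.le_load (V := P.view θ (P.bidRun θ a τ) j) hact hk.le
  rw [view_bidExp hact] at hload
  have hslack : (P.view θ (P.bidRun θ a τ) j).slack k ≤ P.w j * target k (x j) := hvalid.slack_le k
  have hx : (x j : ℝ) ≤ P.maxRatio := by
    refine le_trans ?_ (P.div_le_maxRatio hij)
    rw [le_div_iff₀ (P.A_pos hij)]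
    linarith [P.residual_le_sub x i j]
  have htarget : (target k (x j) : ℝ) ≤ 2 * P.maxRatio := by
    have : (target k (x j) : ℝ) ≤ x j + 2 ^ k := by exact_mod_cast target_le k (x j)
    linarith [P.two_pow_scale_le h.F_pos x hij]
  linarith [mul_le_mul_of_nonneg_left htarget (P.w_nonneg j),
    hvalid.safe k (hk ▸ hvalid.scale_le_topScale i hact)]

theorem Fits.bidExp_sub_le (h : P.Fits θ) {i : Fin m} {τ : ℕ}
    (hi : 0 < P.residual (P.bidRun θ a τ).x i) (hne : (P.row i).Nonempty) :
    ((P.bidRun θ a τ).bidExp i : ℝ) - (P.start θ).bidExp i ≤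
      3 + Real.logb 2 P.maxRatio + Real.logb 2 P.maxDegree := by
  obtain ⟨j, hj, hstart⟩ := h.exists_le_two_pow_start_bidExp hne fun j => h.w_pos_of_mem_row hi
  have hM : 0 < P.maxRatio := by linarith [P.one_le_maxRatio]
  have hΔ : (0 : ℝ) < P.maxDegree := by
    exact_mod_cast (Finset.card_pos.2 ⟨i, mem_col.2 (mem_row.1 hj)⟩).trans_le
      (P.col_card_le_maxDegree j)
  have hratio : (2 : ℝ) ^ (((P.bidRun θ a τ).bidExp i - (P.start θ).bidExp i : ℤ) : ℝ) ≤
      2 ^ (3 : ℝ) * P.maxRatio * P.maxDegree := by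
    rw [Real.rpow_intCast, zpow_sub₀ two_ne_zero, div_le_iff₀ (by positivity)]
    norm_num
    linarith [h.two_pow_bidExp_le hi hj, mul_le_mul_of_nonneg_right hstart hM.le]
  have hlog := Real.logb_le_logb_of_le one_lt_two (by positivity) hratio
  rw [Real.logb_mul (by positivity) hΔ.ne', Real.logb_mul (by positivity) hM.ne',
    Real.logb_rpow two_pos (by norm_num), Real.logb_rpow two_pos (by norm_num)] at hlog
  exact_mod_cast hlog

theorem Fits.sum_scale_sub_le (h : P.Fits θ) (x y : Fin n → ℕ) (i : Fin m) :
    ∑ j ∈ P.row i, ((P.scale θ x i j : ℝ) - P.scale θ y i j) ≤ P.expandedRank θ := by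
  refine h.sum_row_le_expandedRank fun j hj => ?_
  linarith [P.scale_le_logb h.F_pos x (mem_row.1 hj), (P.scale θ y i j).cast_nonneg (α := ℝ)]

open Classical in
theorem Fits.sum_raises_le (h : P.Fits θ) {i : Fin m} {τ : ℕ}
    (hi : 0 < P.residual (P.bidRun θ a τ).x i) (hne : (P.row i).Nonempty) :
    ∑ t ∈ Finset.range τ, (if P.Raises θ (P.bidRun θ a t) (a t) i then (a t : ℝ) else 0) ≤
      3 + Real.logb 2 P.maxRatio + Real.logb 2 P.maxDegree +
        421 * (θ.Z + 1) * P.expandedRank θ := by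
  have hhalvings : ∑ t ∈ Finset.range τ, (P.rowHalvings θ (P.bidRun θ a t) (a t) i : ℝ) ≤
      22 * ∑ t ∈ Finset.range τ, P.rowProgress θ a i t := by
    rw [Finset.mul_sum]
    exact Finset.sum_le_sum fun t ht => h.rowHalvings_le
      (hi.trans_le (residual_anti (P.bidRun_x_mono θ a (Finset.mem_range.1 ht).le) i))
  have hdrop := mul_le_mul_of_nonneg_left
    (h.sum_scale_sub_le (P.start θ).x (P.bidRun θ a τ).x i)
    (show (0 : ℝ) ≤ (θ.Z : ℝ) + 3 by positivity)
  have hexp := P.bidRun_bidExp θ a i τ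
  rw [Finset.sum_sub_distrib] at hexp
  have hnonneg : 0 ≤ (θ.Z : ℝ) * P.expandedRank θ :=
    mul_nonneg (Nat.cast_nonneg _) (P.expandedRank_nonneg θ)
  linarith [h.bidExp_sub_le hi hne, h.sum_rowProgress_le hi]

open Classical in
theorem Fits.sum_not_raises_le (h : P.Fits θ) {i : Fin m} {τ : ℕ}
    (hi : 0 < P.residual (P.bidRun θ a τ).x i) :
    ∑ t ∈ Finset.range τ,
      (if P.Raises θ (P.bidRun θ a t) (a t) i then 0 else ((2 : ℝ) ^ a t)⁻¹) ≤
      152 * (θ.Z + 1) * P.expandedRank θ := by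
  have hact : ∀ t ∈ Finset.range τ, 0 < P.residual (P.bidRun θ a t).x i := fun t ht =>
    hi.trans_le (residual_anti (P.bidRun_x_mono θ a (Finset.mem_range.1 ht).le) i)
  calc _ ≤ ∑ t ∈ Finset.range τ, 8 * P.rowProgress θ a i t := by
        refine Finset.sum_le_sum fun t ht => ?_
        split_ifs with hr
        · exact mul_nonneg (by norm_num) (h.rowProgress_nonneg (hact t ht))
        · exact h.inv_two_pow_le (hact t ht) hr
    _ ≤ _ := by
        rw [← Finset.mul_sum]
        linarith [h.sum_rowProgress_le hi]

end CoveringILP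

/-! ### The number of iterations -/

/-- The exponent of the factor `2 ^ raiseExp γ t` by which bids are raised in iteration `t`. Raising
by the constant factor `2` in every second iteration bounds the number of iterations in which a
constraint is stuck; raising by the slowly growing factor `2 t ^ γ` in the others saves a factor of
order `log log Δ` on the number of raises. -/
def raiseExp (γ : ℝ) (t : ℕ) : ℕ :=
  if t % 2 = 0 then 1 else 1 + ⌊γ * Real.logb 2 (t + 1)⌋₊

theorem le_raiseExp_of_odd (γ : ℝ) {t : ℕ} (ht : t % 2 = 1) :
    γ * Real.logb 2 (t + 1) ≤ raiseExp γ t := by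
  rw [raiseExp, if_neg (by omega), add_comm 1]
  push_cast
  exact (Nat.lt_floor_add_one (γ * Real.logb 2 (t + 1))).le

theorem two_pow_raiseExp_le_of_odd {γ : ℝ} (hγ : 0 ≤ γ) {t : ℕ} (ht : t % 2 = 1) :
    (2 : ℝ) ^ raiseExp γ t ≤ 2 * ((t : ℝ) + 1) ^ γ := by
  have hlog : 0 ≤ Real.logb 2 ((t : ℝ) + 1) :=
    Real.logb_nonneg one_lt_two (le_add_of_nonneg_left t.cast_nonneg)
  rw [raiseExp, if_neg (by omega), pow_add, pow_one]
  refine mul_le_mul_of_nonneg_left ?_ zero_le_two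
  calc (2 : ℝ) ^ ⌊γ * Real.logb 2 ((t : ℝ) + 1)⌋₊
      = (2 : ℝ) ^ ((⌊γ * Real.logb 2 ((t : ℝ) + 1)⌋₊ : ℕ) : ℝ) := (Real.rpow_natCast _ _).symm
    _ ≤ (2 : ℝ) ^ (γ * Real.logb 2 ((t : ℝ) + 1)) :=
        Real.rpow_le_rpow_of_exponent_le one_le_two (Nat.floor_le (mul_nonneg hγ hlog))
    _ = ((t : ℝ) + 1) ^ γ := by
        rw [mul_comm, Real.rpow_mul zero_le_two,
          Real.rpow_logb two_pos (by norm_num) (by positivity)]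

theorem card_filter_le_of_sum_le {p r : ℕ → Prop} [DecidablePred p] [DecidablePred r] {a : ℕ → ℕ}
    {u v S₁ S₂ : ℝ} {τ : ℕ} (hu : 0 < u) (hv : 0 ≤ v)
    (hp : ∀ t < τ, p t → u ≤ a t ∧ (2 : ℝ) ^ a t ≤ v)
    (h₁ : ∑ t ∈ Finset.range τ, (if r t then (a t : ℝ) else 0) ≤ S₁)
    (h₂ : ∑ t ∈ Finset.range τ, (if r t then 0 else ((2 : ℝ) ^ a t)⁻¹) ≤ S₂) :
    (((Finset.range τ).filter p).card : ℝ) ≤ S₁ / u + v * S₂ := by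
  have hterm : ∀ t ∈ Finset.range τ, (if p t then (1 : ℝ) else 0) ≤
      (if r t then (a t : ℝ) else 0) / u + v * (if r t then 0 else ((2 : ℝ) ^ a t)⁻¹) := by
    intro t ht
    by_cases hpt : p t
    · obtain ⟨hua, hav⟩ := hp t (Finset.mem_range.1 ht) hpt
      rw [if_pos hpt]
      split_ifs
      · rwa [mul_zero, add_zero, one_le_div hu]
      · rwa [zero_div, zero_add, ← div_eq_mul_inv, one_le_div (by positivity)]
    · rw [if_neg hpt]
      split_ifs <;> positivity
  calc (((Finset.range τ).filter p).card : ℝ)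
      = ∑ t ∈ Finset.range τ, (if p t then (1 : ℝ) else 0) := by
        rw [Finset.card_filter]
        push_cast
        rfl
    _ ≤ _ := Finset.sum_le_sum hterm
    _ ≤ S₁ / u + v * S₂ := by
        rw [Finset.sum_add_distrib, ← Finset.sum_div, ← Finset.mul_sum]
        gcongr

theorem le_two_mul_card_filter_even (τ : ℕ) :
    τ ≤ 2 * ((Finset.range τ).filter fun t => t % 2 = 0).card := by
  suffices h : (τ + 1) / 2 = ((Finset.range τ).filter fun t => t % 2 = 0).card by omega
  induction τ with
  | zero => rfl
  | succ τ ih =>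
    rw [Finset.range_add_one, Finset.filter_insert]
    split_ifs
    · rw [Finset.card_insert_of_notMem (by simp), ← ih]
      omega
    · omega

theorem div_two_le_card_filter_odd_add (s τ : ℕ) :
    τ / 2 ≤ ((Finset.range τ).filter fun t => t % 2 = 1 ∧ s ≤ t).card + (s + 1) / 2 := by
  induction τ with
  | zero => exact Nat.zero_le _
  | succ τ ih =>
    rw [Finset.range_add_one, Finset.filter_insert]
    split_ifs
    · rw [Finset.card_insert_of_notMem (by simp)]
      omega
    · omega

section Iterations

variable {γ D X S₁ S₂ : ℝ} {τ : ℕ} {r : ℕ → Prop} [DecidablePred r]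

theorem le_of_sum_raiseExp_le
    (h₁ : ∑ t ∈ Finset.range τ, (if r t then (raiseExp γ t : ℝ) else 0) ≤ S₁)
    (h₂ : ∑ t ∈ Finset.range τ, (if r t then 0 else ((2 : ℝ) ^ raiseExp γ t)⁻¹) ≤ S₂) :
    (τ : ℝ) ≤ 2 * S₁ + 4 * S₂ := by
  have hexp : ∀ t < τ, t % 2 = 0 → 1 ≤ (raiseExp γ t : ℝ) ∧ (2 : ℝ) ^ raiseExp γ t ≤ 2 := by
    intro t _ ht
    rw [raiseExp, if_pos ht]
    norm_num
  have hcard := card_filter_le_of_sum_le one_pos zero_le_two hexp h₁ h₂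
  have heven : (τ : ℝ) ≤ 2 * (((Finset.range τ).filter fun t => t % 2 = 0).card : ℝ) := by
    exact_mod_cast le_two_mul_card_filter_even τ
  linarith

/-- In the odd iterations of the second half, bids are raised by at least `2 ^ u`. -/
theorem le_of_sum_raiseExp_le_of_le_logb {u : ℝ} (hγ : 0 ≤ γ) (hu : 0 < u) (hτ : 0 < τ)
    (huτ : u ≤ γ * Real.logb 2 (τ / 2))
    (h₁ : ∑ t ∈ Finset.range τ, (if r t then (raiseExp γ t : ℝ) else 0) ≤ S₁)
    (h₂ : ∑ t ∈ Finset.range τ, (if r t then 0 else ((2 : ℝ) ^ raiseExp γ t)⁻¹) ≤ S₂) :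
    (τ : ℝ) ≤ 4 + 4 * (S₁ / u) + 8 * (τ : ℝ) ^ γ * S₂ := by
  have : (0 : ℝ) < τ := Nat.cast_pos.2 hτ
  have hexp : ∀ t < τ, t % 2 = 1 ∧ τ / 2 ≤ t →
      u ≤ (raiseExp γ t : ℝ) ∧ (2 : ℝ) ^ raiseExp γ t ≤ 2 * (τ : ℝ) ^ γ := by
    rintro t htτ ⟨hodd, ht⟩
    have hhalf : (τ : ℝ) / 2 ≤ (t : ℝ) + 1 := by
      rw [div_le_iff₀ two_pos]
      exact_mod_cast (by omega : τ ≤ (t + 1) * 2)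
    have hle : (t : ℝ) + 1 ≤ τ := by exact_mod_cast htτ
    constructor
    · refine huτ.trans (le_trans ?_ (le_raiseExp_of_odd γ hodd))
      exact mul_le_mul_of_nonneg_left
        (Real.logb_le_logb_of_le one_lt_two (by positivity) hhalf) hγ
    · exact (two_pow_raiseExp_le_of_odd hγ hodd).trans (by gcongr)
  have hcard := card_filter_le_of_sum_le hu (by positivity) hexp h₁ h₂
  have hodd : (τ : ℝ) ≤
      4 * (((Finset.range τ).filter fun t => t % 2 = 1 ∧ τ / 2 ≤ t).card : ℝ) + 4 := by
    have := div_two_le_card_filter_odd_add (τ / 2) τ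
    exact_mod_cast (by omega : τ ≤
      4 * ((Finset.range τ).filter fun t => t % 2 = 1 ∧ τ / 2 ≤ t).card + 4)
  linarith

theorem logb_two_le {x : ℝ} (hx : 0 < x) : Real.logb 2 x ≤ 3 / 2 * x := by
  rw [Real.logb, div_le_iff₀ (Real.log_pos one_lt_two)]
  nlinarith [Real.log_two_gt_d9, Real.log_le_sub_one_of_pos hx]

theorem half_lt_logb (hD : 3 / 2 ≤ D) : 1 / 2 < Real.logb 2 D := by
  rw [Real.lt_logb_iff_rpow_lt one_lt_two (by linarith), ← Real.sqrt_eq_rpow,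
    Real.sqrt_lt' (by linarith)]
  nlinarith

theorem logb_sqrt (hD : 0 < D) : Real.logb 2 (√D) = Real.logb 2 D / 2 := by
  rw [Real.sqrt_eq_rpow, Real.logb_rpow_eq_mul_logb_of_pos hD]
  ring

theorem sqrt_le_div_logb (hD : 3 / 2 ≤ D) : √D ≤ 3 * (D / Real.logb 2 D) := by
  have hD0 : 0 < D := by linarith
  rw [← mul_div_assoc, le_div_iff₀ (by linarith [half_lt_logb hD])]
  calc √D * Real.logb 2 D = √D * (2 * Real.logb 2 (√D)) := by rw [logb_sqrt hD0]; ring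
    _ ≤ √D * (2 * (3 / 2 * √D)) := by gcongr; exact logb_two_le (Real.sqrt_pos.2 hD0)
    _ = 3 * (√D * √D) := by ring
    _ = 3 * D := by rw [Real.mul_self_sqrt hD0.le]

theorem rpow_le_mul_rpow_of_le_mul {x c : ℝ} (hx : 0 ≤ x) (hc : 1 ≤ c) (hD : 0 ≤ D)
    (hxD : x ≤ c * D) (hγ : 0 ≤ γ) (hγ1 : γ ≤ 1) : x ^ γ ≤ c * D ^ γ :=
  calc x ^ γ ≤ (c * D) ^ γ := Real.rpow_le_rpow hx hxD hγ
    _ = c ^ γ * D ^ γ := Real.mul_rpow (by linarith) hD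
    _ ≤ c ^ (1 : ℝ) * D ^ γ := by gcongr
    _ = c * D ^ γ := by rw [Real.rpow_one]

theorem rpow_le_three_mul_div_logb (hγ : γ ≤ 1 / 2) (hD : 3 / 2 ≤ D) :
    D ^ γ ≤ 3 * (D / Real.logb 2 D) := by
  refine le_trans ?_ (sqrt_le_div_logb hD)
  rw [Real.sqrt_eq_rpow]
  exact Real.rpow_le_rpow_of_exponent_le (by linarith) hγ

variable {A G : ℝ}

theorem le_mul_div_logb_add_mul_rpow (hA : 1 ≤ A) (hγ : 0 < γ) (hγ1 : γ ≤ 1 / 2) (hD : 3 / 2 ≤ D)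
    (hX : 0 ≤ X) (hGD : G ≤ D) (hGX : G ≤ 2 + 2 * X)
    (h₁ : ∑ t ∈ Finset.range τ, (if r t then (raiseExp γ t : ℝ) else 0) ≤ A * (D + G))
    (h₂ : ∑ t ∈ Finset.range τ, (if r t then 0 else ((2 : ℝ) ^ raiseExp γ t)⁻¹) ≤ A * G) :
    (τ : ℝ) ≤ (12 + 16 * A / γ + 384 * A ^ 2) * (D / Real.logb 2 D + X * D ^ γ) := by
  have hlog := half_lt_logb hD
  have hsqrt := sqrt_le_div_logb hD
  have hsqrt1 : 1 ≤ √D := Real.one_le_sqrt.2 (by linarith)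
  have hrpow := rpow_le_three_mul_div_logb hγ1 hD
  have hAG : A * G ≤ A * D := by gcongr
  set Q := D / Real.logb 2 D with hQ
  suffices h : (τ : ℝ) ≤ 12 * Q + 16 * A / γ * Q + 128 * A ^ 2 * (3 * Q + X * D ^ γ) by
    have hXD : 0 ≤ (12 + 16 * A / γ + 256 * A ^ 2) * (X * D ^ γ) := by positivity
    linarith
  have : 0 ≤ Q := by linarith
  rcases le_total (τ : ℝ) (4 * √D) with hsmall | hlarge
  · have : 0 ≤ 16 * A / γ * Q + 128 * A ^ 2 * (3 * Q + X * D ^ γ) := by positivity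
    linarith
  · have hu : γ * (Real.logb 2 D / 2) ≤ γ * Real.logb 2 ((τ : ℝ) / 2) := by
      rw [← logb_sqrt (by linarith)]
      exact mul_le_mul_of_nonneg_left
        (Real.logb_le_logb_of_le one_lt_two (by linarith) (by linarith)) hγ.le
    have hodd := le_of_sum_raiseExp_le_of_le_logb hγ.le (by positivity)
      (Nat.cast_pos.1 (by linarith : (0 : ℝ) < τ)) hu h₁ h₂
    have hraises : A * (D + G) / (γ * (Real.logb 2 D / 2)) ≤ 4 * A / γ * Q := by
      calc _ ≤ (2 * (A * D)) / (γ * (Real.logb 2 D / 2)) :=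
            div_le_div_of_nonneg_right (by linarith) (by positivity)
        _ = 4 * A / γ * Q := by rw [hQ]; field_simp; norm_num
    have hτ : (τ : ℝ) ^ γ ≤ 8 * A * D ^ γ :=
      rpow_le_mul_rpow_of_le_mul (Nat.cast_nonneg τ) (by linarith) (by linarith)
        (by linarith [le_of_sum_raiseExp_le h₁ h₂]) hγ.le (by linarith)
    have hstuck : 8 * (τ : ℝ) ^ γ * (A * G) ≤ 128 * A ^ 2 * (3 * Q + X * D ^ γ) :=
      calc _ ≤ 8 * (τ : ℝ) ^ γ * (A * (2 + 2 * X)) := by gcongr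
        _ ≤ 8 * (8 * A * D ^ γ) * (A * (2 + 2 * X)) := by gcongr
        _ = 128 * A ^ 2 * (D ^ γ + X * D ^ γ) := by ring
        _ ≤ _ := by gcongr
    calc (τ : ℝ) ≤ _ := hodd
      _ ≤ 12 * Q + 4 * (4 * A / γ * Q) + 128 * A ^ 2 * (3 * Q + X * D ^ γ) := by linarith
      _ = _ := by ring

theorem le_mul_add_div_logb_add_min (hA : 1 ≤ A) (hγ : 0 < γ) (hD : 3 / 2 ≤ D) (hX : 0 ≤ X)
    (hGX : G ≤ 2 + 2 * X)
    (h₁ : ∑ t ∈ Finset.range τ, (if r t then (raiseExp (min γ (1 / 2)) t : ℝ) else 0) ≤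
      A * (D + G))
    (h₂ : ∑ t ∈ Finset.range τ, (if r t then 0 else ((2 : ℝ) ^ raiseExp (min γ (1 / 2)) t)⁻¹) ≤
      A * G) :
    (τ : ℝ) ≤ (60 * A + 16 * A / min γ (1 / 2) + 384 * A ^ 2) *
      (X + D / Real.logb 2 D + min D (X * D ^ γ)) := by
  have hγ0 : 0 < min γ (1 / 2) := lt_min hγ (by norm_num)
  have hQ : 1 ≤ 3 * (D / Real.logb 2 D) :=
    (Real.one_le_sqrt.2 (by linarith)).trans (sqrt_le_div_logb hD)
  have heven := le_of_sum_raiseExp_le h₁ h₂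
  set Q := D / Real.logb 2 D
  set c := 16 * A / min γ (1 / 2) + 384 * A ^ 2 with hc
  have hc0 : 0 ≤ c := by positivity
  have hmin : 0 ≤ min D (X * D ^ γ) := le_min (by linarith) (by positivity)
  have hsum : 0 ≤ X + Q + min D (X * D ^ γ) := by linarith
  rw [add_assoc, ← hc]
  rcases le_total D G with hDG | hGD
  · calc (τ : ℝ) ≤ 8 * A * G := by linarith [mul_le_mul_of_nonneg_left hDG (by linarith : 0 ≤ A)]
      _ ≤ 8 * A * (6 * (X + Q + min D (X * D ^ γ))) := by gcongr; linarith
      _ ≤ _ := by linarith [mul_nonneg (by linarith : 0 ≤ 12 * A + c) hsum]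
  rcases le_total D (X * D ^ γ) with hmin' | hmin'
  · rw [min_eq_left hmin'] at hsum ⊢
    calc (τ : ℝ) ≤ 8 * A * D := by linarith [mul_le_mul_of_nonneg_left hGD (by linarith : 0 ≤ A)]
      _ ≤ 8 * A * (X + Q + D) := by gcongr; linarith
      _ ≤ _ := by linarith [mul_nonneg (by linarith : 0 ≤ 52 * A + c) hsum]
  · rw [min_eq_right hmin'] at hsum ⊢
    calc (τ : ℝ) ≤ (12 + c) * (Q + X * D ^ min γ (1 / 2)) := by
          rw [hc, ← add_assoc]
          exact le_mul_div_logb_add_mul_rpow hA hγ0 (min_le_right _ _) hD hX hGD hGX h₁ h₂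
      _ ≤ (60 * A + c) * (X + Q + X * D ^ γ) := by
          have : D ^ min γ (1 / 2) ≤ D ^ γ :=
            Real.rpow_le_rpow_of_exponent_le (by linarith) (min_le_left _ _)
          have hXD : 0 ≤ X * D ^ min γ (1 / 2) :=
            mul_nonneg hX (Real.rpow_nonneg (by linarith) _)
          exact mul_le_mul (by linarith) (add_le_add (by linarith) (by gcongr)) (by linarith)
            (by linarith)

end Iterations

theorem three_halves_le_logb (x : ℝ) : 3 / 2 ≤ Real.logb 2 (max 3 x) := by
  rw [Real.le_logb_iff_rpow_le one_lt_two (by positivity)]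
  refine le_trans (le_of_sq_le_sq ?_ (by norm_num)) (le_max_left 3 x)
  rw [← Real.rpow_natCast, ← Real.rpow_mul zero_le_two]
  norm_num

theorem third_le_div_logb (x : ℝ) :
    1 / 3 ≤ Real.logb 2 (max 3 x) / Real.logb 2 (Real.logb 2 (max 3 x)) := by
  have h := three_halves_le_logb x
  linarith [sqrt_le_div_logb h, Real.one_le_sqrt.2 (by linarith : 1 ≤ Real.logb 2 (max 3 x))]

section TimeBound

variable {F ε : ℝ}

theorem logb_div_nonneg (hF : 1 ≤ F) (hε : 0 < ε) (hε1 : ε ≤ 1) : 0 ≤ Real.logb 2 (F / ε) :=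
  Real.logb_nonneg one_lt_two ((one_le_div hε).2 (hε1.trans hF))

theorem mul_one_add_logb_le (hF : 1 ≤ F) (hε : 0 < ε) (hε1 : ε ≤ 1) :
    F * (1 + Real.logb 2 (F / ε)) ≤ 2 + 2 * (F * Real.logb 2 (F / ε)) := by
  have hlog := logb_div_nonneg hF hε hε1
  rcases le_total F 2 with hF2 | hF2
  · nlinarith
  · have hFε : F ≤ F / ε := le_div_self (by linarith) hε hε1
    have : 1 ≤ Real.logb 2 (F / ε) := by
      rw [Real.le_logb_iff_rpow_le one_lt_two (by linarith), Real.rpow_one]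
      linarith
    nlinarith

theorem logb_two_le_rpow (hF : 0 < F) : Real.logb 2 F ≤ 167 * F ^ (0.009 : ℝ) := by
  have hpos : 0 < F ^ (0.009 : ℝ) := by positivity
  have h := logb_two_le hpos
  rw [Real.logb_rpow_eq_mul_logb_of_pos hF] at h
  norm_num at h hpos ⊢
  linarith

theorem mul_logb_div_le (hF : 1 ≤ F) (hε : 0 < ε) (hε1 : ε ≤ 1) :
    F * Real.logb 2 (F / ε) ≤ 167 * (F ^ (1.009 : ℝ) * (1 + Real.logb 2 ε⁻¹)) := by
  have hF0 : 0 < F := by linarith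
  have hE : 0 ≤ Real.logb 2 ε⁻¹ := Real.logb_nonneg one_lt_two ((one_le_inv₀ hε).2 hε1)
  have hlog := logb_two_le_rpow hF0
  have hone : 1 ≤ F ^ (0.009 : ℝ) := Real.one_le_rpow hF (by norm_num)
  have hrpow : F ^ (1.009 : ℝ) = F * F ^ (0.009 : ℝ) := by
    rw [← Real.rpow_one_add' hF0.le (by norm_num)]
    norm_num
  rw [div_eq_mul_inv, Real.logb_mul hF0.ne' (inv_ne_zero hε.ne'), hrpow, mul_assoc,
    mul_left_comm (167 : ℝ)]
  refine mul_le_mul_of_nonneg_left ?_ hF0.le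
  nlinarith

theorem logb_max_le_two_mul_add {f : ℕ} {M Δ : ℝ} (hf : 1 ≤ f) (hM : 1 ≤ M) :
    Real.logb 2 (max 3 (2 ^ f * M * Δ)) ≤
      2 * (f * (1 + Real.logb 2 M)) + Real.logb 2 (max 3 Δ) := by
  have hf1 : (1 : ℝ) ≤ f := Nat.one_le_cast.2 hf
  have hlogM : 0 ≤ Real.logb 2 M := Real.logb_nonneg one_lt_two hM
  have h2fM : 1 ≤ 2 ^ f * M := one_le_mul_of_one_le_of_one_le (one_le_pow₀ one_le_two) hM
  have h3 : (3 : ℝ) ≤ max 3 Δ := le_max_left _ _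
  have hmax : max 3 (2 ^ f * M * Δ) ≤ 2 ^ f * M * max 3 Δ :=
    max_le (h3.trans (le_mul_of_one_le_left (by linarith) h2fM))
      (mul_le_mul_of_nonneg_left (le_max_right _ _) (by linarith))
  have hlog := Real.logb_le_logb_of_le one_lt_two (by positivity) hmax
  rw [Real.logb_mul (by positivity) (by positivity), Real.logb_mul (by positivity) (by positivity),
    Real.logb_pow, Real.logb_self_eq_one one_lt_two] at hlog
  nlinarith

variable {d D : ℝ}

theorem div_logb_le_add (hF : 0 ≤ F) (hd : 3 / 2 ≤ d) (hdD : d ≤ D) (hD : D ≤ 2 * F + d) :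
    D / Real.logb 2 D ≤ d / Real.logb 2 d + 4 * F := by
  have hlogd := half_lt_logb hd
  have hlog : Real.logb 2 d ≤ Real.logb 2 D := Real.logb_le_logb_of_le one_lt_two (by linarith) hdD
  calc D / Real.logb 2 D ≤ (2 * F + d) / Real.logb 2 d := by gcongr
    _ = d / Real.logb 2 d + 2 * F / Real.logb 2 d := by rw [add_div, add_comm]
    _ ≤ d / Real.logb 2 d + 4 * F := by
        gcongr
        rw [div_le_iff₀ (by linarith)]
        nlinarith

theorem rpow_le_of_le_two_mul_add {γ : ℝ} (hγ : γ ≤ 0.001) (hF : 1 ≤ F) (hd : 3 / 2 ≤ d)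
    (hdD : d ≤ D) (hD : D ≤ 2 * F + d) : D ^ γ ≤ 4 * (F ^ (0.001 : ℝ) * d ^ (0.01 : ℝ)) := by
  have hDF : D ≤ 4 * (F * d) := by nlinarith
  calc D ^ γ ≤ D ^ (0.001 : ℝ) := Real.rpow_le_rpow_of_exponent_le (by linarith) hγ
    _ ≤ 4 * (F * d) ^ (0.001 : ℝ) := rpow_le_mul_rpow_of_le_mul (by linarith) (by norm_num)
        (by nlinarith) hDF (by norm_num) (by norm_num)
    _ = 4 * (F ^ (0.001 : ℝ) * d ^ (0.001 : ℝ)) := by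
        rw [Real.mul_rpow (by linarith) (by linarith)]
    _ ≤ _ := by
        gcongr 4 * (_ * ?_)
        exact Real.rpow_le_rpow_of_exponent_le (by linarith) (by norm_num)

theorem mwhvcTime_le_simplifiedTime {f : ℕ} {Δ M γ : ℝ} (hf : 1 ≤ f) (hΔ : 0 ≤ Δ) (hM : 1 ≤ M)
    (hε : 0 < ε) (hε1 : ε ≤ 1) (hγ : γ ≤ 0.001) :
    mwhvcTime γ (f * (1 + Real.logb 2 M)) (2 ^ f * M * Δ) ε ≤ 1000 * simplifiedTime f Δ M ε := by
  have hF : 1 ≤ (f : ℝ) * (1 + Real.logb 2 M) :=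
    one_le_mul_of_one_le_of_one_le (Nat.one_le_cast.2 hf)
      (le_add_of_nonneg_right (Real.logb_nonneg one_lt_two hM))
  have hDd := logb_max_le_two_mul_add (Δ := Δ) hf hM
  have hΔ' : Δ ≤ 2 ^ f * M * Δ := le_mul_of_one_le_left hΔ
    (one_le_mul_of_one_le_of_one_le (one_le_pow₀ one_le_two) hM)
  have hdD : Real.logb 2 (max 3 Δ) ≤ Real.logb 2 (max 3 (2 ^ f * M * Δ)) :=
    Real.logb_le_logb_of_le one_lt_two (by positivity) (max_le_max le_rfl hΔ')
  have hd := three_halves_le_logb Δ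
  have hq := third_le_div_logb Δ
  rw [mwhvcTime, simplifiedTime]
  set F := (f : ℝ) * (1 + Real.logb 2 M)
  set d := Real.logb 2 (max 3 Δ)
  set D := Real.logb 2 (max 3 (2 ^ f * M * Δ))
  set E := 1 + Real.logb 2 ε⁻¹
  have hE : 1 ≤ E :=
    le_add_of_nonneg_right (Real.logb_nonneg one_lt_two ((one_le_inv₀ hε).2 hε1))
  have hX : F * Real.logb 2 (F / ε) ≤ 167 * (F ^ (1.009 : ℝ) * E) := mul_logb_div_le hF hε hε1
  set S := F ^ (1.01 : ℝ) * E * d ^ (0.01 : ℝ) with hS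
  have hrankS : F ^ (1.009 : ℝ) * E ≤ S :=
    calc F ^ (1.009 : ℝ) * E ≤ F ^ (1.01 : ℝ) * E := by gcongr; norm_num
      _ ≤ S := le_mul_of_one_le_right (by positivity)
        (Real.one_le_rpow (by linarith) (by norm_num))
  have hFS : F ≤ S :=
    calc F = F ^ (1 : ℝ) * 1 := by rw [Real.rpow_one, mul_one]
      _ ≤ F ^ (1.009 : ℝ) * E := by gcongr; norm_num
      _ ≤ S := hrankS
  have hmin : F * Real.logb 2 (F / ε) * D ^ γ ≤ 668 * S :=
    calc _ ≤ 167 * (F ^ (1.009 : ℝ) * E) * (4 * (F ^ (0.001 : ℝ) * d ^ (0.01 : ℝ))) := by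
          exact mul_le_mul hX (rpow_le_of_le_two_mul_add hγ hF hd hdD hDd)
            (Real.rpow_nonneg (by linarith) _) (by positivity)
      _ = 668 * ((F ^ (1.009 : ℝ) * F ^ (0.001 : ℝ)) * E * d ^ (0.01 : ℝ)) := by ring
      _ = 668 * S := by rw [← Real.rpow_add (by linarith)]; norm_num [hS]
  linarith [min_le_right D (F * Real.logb 2 (F / ε) * D ^ γ),
    div_logb_le_add (by linarith) hd hdD hDd]

/-- The number of halvings after which a tolerance `β` is reached. -/
def toleranceExp (β : ℝ) : ℕ := ⌈-Real.logb 2 β⌉₊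

theorem toleranceExp_le_iff {β : ℝ} (hβ : 0 < β) {N : ℕ} :
    toleranceExp β ≤ N ↔ (2 : ℝ)⁻¹ ^ N ≤ β := by
  rw [toleranceExp, Nat.ceil_le, neg_le, Real.le_logb_iff_rpow_le one_lt_two hβ,
    Real.rpow_neg zero_le_two, Real.rpow_natCast, inv_pow]

theorem toleranceExp_add_one_le {f ε' : ℝ} (hf : 1 ≤ f) (hε : 0 < ε) (hε1 : ε ≤ 1)
    (hεε' : ε ≤ ε') :
    (toleranceExp (ε' / (f + ε')) : ℝ) + 1 ≤ 4 * (1 + Real.logb 2 (f / ε)) := by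
  have hε' : 0 < ε' := hε.trans_le hεε'
  have hlog := logb_div_nonneg hf hε hε1
  have hquot : (f + ε') / ε' ≤ 2 * (f / ε) := by
    rw [add_div, div_self hε'.ne', two_mul]
    exact add_le_add (by gcongr) ((one_le_div hε).2 (hε1.trans hf))
  have hneg : -Real.logb 2 (ε' / (f + ε')) ≤ 1 + Real.logb 2 (f / ε) := by
    rw [← Real.logb_inv, inv_div]
    calc Real.logb 2 ((f + ε') / ε') ≤ Real.logb 2 (2 * (f / ε)) :=
          Real.logb_le_logb_of_le one_lt_two (by positivity) hquot
      _ = 1 + Real.logb 2 (f / ε) := by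
          rw [Real.logb_mul two_ne_zero (by positivity), Real.logb_self_eq_one one_lt_two]
  have hpos : 0 ≤ -Real.logb 2 (ε' / (f + ε')) :=
    neg_nonneg.2 (Real.logb_nonpos one_lt_two (by positivity)
      ((div_le_one (by linarith)).2 (by linarith)))
  have := Nat.ceil_lt_add_one hpos
  rw [toleranceExp]
  linarith

end TimeBound

namespace CoveringILP

theorem logb_maxRatio_add_logb_maxDegree_le {n m : ℕ} {P : CoveringILP m n} (hΔ : 1 ≤ P.maxDegree)
    (f : ℕ) : Real.logb 2 P.maxRatio + Real.logb 2 P.maxDegree ≤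
      Real.logb 2 (max 3 (2 ^ f * P.maxRatio * P.maxDegree)) := by
  have hM := P.one_le_maxRatio
  have hΔ' : (0 : ℝ) < P.maxDegree := Nat.cast_pos.2 hΔ
  rw [← Real.logb_mul (by linarith) hΔ'.ne']
  refine Real.logb_le_logb_of_le one_lt_two (by positivity) (le_trans ?_ (le_max_right _ _))
  rw [mul_assoc]
  exact le_mul_of_one_le_left (by positivity) (one_le_pow₀ one_le_two)

theorem exists_le_mul_mwhvcTime {γ : ℝ} (hγ : 0 < γ) :
    ∃ C : ℝ, 0 < C ∧ ∀ (n m : ℕ) (P : CoveringILP m n) (θ : BidParams) (ε ε' : ℝ),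
      P.Fits θ → 0 < ε → ε ≤ 1 → ε ≤ ε' → θ.Z = toleranceExp (ε' / (θ.F + ε')) →
      ∀ (i : Fin m) (τ : ℕ), (P.row i).Nonempty →
        0 < P.residual (P.bidRun θ (raiseExp (min γ (1 / 2))) τ).x i →
        (τ : ℝ) ≤
          C * mwhvcTime γ (P.expandedRank θ) (2 ^ θ.F * P.maxRatio * P.maxDegree) ε := by
  have : 0 < min γ (1 / 2) := lt_min hγ (by norm_num)
  classical
  refine ⟨60 * 2000 + 16 * 2000 / min γ (1 / 2) + 384 * 2000 ^ 2, by positivity, ?_⟩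
  intro n m P θ ε ε' h hε hε1 hεε' hZ i τ hne hi
  have hF : (1 : ℝ) ≤ θ.F := Nat.one_le_cast.2 h.F_pos
  have hFF : (θ.F : ℝ) ≤ P.expandedRank θ :=
    le_mul_of_one_le_right (by linarith) (le_add_of_nonneg_right P.logb_maxRatio_nonneg)
  have hF' : 1 ≤ P.expandedRank θ := hF.trans hFF
  have hΔ : 1 ≤ P.maxDegree := by
    obtain ⟨j, hj⟩ := hne
    exact (Finset.card_pos.2 ⟨i, mem_col.2 (mem_row.1 hj)⟩).trans_le (P.col_card_le_maxDegree j)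
  have hlog := logb_div_nonneg hF' hε hε1
  have hZ' : (θ.Z : ℝ) + 1 ≤ 4 * (1 + Real.logb 2 (P.expandedRank θ / ε)) := by
    have hmono : Real.logb 2 (θ.F / ε) ≤ Real.logb 2 (P.expandedRank θ / ε) :=
      Real.logb_le_logb_of_le one_lt_two (by positivity) (by gcongr)
    rw [hZ]
    linarith [toleranceExp_add_one_le hF hε hε1 hεε']
  have hZF := mul_le_mul_of_nonneg_right hZ' (by linarith : 0 ≤ P.expandedRank θ)
  have hD := logb_maxRatio_add_logb_maxDegree_le hΔ θ.F
  have hD' := three_halves_le_logb (2 ^ θ.F * P.maxRatio * P.maxDegree)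
  have hX : 0 ≤ P.expandedRank θ * Real.logb 2 (P.expandedRank θ / ε) := by positivity
  refine le_mul_add_div_logb_add_min (by norm_num) hγ hD' hX
    (mul_one_add_logb_le hF' hε hε1) ((h.sum_raises_le hi hne).trans ?_)
    ((h.sum_not_raises_le hi).trans ?_)
  · linarith
  · linarith

end CoveringILP

/-! ### The message-passing program -/

/-- The natural number `N`, written in binary and truncated to `bw` bits. -/
def Message.ofNat (bw N : ℕ) : Message bw :=
  ⟨N.bits.take bw, by rw [List.length_take]; exact min_le_left _ _⟩

/-- The natural number whose binary representation is the message. -/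
def Message.toNat {bw : ℕ} (M : Message bw) : ℕ := Nat.ofDigits 2 (M.1.map fun b => cond b 1 0)

theorem Message.toNat_ofNat {bw N : ℕ} (h : N < 2 ^ bw) :
    Message.toNat (Message.ofNat bw N) = N := by
  have hlength : N.bits.length ≤ bw := by
    rw [Nat.size_eq_bits_len]
    exact Nat.size_le.2 h
  change Nat.ofDigits 2 ((N.bits.take bw).map _) = N
  rw [List.take_of_length_le hlength, ← Nat.digits_two_eq_bits, Nat.ofDigits_digits]

theorem pair_lt_two_pow {x y E bw : ℕ} (hE : 2 * E ≤ bw) (hx : x < 2 ^ E) (hy : y < 2 ^ E) :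
    Nat.pair x y < 2 ^ bw :=
  calc Nat.pair x y < (max x y + 1) ^ 2 := Nat.pair_lt_max_add_one_sq x y
    _ ≤ (2 ^ E) ^ 2 := Nat.pow_le_pow_left (max_lt hx hy) 2
    _ = 2 ^ (2 * E) := by rw [← pow_mul, mul_comm]
    _ ≤ 2 ^ bw := Nat.pow_le_pow_right two_pos hE

open Classical in
/-- The numerator in a representation of `x` as a quotient of numbers of at most `K` bits. -/
def shortNum (K : ℕ) (x : ℝ) : ℕ := if h : IsShort K x then h.choose else 0

open Classical in
/-- The denominator that belongs to `shortNum K x`. -/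
def shortDen (K : ℕ) (x : ℝ) : ℕ := if h : IsShort K x then h.choose_spec.choose else 0

theorem shortNum_lt {K : ℕ} {x : ℝ} (h : IsShort K x) : shortNum K x < 2 ^ K := by
  rw [shortNum, dif_pos h]
  exact h.choose_spec.choose_spec.1

theorem shortDen_lt {K : ℕ} {x : ℝ} (h : IsShort K x) : shortDen K x < 2 ^ K := by
  rw [shortDen, dif_pos h]
  exact h.choose_spec.choose_spec.2.2.1

theorem shortNum_div_shortDen {K : ℕ} {x : ℝ} (h : IsShort K x) :
    (shortNum K x : ℝ) / shortDen K x = x := by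
  rw [shortNum, shortDen, dif_pos h, dif_pos h]
  exact h.choose_spec.choose_spec.2.2.2.symm

/-- The numbers received if exactly the nodes in `s` send a message, node `i` the number `u i`. -/
def messages {k : ℕ} (s : Finset (Fin k)) (u : Fin k → ℕ) (i : Fin k) : Option ℕ :=
  if i ∈ s then some (u i) else none

/-- The nodes from which a number has been received. -/
def senders {k : ℕ} (f : Fin k → Option ℕ) : Finset (Fin k) := {i | (f i).isSome}

/-- The pair of numbers received from node `i`, and `(0, 0)` if there was no message. -/
def receivedPair {k : ℕ} (f : Fin k → Option ℕ) (i : Fin k) : ℕ × ℕ := (f i).elim (0, 0) Nat.unpair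

theorem lt_of_messages_eq_some {k B : ℕ} {s : Finset (Fin k)} {u : Fin k → ℕ}
    (h : ∀ i ∈ s, u i < B) (i : Fin k) (N : ℕ) (hN : messages s u i = some N) : N < B := by
  unfold messages at hN
  split_ifs at hN with hi
  exact Option.some.inj hN ▸ h i hi

theorem senders_messages {k : ℕ} (s : Finset (Fin k)) (u : Fin k → ℕ) :
    senders (messages s u) = s := by
  ext i
  by_cases hi : i ∈ s <;> simp [senders, messages, hi]

theorem receivedPair_messages {k : ℕ} (s : Finset (Fin k)) (u v : Fin k → ℕ) (i : Fin k) :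
    receivedPair (messages s fun i => Nat.pair (u i) (v i)) i =
      if i ∈ s then (u i, v i) else (0, 0) := by
  by_cases hi : i ∈ s <;> simp [receivedPair, messages, hi]

theorem messages_eq_some_one_iff {k : ℕ} {s : Finset (Fin k)} {p : Fin k → Prop} [DecidablePred p]
    {i : Fin k} : messages s (fun i => if p i then 1 else 0) i = some 1 ↔ i ∈ s ∧ p i := by
  by_cases hi : i ∈ s <;> simp [messages, hi]

/-- What a constraint node knows: its right-hand side, its row, and the values of its variables. -/
structure RowView (n : ℕ) where
  b : ℝ
  a : Fin n → ℝ
  x : Fin n → ℕ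

/-- The residual of the constraint, as computed by its node. -/
def RowView.residual {n : ℕ} (R : RowView n) : ℝ := R.b - ∑ j, R.a j * (R.x j : ℝ)

/-- The scale of the bid for variable `j`, as computed by the node of the constraint. -/
def RowView.scale {n : ℕ} (R : RowView n) (F : ℕ) (j : Fin n) : ℕ := scaleOf F R.residual (R.a j)

/-- The states of the nodes. The states `varReport`, …, `varAwaitScale` and `rowAwaitReport`, …,
`rowRescale` belong to the four rounds of an iteration; their last argument is the number of the
iteration. -/
inductive NodeState (n m : ℕ) : Type
  | varInit (w : ℝ) (c : Fin m → ℝ)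
  | varWait (w : ℝ)
  | varReport (V : VarView m) (t : ℕ)
  | varAwaitDecision (V : VarView m) (t : ℕ)
  | varAnnounce (V : VarView m) (t : ℕ)
  | varAwaitScale (V : VarView m) (t : ℕ)
  | varHalt (x : ℕ)
  | rowInit (b : ℝ)
  | rowReady (R : RowView n) (N : ℕ)
  | rowAwaitReport (R : RowView n) (t : ℕ)
  | rowDecide (R : RowView n) (r : Prop) (t : ℕ)
  | rowAwaitValue (R : RowView n) (t : ℕ)
  | rowRescale (R : RowView n) (N t : ℕ)
  | rowHalt

namespace NodeState

variable {n m : ℕ}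

open Classical in
/-- The number that a node in the given state sends to a neighbour. Values of variables are capped
at `2 ^ (2 * K)`, which satisfies all constraints anyway. -/
def content (θ : BidParams) (a : ℕ → ℕ) : NodeState n m → Fin n ⊕ Fin m → Option ℕ
  | varInit w c, Sum.inr i => some (Nat.pair
      (Nat.pair (shortNum θ.K (c i)) (shortDen θ.K (c i)))
      (Nat.pair (startReduction θ.K (Finset.univ.filter fun i => c i ≠ 0).card w)
        (if w = 0 then 1 else 0)))
  | varReport V t, Sum.inr i => some (if V.Stuck (a t) i then 1 else 0)
  | varAnnounce V _, Sum.inr i => some (Nat.pair (min V.x (2 ^ (2 * θ.K))) (V.maxHalvings θ.Z i))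
  | rowReady R N, Sum.inl j => some (Nat.pair N (R.scale θ.F j))
  | rowDecide _ r _, Sum.inl _ => some (if r then 1 else 0)
  | rowRescale R N _, Sum.inl j => some (Nat.pair N (R.scale θ.F j))
  | _, _ => none

/-- The first view of a variable node, from the reductions and scales received from its active
constraints. -/
def varStart (θ : BidParams) (w : ℝ) (f : Fin m → Option ℕ) : VarView m where
  w := w
  x := startValue θ.K w
  paid _ := 0
  topScale := (senders f).sup fun i => (receivedPair f i).2
  active := senders f
  bidExp i := if i ∈ senders f then (θ.K : ℤ) - (receivedPair f i).1 else 0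
  scale i := (receivedPair f i).2

/-- The view of a variable node for the next iteration, from the reductions and scales received
from its active constraints. -/
def varUpdate (V : VarView m) (f : Fin m → Option ℕ) : VarView m :=
  { V with
    active := senders f
    bidExp := fun i => if i ∈ senders f then V.bidExp i - (receivedPair f i).1 else 0
    scale := fun i => (receivedPair f i).2 }

/-- The first view of a constraint node, from the coefficients and the flags for weight `0` received
from its variables. The coefficient of a variable without a link is `0 / 0 = 0`. -/
def rowStart (θ : BidParams) (b : ℝ) (f : Fin n → Option ℕ) : RowView n where
  b := b
  a j := ((receivedPair f j).1.unpair.1 : ℝ) / (receivedPair f j).1.unpair.2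
  x j := if (receivedPair f j).2.unpair.2 = 1 then 2 ^ (2 * θ.K) else 0

/-- The reduction of the initial bid of a constraint, from the demands of its variables. -/
def rowStartReduction (f : Fin n → Option ℕ) : ℕ :=
  (senders f).sup fun j => (receivedPair f j).2.unpair.1

/-- The view of a constraint node after it has received the new values of its variables. -/
def rowUpdate (R : RowView n) (f : Fin n → Option ℕ) : RowView n :=
  { R with x := fun j => (receivedPair f j).1 }

/-- The reduction of the bid of a constraint at the end of an iteration, from the demands of its
variables and its loss of scale. -/
def rowUpdateReduction (θ : BidParams) (R : RowView n) (f : Fin n → Option ℕ) : ℕ :=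
  ((senders f).sup fun j => (receivedPair f j).2) +
    (θ.Z + 3) * ∑ j, (R.scale θ.F j - (rowUpdate R f).scale θ.F j)

/-- The next state, from the numbers received from variables (`f`) and constraints (`h`). -/
def next (θ : BidParams) (a : ℕ → ℕ) (f : Fin n → Option ℕ) (h : Fin m → Option ℕ) :
    NodeState n m → NodeState n m
  | varInit w _ => varWait w
  | varWait w =>
      if (varStart θ w h).active.Nonempty then varReport (varStart θ w h) 0
      else varHalt (varStart θ w h).x
  | varReport V t => varAwaitDecision V t
  | varAwaitDecision V t => varAnnounce ((V.raise (a t) fun i => h i = some 1).settle θ.β) t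
  | varAnnounce V t => varAwaitScale V t
  | varAwaitScale V t =>
      if (varUpdate V h).active.Nonempty then varReport (varUpdate V h) (t + 1) else varHalt V.x
  | varHalt x => varHalt x
  | rowInit b =>
      if 0 < (rowStart θ b f).residual then rowReady (rowStart θ b f) (rowStartReduction f)
      else rowHalt
  | rowReady R _ => rowAwaitReport R 0
  | rowAwaitReport R t => rowDecide R (∀ j, f j ≠ some 1) t
  | rowDecide R _ t => rowAwaitValue R t
  | rowAwaitValue R t =>
      if 0 < (rowUpdate R f).residual then rowRescale (rowUpdate R f) (rowUpdateReduction θ R f) t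
      else rowHalt
  | rowRescale R _ t => rowAwaitReport R (t + 1)
  | rowHalt => rowHalt

/-- The output of a node that has halted. -/
def out : NodeState n m → Option ℕ
  | varHalt x => some x
  | rowHalt => some 0
  | _ => none

theorem content_eq_none {θ : BidParams} {a : ℕ → ℕ} {s : NodeState n m} (h : ¬s.out.isNone)
    (u : Fin n ⊕ Fin m) : s.content θ a u = none := by
  cases s <;> first | rfl | exact absurd rfl h

theorem next_eq_self {θ : BidParams} {a : ℕ → ℕ} {s : NodeState n m} (h : s.out.isSome)
    (f : Fin n → Option ℕ) (g : Fin m → Option ℕ) : s.next θ a f g = s := by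
  cases s <;> first | rfl | cases h

end NodeState

/-- The bidding process as a message-passing program. -/
def bidAlg (n m bw : ℕ) (θ : BidParams) (a : ℕ → ℕ) : CongestAlg n m bw where
  State := NodeState n m
  initVar _ w c := .varInit w c
  initCon _ b _ := .rowInit b
  send s u := (s.content θ a u).map (Message.ofNat bw)
  recv s f := s.next θ a (fun j => (f (Sum.inl j)).map Message.toNat)
    (fun i => (f (Sum.inr i)).map Message.toNat)
  output := NodeState.out

namespace VarView

theorem Valid.settle_x_eq {m : ℕ} {V : VarView m} {β : ℝ} (h : V.Valid β) (hV : V.active = ∅) :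
    (V.settle β).x = V.x := by
  have hpaid : V.paidAfter = V.paid := by
    funext T
    simp [paidAfter, hV]
  refine max_eq_left ?_
  rw [hpaid]
  rcases h.w_nonneg.eq_or_lt with hw | hw
  · have huniv : {T : ℕ | (1 - β) * V.w * T ≤ V.paid T} = Set.univ :=
      Set.eq_univ_of_forall fun T => by simpa [← hw] using h.paid_nonneg T
    rw [huniv, Nat.sSup_of_not_bddAbove not_bddAbove_univ]
    exact Nat.zero_le _
  · exact csSup_le' fun T hT => not_lt.1 fun hlt => (h.unsat hw T hlt).not_ge hT

theorem maxHalvings_le {m : ℕ} (V : VarView m) (Z : ℕ) (i : Fin m) : V.maxHalvings Z i ≤ Z + 1 :=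
  Finset.sup_le fun _ _ => min_le_left _ _

end VarView

namespace CoveringILP

variable {n m bw : ℕ} {P : CoveringILP m n} {θ : BidParams} {a : ℕ → ℕ}

theorem network_adj_inl_inr {j : Fin n} {i : Fin m} :
    P.network.Adj (Sum.inl j) (Sum.inr i) ↔ P.A i j ≠ 0 := by
  simp [network, SimpleGraph.fromRel_adj]

theorem network_adj_inr_inl {j : Fin n} {i : Fin m} :
    P.network.Adj (Sum.inr i) (Sum.inl j) ↔ P.A i j ≠ 0 := by
  rw [SimpleGraph.adj_comm, network_adj_inl_inr]

theorem not_network_adj_inl_inl {j j' : Fin n} : ¬P.network.Adj (Sum.inl j) (Sum.inl j') := by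
  simp [network, SimpleGraph.fromRel_adj]

theorem not_network_adj_inr_inr {i i' : Fin m} : ¬P.network.Adj (Sum.inr i) (Sum.inr i') := by
  simp [network, SimpleGraph.fromRel_adj]

/-- The numbers sent to variable `j` if the nodes are in the states `s`. -/
def fromRows (P : CoveringILP m n) (θ : BidParams) (a : ℕ → ℕ) (s : Fin n ⊕ Fin m → NodeState n m)
    (j : Fin n) (i : Fin m) : Option ℕ :=
  if P.A i j ≠ 0 then (s (Sum.inr i)).content θ a (Sum.inl j) else none

/-- The numbers sent to constraint `i` if the nodes are in the states `s`. -/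
def fromVars (P : CoveringILP m n) (θ : BidParams) (a : ℕ → ℕ) (s : Fin n ⊕ Fin m → NodeState n m)
    (i : Fin m) (j : Fin n) : Option ℕ :=
  if P.A i j ≠ 0 then (s (Sum.inl j)).content θ a (Sum.inr i) else none

theorem fromRows_eq_none {s : Fin n ⊕ Fin m → NodeState n m} {j : Fin n}
    (h : ∀ i, (s (Sum.inr i)).content θ a (Sum.inl j) = none) :
    P.fromRows θ a s j = messages ∅ 0 := by
  funext i
  simp [fromRows, messages, h i]

theorem fromVars_eq_none {s : Fin n ⊕ Fin m → NodeState n m} {i : Fin m}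
    (h : ∀ j, (s (Sum.inl j)).content θ a (Sum.inr i) = none) :
    P.fromVars θ a s i = messages ∅ 0 := by
  funext j
  simp [fromVars, messages, h j]

theorem fromVars_eq_messages {s : Fin n ⊕ Fin m → NodeState n m} {i : Fin m} {u : Fin n → ℕ}
    (h : ∀ j, P.A i j ≠ 0 → (s (Sum.inl j)).content θ a (Sum.inr i) = some (u j)) :
    P.fromVars θ a s i = messages (P.row i) u := by
  funext j
  simp only [fromVars, messages, mem_row]
  exact ite_congr rfl (h j) fun _ => rfl

open Classical in
theorem map_toNat_send {s : NodeState n m} {u v : Fin n ⊕ Fin m}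
    (hs : ∀ N, P.network.Adj u v → s.content θ a v = some N → N < 2 ^ bw) :
    (if P.network.Adj u v ∧ s.out.isNone then (s.content θ a v).map (Message.ofNat bw)
      else none).map Message.toNat =
      if P.network.Adj u v then s.content θ a v else none := by
  by_cases hadj : P.network.Adj u v
  · cases hcontent : s.content θ a v with
    | none => simp
    | some N =>
      have hlive : s.out.isNone := not_not.1 fun ho => by
        cases (NodeState.content_eq_none ho v).symm.trans hcontent
      simp [hadj, hlive, Message.toNat_ofNat (hs N hadj hcontent)]
  · simp [hadj]

theorem round_of_halted {s : Fin n ⊕ Fin m → NodeState n m} {v : Fin n ⊕ Fin m}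
    (h : (s v).out.isSome) : (bidAlg n m bw θ a).round P s v = s v :=
  if_pos h

theorem round_inl {s : Fin n ⊕ Fin m → NodeState n m} {j : Fin n} {f : Fin m → Option ℕ}
    (hf : P.fromRows θ a s j = f) (hlt : ∀ i N, f i = some N → N < 2 ^ bw) :
    (bidAlg n m bw θ a).round P s (Sum.inl j) =
      (s (Sum.inl j)).next θ a (fun _ => none) f := by
  classical
  subst hf
  by_cases ho : (s (Sum.inl j)).out.isSome
  · rw [round_of_halted ho, NodeState.next_eq_self ho]
  · refine (if_neg ho).trans (congrArg₂ (NodeState.next θ a · · _) ?_ ?_)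
    · funext j'
      exact (map_toNat_send fun _ hadj => absurd hadj not_network_adj_inl_inl).trans
        (if_neg not_network_adj_inl_inl)
    · funext i
      refine (map_toNat_send fun N hadj hN => hlt i N ?_).trans
        (if_congr network_adj_inr_inl rfl rfl)
      rwa [fromRows, if_pos (network_adj_inr_inl.1 hadj)]

theorem round_inr {s : Fin n ⊕ Fin m → NodeState n m} {i : Fin m} {f : Fin n → Option ℕ}
    (hf : P.fromVars θ a s i = f) (hlt : ∀ j N, f j = some N → N < 2 ^ bw) :
    (bidAlg n m bw θ a).round P s (Sum.inr i) =
      (s (Sum.inr i)).next θ a f (fun _ => none) := by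
  classical
  subst hf
  by_cases ho : (s (Sum.inr i)).out.isSome
  · rw [round_of_halted ho, NodeState.next_eq_self ho]
  · refine (if_neg ho).trans (congrArg₂ (NodeState.next θ a · · _) ?_ ?_)
    · funext j
      refine (map_toNat_send fun N hadj hN => hlt j N ?_).trans
        (if_congr network_adj_inl_inr rfl rfl)
      rwa [fromVars, if_pos (network_adj_inl_inr.1 hadj)]
    · funext i'
      exact (map_toNat_send fun _ hadj => absurd hadj not_network_adj_inr_inr).trans
        (if_neg not_network_adj_inr_inr)

/-- What the node of constraint `i` knows when the values of the variables are `x`. -/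
def rowView (P : CoveringILP m n) (x : Fin n → ℕ) (i : Fin m) : RowView n where
  b := P.b i
  a := P.A i
  x j := if j ∈ P.row i then x j else 0

theorem residual_congr {x y : Fin n → ℕ} {i : Fin m} (h : ∀ j ∈ P.row i, x j = y j) :
    P.residual x i = P.residual y i := by
  unfold residual
  congr 1
  refine Finset.sum_congr rfl fun j _ => ?_
  by_cases hij : P.A i j = 0
  · simp [hij]
  · rw [h j (mem_row.2 hij)]

theorem rowView_congr {x y : Fin n → ℕ} {i : Fin m} (h : ∀ j ∈ P.row i, x j = y j) :
    P.rowView x i = P.rowView y i := by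
  unfold rowView
  congr 1
  funext j
  exact ite_congr rfl (h j) fun _ => rfl

theorem rowView_residual (P : CoveringILP m n) (x : Fin n → ℕ) (i : Fin m) :
    (P.rowView x i).residual = P.residual x i :=
  residual_congr fun _ hj => if_pos hj

theorem rowView_scale (P : CoveringILP m n) (θ : BidParams) (x : Fin n → ℕ) (i : Fin m)
    (j : Fin n) : (P.rowView x i).scale θ.F j = P.scale θ x i j := by
  rw [RowView.scale, rowView_residual]
  rfl

theorem scale_eq_zero {x : Fin n → ℕ} {i : Fin m} {j : Fin n} (h : j ∉ P.row i) :
    P.scale θ x i j = 0 := by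
  simp [scale, scaleOf, not_not.1 (mt mem_row.2 h)]

/-- The number of halvings of the bid of constraint `i` at the end of an iteration. -/
def rowReduction (P : CoveringILP m n) (θ : BidParams) (g : BidState n m) (a : ℕ) (i : Fin m) : ℕ :=
  P.rowHalvings θ g a i +
    (θ.Z + 3) * ∑ j, (P.scale θ g.x i j - P.scale θ (P.step θ a g).x i j)

theorem step_bidExp (P : CoveringILP m n) (θ : BidParams) (g : BidState n m) (a : ℕ) (i : Fin m) :
    (P.step θ a g).bidExp i = P.bid θ g a i - P.rowReduction θ g a i := by
  have hsum : ((∑ j, (P.scale θ g.x i j - P.scale θ (P.step θ a g).x i j) : ℕ) : ℤ) =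
      ∑ j ∈ P.row i, ((P.scale θ g.x i j : ℤ) - P.scale θ (P.step θ a g).x i j) := by
    rw [Nat.cast_sum, ← Finset.sum_subset (Finset.subset_univ (P.row i)) fun j _ hj => by
      rw [scale_eq_zero hj, Nat.zero_sub, Nat.cast_zero]]
    exact Finset.sum_congr rfl fun j _ => Nat.cast_sub (scale_anti (P.le_step_x θ a g) i j)
  rw [rowReduction, Nat.cast_add, Nat.cast_mul, hsum, ← sub_sub]
  rfl

theorem varUpdate_settled (P : CoveringILP m n) (θ : BidParams) (g : BidState n m) (a : ℕ)
    (j : Fin n) :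
    NodeState.varUpdate (P.settled θ g a j) (messages (P.active (P.step θ a g).x j) fun i =>
      Nat.pair (P.rowReduction θ g a i) (P.scale θ (P.step θ a g).x i j)) =
      P.view θ (P.step θ a g) j := by
  unfold NodeState.varUpdate view
  simp only [senders_messages, receivedPair_messages]
  refine (VarView.mk.injEq ..).mpr ⟨rfl, rfl, rfl, rfl, rfl, ?_, ?_⟩
  · funext i
    refine ite_congr rfl (fun hi => ?_) fun _ => rfl
    rw [if_pos hi, step_bidExp]
    exact congrArg (· - _) (raised_bidExp (active_anti (P.le_step_x θ a g) j hi) a)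
  · funext i
    exact apply_ite Prod.snd _ _ _

/-- The number of halvings by which constraint `i` obtains its initial bid from `2 ^ K`. -/
def rowStartReduction (P : CoveringILP m n) (θ : BidParams) (i : Fin m) : ℕ :=
  (P.row i).sup fun j => startReduction θ.K (P.col j).card (P.w j)

theorem rowStartReduction_messages (P : CoveringILP m n) (θ : BidParams) (u v : Fin n → ℕ)
    (i : Fin m) :
    NodeState.rowStartReduction (messages (P.row i) fun j => Nat.pair (u j)
      (Nat.pair (startReduction θ.K (P.col j).card (P.w j)) (v j))) = P.rowStartReduction θ i := by
  unfold NodeState.rowStartReduction rowStartReduction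
  rw [senders_messages]
  refine Finset.sup_congr rfl fun j hj => ?_
  rw [receivedPair_messages, if_pos hj, Nat.unpair_pair]

theorem varStart_messages (P : CoveringILP m n) (θ : BidParams) (j : Fin n) :
    NodeState.varStart θ (P.w j) (messages (P.active (P.start θ).x j) fun i =>
      Nat.pair (P.rowStartReduction θ i) (P.scale θ (P.start θ).x i j)) =
        P.view θ (P.start θ) j := by
  unfold NodeState.varStart view
  simp only [senders_messages, receivedPair_messages]
  refine (VarView.mk.injEq ..).mpr ⟨rfl, rfl, rfl, ?_, rfl, ?_, ?_⟩
  · exact Finset.sup_congr rfl fun i hi => by rw [if_pos hi]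
  · funext i
    refine ite_congr rfl (fun hi => ?_) fun _ => rfl
    rw [if_pos hi]
    rfl
  · funext i
    exact apply_ite Prod.snd _ _ _

theorem rowStart_messages {i : Fin m} (hA : ∀ j, IsShort θ.K (P.A i j)) :
    NodeState.rowStart θ (P.b i) (messages (P.row i) fun j => Nat.pair
      (Nat.pair (shortNum θ.K (P.A i j)) (shortDen θ.K (P.A i j)))
      (Nat.pair (startReduction θ.K (P.col j).card (P.w j)) (if P.w j = 0 then 1 else 0))) =
      P.rowView (P.start θ).x i := by
  unfold NodeState.rowStart rowView
  simp only [receivedPair_messages]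
  refine (RowView.mk.injEq ..).mpr ⟨rfl, ?_, ?_⟩
  · funext j
    by_cases hj : j ∈ P.row i
    · simp [hj, shortNum_div_shortDen (hA j)]
    · simp [hj, not_not.1 (mt mem_row.2 hj)]
  · funext j
    by_cases hj : j ∈ P.row i
    · simp [hj, start, startValue]
    · simp [hj]

theorem rowUpdate_rowView (P : CoveringILP m n) (x y v : Fin n → ℕ) (i : Fin m) :
    NodeState.rowUpdate (P.rowView x i) (messages (P.row i) fun j => Nat.pair (y j) (v j)) =
      P.rowView y i := by
  unfold NodeState.rowUpdate rowView
  simp only [receivedPair_messages]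
  refine (RowView.mk.injEq ..).mpr ⟨rfl, rfl, ?_⟩
  funext j
  exact apply_ite Prod.fst _ _ _

theorem Fits.lt_of_residual_pos (h : P.Fits θ) {x : Fin n → ℕ} {i : Fin m}
    (hx : 0 < P.residual x i) {j : Fin n} (hj : j ∈ P.row i) : x j < 2 ^ (2 * θ.K) := by
  have hAx : P.A i j * x j < P.A i j * 2 ^ (2 * θ.K) := by
    linarith [P.residual_le_sub x i j, h.b_le i j (mem_row.1 hj)]
  exact_mod_cast lt_of_mul_lt_mul_left hAx (P.A_nonneg i j)

theorem Fits.residual_min_pos_iff (h : P.Fits θ) {x : Fin n → ℕ} {i : Fin m} :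
    0 < P.residual (fun j => min (x j) (2 ^ (2 * θ.K))) i ↔ 0 < P.residual x i := by
  constructor <;> intro hres
  · rwa [residual_congr fun j hj => ?_] at hres
    have := h.lt_of_residual_pos hres hj
    omega
  · rwa [residual_congr fun j hj => min_eq_left (h.lt_of_residual_pos hres hj).le]

/-- The states of the nodes when the values are `x` for the variable nodes and `y` for the
constraint nodes: nodes that still have work to do are in the states `v` and `r`, the others have
halted. -/
def liveNodes (P : CoveringILP m n) (x y : Fin n → ℕ) (v : Fin n → NodeState n m)
    (r : Fin m → NodeState n m) : Fin n ⊕ Fin m → NodeState n m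
  | Sum.inl j => if (P.active x j).Nonempty then v j else .varHalt (x j)
  | Sum.inr i => if 0 < P.residual y i then r i else .rowHalt

section LiveNodes

variable {x y x' y' : Fin n → ℕ} {v v' : Fin n → NodeState n m} {r r' : Fin m → NodeState n m}

theorem liveNodes_inl_of_active {j : Fin n} (hj : (P.active x j).Nonempty) :
    P.liveNodes x y v r (Sum.inl j) = v j := if_pos hj

theorem liveNodes_inr_of_pos {i : Fin m} (hi : 0 < P.residual y i) :
    P.liveNodes x y v r (Sum.inr i) = r i := if_pos hi

theorem fromRows_liveNodes {j : Fin n} {u : Fin m → ℕ}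
    (h : ∀ i, (r i).content θ a (Sum.inl j) = some (u i)) :
    P.fromRows θ a (P.liveNodes x y v r) j = messages (P.active y j) u := by
  funext i
  by_cases hi : 0 < P.residual y i
  · simp [fromRows, messages, mem_active, liveNodes_inr_of_pos hi, h i, hi]
  · simp [fromRows, messages, mem_active, liveNodes, NodeState.content, hi]

theorem fromRows_liveNodes_eq_none {j : Fin n}
    (h : ∀ i, (r i).content θ a (Sum.inl j) = none) :
    P.fromRows θ a (P.liveNodes x y v r) j = messages ∅ 0 :=
  fromRows_eq_none fun i => by
    dsimp only [liveNodes]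
    split_ifs
    exacts [h i, rfl]

theorem fromVars_liveNodes {i : Fin m} (hi : 0 < P.residual x i) {u : Fin n → ℕ}
    (h : ∀ j, (v j).content θ a (Sum.inr i) = some (u j)) :
    P.fromVars θ a (P.liveNodes x y v r) i = messages (P.row i) u :=
  fromVars_eq_messages fun j hij => by
    rw [liveNodes_inl_of_active ⟨i, mem_active.2 ⟨hij, hi⟩⟩, h j]

theorem fromVars_liveNodes_eq_none {i : Fin m}
    (h : ∀ j, (v j).content θ a (Sum.inr i) = none) :
    P.fromVars θ a (P.liveNodes x y v r) i = messages ∅ 0 :=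
  fromVars_eq_none fun j => by
    dsimp only [liveNodes]
    split_ifs
    exacts [h j, rfl]

theorem round_liveNodes (hxx' : x ≤ x') (hyy' : y ≤ y')
    (hx : ∀ j, ¬(P.active x j).Nonempty → x' j = x j)
    (hv : ∀ j, (P.active x j).Nonempty →
      (bidAlg n m bw θ a).round P (P.liveNodes x y v r) (Sum.inl j) =
        P.liveNodes x' y' v' r' (Sum.inl j))
    (hr : ∀ i, 0 < P.residual y i →
      (bidAlg n m bw θ a).round P (P.liveNodes x y v r) (Sum.inr i) =
        P.liveNodes x' y' v' r' (Sum.inr i)) :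
    (bidAlg n m bw θ a).round P (P.liveNodes x y v r) = P.liveNodes x' y' v' r' := by
  funext u
  rcases u with j | i
  · by_cases hj : (P.active x j).Nonempty
    · exact hv j hj
    · have hj' : ¬(P.active x' j).Nonempty := mt (Finset.Nonempty.mono (active_anti hxx' j)) hj
      have hhalt : P.liveNodes x y v r (Sum.inl j) = .varHalt (x j) := if_neg hj
      rw [round_of_halted (by rw [hhalt]; rfl), hhalt, ← hx j hj]
      exact (if_neg hj').symm
  · by_cases hi : 0 < P.residual y i
    · exact hr i hi
    · have hi' : ¬0 < P.residual y' i := fun h => hi (h.trans_le (residual_anti hyy' i))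
      have hhalt : P.liveNodes x y v r (Sum.inr i) = .rowHalt := if_neg hi
      rw [round_of_halted (by rw [hhalt]; rfl), hhalt]
      exact (if_neg hi').symm

end LiveNodes

/-- The states of the nodes before the first round of iteration `t`, in which the variables report
which constraints are stuck. -/
def nodesReport (P : CoveringILP m n) (θ : BidParams) (g : BidState n m) (t : ℕ) :
    Fin n ⊕ Fin m → NodeState n m :=
  P.liveNodes g.x g.x (fun j => .varReport (P.view θ g j) t)
    fun i => .rowAwaitReport (P.rowView g.x i) t

/-- The states of the nodes before the second round of iteration `t`, in which the constraints
announce whether they raise their bids. -/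
def nodesDecide (P : CoveringILP m n) (θ : BidParams) (g : BidState n m) (a t : ℕ) :
    Fin n ⊕ Fin m → NodeState n m :=
  P.liveNodes g.x g.x (fun j => .varAwaitDecision (P.view θ g j) t)
    fun i => .rowDecide (P.rowView g.x i) (P.Raises θ g a i) t

/-- The states of the nodes before the third round of iteration `t`, in which the variables announce
their new values and how often bids are to be halved. -/
def nodesAnnounce (P : CoveringILP m n) (θ : BidParams) (g : BidState n m) (a t : ℕ) :
    Fin n ⊕ Fin m → NodeState n m :=
  P.liveNodes g.x g.x (fun j => .varAnnounce (P.settled θ g a j) t)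
    fun i => .rowAwaitValue (P.rowView g.x i) t

/-- The states of the nodes before the fourth round of iteration `t`, in which the constraints
announce the reductions of their bids and their new scales. -/
def nodesRescale (P : CoveringILP m n) (θ : BidParams) (g : BidState n m) (a t : ℕ) :
    Fin n ⊕ Fin m → NodeState n m :=
  P.liveNodes g.x (P.step θ a g).x (fun j => .varAwaitScale (P.settled θ g a j) t)
    fun i => .rowRescale (P.rowView (P.step θ a g).x i) (P.rowReduction θ g a i) t

theorem bit_lt_two_pow (hbw : 0 < bw) (p : Prop) [Decidable p] :
    (if p then 1 else 0) < 2 ^ bw := by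
  have : 1 < 2 ^ bw := Nat.one_lt_two_pow hbw.ne'
  split_ifs <;> omega

theorem round_nodesReport (P : CoveringILP m n) (θ : BidParams) (a : ℕ → ℕ) (g : BidState n m)
    (t : ℕ) (hbw : 0 < bw) :
    (bidAlg n m bw θ a).round P (P.nodesReport θ g t) = P.nodesDecide θ g (a t) t := by
  classical
  refine round_liveNodes le_rfl le_rfl (fun _ _ => rfl) (fun j hj => ?_) fun i hi => ?_
  · refine (round_inl (fromRows_liveNodes_eq_none fun _ => rfl)
      (lt_of_messages_eq_some (by simp))).trans ?_
    rw [liveNodes_inl_of_active hj, liveNodes_inl_of_active hj]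
    rfl
  · refine (round_inr (fromVars_liveNodes hi fun _ => rfl)
      (lt_of_messages_eq_some fun _ _ => bit_lt_two_pow hbw _)).trans ?_
    rw [liveNodes_inr_of_pos hi, liveNodes_inr_of_pos hi]
    refine congrArg (NodeState.rowDecide _ · t) (propext (forall_congr' fun j => ?_))
    rw [ne_eq, messages_eq_some_one_iff, not_and]

theorem round_nodesDecide (P : CoveringILP m n) (θ : BidParams) (a : ℕ → ℕ) (g : BidState n m)
    (t : ℕ) (hbw : 0 < bw) :
    (bidAlg n m bw θ a).round P (P.nodesDecide θ g (a t) t) = P.nodesAnnounce θ g (a t) t := by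
  classical
  refine round_liveNodes le_rfl le_rfl (fun _ _ => rfl) (fun j hj => ?_) fun i hi => ?_
  · refine (round_inl (fromRows_liveNodes fun _ => rfl)
      (lt_of_messages_eq_some fun _ _ => bit_lt_two_pow hbw _)).trans ?_
    rw [liveNodes_inl_of_active hj, liveNodes_inl_of_active hj]
    have hraise : (P.view θ g j).raise (a t) (fun i => messages (P.active g.x j)
        (fun i => if P.Raises θ g (a t) i then 1 else 0) i = some 1) = P.raised θ g (a t) j := by
      unfold VarView.raise raised
      simp only [messages_eq_some_one_iff]
      refine (VarView.mk.injEq ..).mpr ⟨rfl, rfl, rfl, rfl, rfl, ?_, rfl⟩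
      funext i
      exact if_congr and_self_left rfl rfl
    exact congrArg (fun V : VarView m => NodeState.varAnnounce (V.settle θ.β) t) hraise
  · refine (round_inr (fromVars_liveNodes_eq_none fun _ => rfl)
      (lt_of_messages_eq_some (by simp))).trans ?_
    rw [liveNodes_inr_of_pos hi, liveNodes_inr_of_pos hi]
    rfl

theorem rowUpdateReduction_rowView {g : BidState n m} {a : ℕ} {i : Fin m} {y : Fin n → ℕ}
    (hy : ∀ j ∈ P.row i, y j = (P.step θ a g).x j) :
    NodeState.rowUpdateReduction θ (P.rowView g.x i) (messages (P.row i) fun j =>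
      Nat.pair (y j) ((P.settled θ g a j).maxHalvings θ.Z i)) = P.rowReduction θ g a i := by
  unfold NodeState.rowUpdateReduction rowReduction rowHalvings
  simp only [rowUpdate_rowView, rowView_congr hy, rowView_scale, senders_messages]
  congr 1
  refine Finset.sup_congr rfl fun j hj => ?_
  rw [receivedPair_messages, if_pos hj]

theorem Fits.next_rowAwaitValue (h : P.Fits θ) (a : ℕ → ℕ) (g : BidState n m) (t : ℕ)
    (i : Fin m) :
    (NodeState.rowAwaitValue (P.rowView g.x i) t).next θ a (messages (P.row i) fun j =>
      Nat.pair (min ((P.step θ (a t) g).x j) (2 ^ (2 * θ.K)))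
        ((P.settled θ g (a t) j).maxHalvings θ.Z i)) (fun _ => none) =
      P.nodesRescale θ g (a t) t (Sum.inr i) := by
  simp only [NodeState.next, rowUpdate_rowView, rowView_residual, h.residual_min_pos_iff]
  refine ite_congr rfl (fun hi => ?_) fun _ => rfl
  have hcap : ∀ j ∈ P.row i,
      min ((P.step θ (a t) g).x j) (2 ^ (2 * θ.K)) = (P.step θ (a t) g).x j := fun j hj =>
    min_eq_left (h.lt_of_residual_pos hi hj).le
  rw [rowView_congr hcap, rowUpdateReduction_rowView hcap]

theorem Fits.round_nodesAnnounce (h : P.Fits θ) (a : ℕ → ℕ) (g : BidState n m) (t : ℕ) {E : ℕ}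
    (hE : 2 * E ≤ bw) (hK : 2 * θ.K < E) (hZ : θ.Z + 1 < 2 ^ E) :
    (bidAlg n m bw θ a).round P (P.nodesAnnounce θ g (a t) t) = P.nodesRescale θ g (a t) t := by
  refine round_liveNodes le_rfl (P.le_step_x θ (a t) g) (fun _ _ => rfl) (fun j hj => ?_)
    fun i hi => ?_
  · refine (round_inl (fromRows_liveNodes_eq_none fun _ => rfl)
      (lt_of_messages_eq_some (by simp))).trans ?_
    rw [liveNodes_inl_of_active hj, liveNodes_inl_of_active hj]
    rfl
  · have hlt : ∀ j ∈ P.row i, Nat.pair (min ((P.step θ (a t) g).x j) (2 ^ (2 * θ.K)))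
        ((P.settled θ g (a t) j).maxHalvings θ.Z i) < 2 ^ bw := fun j _ =>
      pair_lt_two_pow hE ((min_le_right _ _).trans_lt (Nat.pow_lt_pow_right one_lt_two hK))
        ((VarView.maxHalvings_le _ _ _).trans_lt hZ)
    refine (round_inr (fromVars_liveNodes hi fun _ => rfl) (lt_of_messages_eq_some hlt)).trans ?_
    rw [liveNodes_inr_of_pos hi]
    exact h.next_rowAwaitValue a g t i

theorem round_nodesRescale {g : BidState n m} (hg : ∀ j, (P.view θ g j).Valid θ.β) (a : ℕ → ℕ)
    (t : ℕ) {E : ℕ} (hE : 2 * E ≤ bw)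
    (hcost : ∀ i, 0 < P.residual (P.step θ (a t) g).x i → P.rowReduction θ g (a t) i < 2 ^ E)
    (hscale : ∀ i j, P.A i j ≠ 0 → P.scale θ (P.step θ (a t) g).x i j < 2 ^ E) :
    (bidAlg n m bw θ a).round P (P.nodesRescale θ g (a t) t) =
      P.nodesReport θ (P.step θ (a t) g) (t + 1) := by
  refine round_liveNodes (P.le_step_x θ (a t) g) le_rfl (fun j hj => ?_) (fun j hj => ?_)
    fun i hi => ?_
  · exact (valid_raised (hg j) (a t)).settle_x_eq (Finset.not_nonempty_iff_eq_empty.1 hj)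
  · have hlt : ∀ i ∈ P.active (P.step θ (a t) g).x j, Nat.pair (P.rowReduction θ g (a t) i)
        (P.scale θ (P.step θ (a t) g).x i j) < 2 ^ bw := fun i hi =>
      pair_lt_two_pow hE (hcost i (mem_active.1 hi).2) (hscale i j (mem_active.1 hi).1)
    refine (round_inl (fromRows_liveNodes fun i => ?_) (lt_of_messages_eq_some hlt)).trans ?_
    · rw [← rowView_scale]
      rfl
    · rw [liveNodes_inl_of_active hj]
      simp only [NodeState.next, varUpdate_settled]
      rfl
  · refine (round_inr (fromVars_liveNodes_eq_none fun _ => rfl)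
      (lt_of_messages_eq_some (by simp))).trans ?_
    rw [liveNodes_inr_of_pos hi, liveNodes_inr_of_pos hi]
    rfl

/-- The states of the nodes after the first round, in which the variables have announced their
columns and their demands on the initial bids. -/
def nodesReady (P : CoveringILP m n) (θ : BidParams) : Fin n ⊕ Fin m → NodeState n m
  | Sum.inl j => .varWait (P.w j)
  | Sum.inr i =>
    if 0 < P.residual (P.start θ).x i then
      .rowReady (P.rowView (P.start θ).x i) (P.rowStartReduction θ i)
    else .rowHalt

theorem startMessage_lt {E : ℕ} (hbw : 4 * E ≤ bw) (hK : θ.K ≤ E) (hE : 0 < E) {i : Fin m}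
    {j : Fin n} (hA : IsShort θ.K (P.A i j))
    (hcost : startReduction θ.K (P.col j).card (P.w j) < 2 ^ E) :
    Nat.pair (Nat.pair (shortNum θ.K (P.A i j)) (shortDen θ.K (P.A i j)))
      (Nat.pair (startReduction θ.K (P.col j).card (P.w j)) (if P.w j = 0 then 1 else 0)) <
        2 ^ bw := by
  have hpow : 2 ^ θ.K ≤ 2 ^ E := Nat.pow_le_pow_right two_pos hK
  exact pair_lt_two_pow (E := 2 * E) (by omega)
    (pair_lt_two_pow le_rfl ((shortNum_lt hA).trans_le hpow) ((shortDen_lt hA).trans_le hpow))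
    (pair_lt_two_pow le_rfl hcost (bit_lt_two_pow hE _))

theorem round_init {E : ℕ} (hbw : 4 * E ≤ bw) (hK : θ.K ≤ E) (hE : 0 < E)
    (hA : ∀ i j, IsShort θ.K (P.A i j))
    (hcost : ∀ j, startReduction θ.K (P.col j).card (P.w j) < 2 ^ E) (a : ℕ → ℕ) :
    (bidAlg n m bw θ a).round P ((bidAlg n m bw θ a).init P) = P.nodesReady θ := by
  funext u
  rcases u with j | i
  · exact round_inl (fromRows_eq_none fun _ => rfl) (lt_of_messages_eq_some (by simp))
  · refine (round_inr (fromVars_eq_messages fun _ _ => rfl)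
      (lt_of_messages_eq_some fun j _ => startMessage_lt hbw hK hE (hA i j) (hcost j))).trans ?_
    change NodeState.next θ a _ _ (NodeState.rowInit (P.b i)) = _
    have hview := rowStart_messages (P := P) (hA i)
    have hreduction := P.rowStartReduction_messages θ
      (fun j => Nat.pair (shortNum θ.K (P.A i j)) (shortDen θ.K (P.A i j)))
      (fun j => if P.w j = 0 then 1 else 0) i
    simp only [NodeState.next, hview, hreduction, rowView_residual]
    rfl

theorem round_nodesReady (P : CoveringILP m n) (θ : BidParams) (a : ℕ → ℕ) {E : ℕ}
    (hE : 2 * E ≤ bw) (hcost : ∀ i, P.rowStartReduction θ i < 2 ^ E)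
    (hscale : ∀ i j, P.A i j ≠ 0 → P.scale θ (P.start θ).x i j < 2 ^ E) :
    (bidAlg n m bw θ a).round P (P.nodesReady θ) = P.nodesReport θ (P.start θ) 0 := by
  funext u
  rcases u with j | i
  · have hmessages : P.fromRows θ a (P.nodesReady θ) j = messages (P.active (P.start θ).x j)
        fun i => Nat.pair (P.rowStartReduction θ i) (P.scale θ (P.start θ).x i j) := by
      refine fromRows_liveNodes (x := 0) (v := fun j => .varWait (P.w j))
        (r := fun i => .rowReady (P.rowView (P.start θ).x i) (P.rowStartReduction θ i)) fun i => ?_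
      rw [← rowView_scale]
      rfl
    refine (round_inl hmessages (lt_of_messages_eq_some fun i hi =>
      pair_lt_two_pow hE (hcost i) (hscale i j (mem_active.1 hi).1))).trans ?_
    simp only [nodesReady, NodeState.next, varStart_messages]
    rfl
  · refine (round_inr (fromVars_eq_none fun _ => rfl)
      (lt_of_messages_eq_some (by simp))).trans ?_
    exact apply_ite (NodeState.next θ a _ _) _ _ _

theorem Fits.scale_le (h : P.Fits θ) (x : Fin n → ℕ) (i : Fin m) (j : Fin n) :
    P.scale θ x i j ≤ 2 * θ.K := by
  by_cases hij : P.A i j = 0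
  · rw [scale_eq_zero fun hj => mem_row.1 hj hij]
    exact Nat.zero_le _
  · have hratio : P.residual x i / P.A i j ≤ 2 ^ (2 * θ.K) := by
      rw [div_le_iff₀ (P.A_pos hij), mul_comm]
      exact (P.residual_le x i).trans (h.b_le i j hij)
    exact (pow_le_pow_iff_right₀ one_lt_two).1
      (two_pow_scaleOf_le h.F_pos hratio (one_le_pow₀ one_le_two))

theorem Fits.rowReduction_le (h : P.Fits θ) (g : BidState n m) (a : ℕ) (i : Fin m) :
    P.rowReduction θ g a i ≤ (θ.Z + 3) * (1 + 2 * n * θ.K) := by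
  have hhalvings : P.rowHalvings θ g a i ≤ θ.Z + 3 :=
    Finset.sup_le fun j _ => (VarView.maxHalvings_le _ _ _).trans (by omega)
  have hscales : ∑ j, (P.scale θ g.x i j - P.scale θ (P.step θ a g).x i j) ≤ 2 * n * θ.K :=
    (Finset.sum_le_card_nsmul _ _ (2 * θ.K) fun j _ =>
      (Nat.sub_le _ _).trans (h.scale_le _ i j)).trans (le_of_eq (by simp; ring))
  calc P.rowReduction θ g a i ≤ (θ.Z + 3) + (θ.Z + 3) * (2 * n * θ.K) :=
        add_le_add hhalvings (Nat.mul_le_mul_left _ hscales)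
    _ = (θ.Z + 3) * (1 + 2 * n * θ.K) := by ring

/-- All numbers that are sent in the course of the bidding process have at most `E` bits. -/
structure FitsBandwidth (P : CoveringILP m n) (θ : BidParams) (E : ℕ) : Prop where
  short : ∀ i j, IsShort θ.K (P.A i j)
  K_lt : 2 * θ.K < E
  startReduction_lt : ∀ j, startReduction θ.K (P.col j).card (P.w j) < 2 ^ E
  reduction_lt : (θ.Z + 3) * (1 + 2 * n * θ.K) < 2 ^ E

theorem Fits.run_eq_nodesReport (h : P.Fits θ) {E : ℕ} (hE : P.FitsBandwidth θ E)
    (hbw : 4 * E ≤ bw) (a : ℕ → ℕ) (t : ℕ) :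
    (bidAlg n m bw θ a).run P (2 + 4 * t) = P.nodesReport θ (P.bidRun θ a t) t := by
  have hK := hE.K_lt
  have hZ : θ.Z + 3 < 2 ^ E :=
    (Nat.le_mul_of_pos_right _ (by omega)).trans_lt hE.reduction_lt
  have hscale : ∀ x i j, P.scale θ x i j < 2 ^ E := fun x i j =>
    (h.scale_le x i j).trans_lt (hK.trans Nat.lt_two_pow_self)
  induction t with
  | zero =>
    refine (congrArg _ (round_init hbw (by omega) (by omega) hE.short
      hE.startReduction_lt a)).trans ?_
    exact P.round_nodesReady θ a (by omega)
      (fun i => (Finset.sup_lt_iff (Nat.two_pow_pos E)).2 fun j _ => hE.startReduction_lt j)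
      fun i j _ => hscale _ i j
  | succ t ih =>
    let round := (bidAlg n m bw θ a).round P
    have hdecide : round ((bidAlg n m bw θ a).run P (2 + 4 * t)) = _ :=
      (congrArg round ih).trans (round_nodesReport P θ a _ t (by omega))
    have hannounce := (congrArg round hdecide).trans (round_nodesDecide P θ a _ t (by omega))
    have hrescale := (congrArg round hannounce).trans
      (h.round_nodesAnnounce a _ t (by omega) hK (by omega))
    exact (congrArg round hrescale).trans (round_nodesRescale (h.valid a t) a t (by omega)
      (fun i _ => (h.rowReduction_le _ _ i).trans_lt hE.reduction_lt) fun i j _ => hscale _ i j)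

theorem Fits.haltsWith (h : P.Fits θ) {E : ℕ} (hE : P.FitsBandwidth θ E) (hbw : 4 * E ≤ bw)
    {t : ℕ} (ht : P.Feasible (P.bidRun θ a t).x) :
    (bidAlg n m bw θ a).HaltsWith P (2 + 4 * t) (P.bidRun θ a t).x := by
  have hresidual : ∀ i, ¬0 < P.residual (P.bidRun θ a t).x i := fun i =>
    not_lt.2 (sub_nonpos.2 (ht i))
  have hvar : ∀ j, (bidAlg n m bw θ a).run P (2 + 4 * t) (Sum.inl j) =
      NodeState.varHalt ((P.bidRun θ a t).x j) := fun j => by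
    rw [h.run_eq_nodesReport hE hbw]
    exact if_neg fun ⟨i, hi⟩ => hresidual i (mem_active.1 hi).2
  have hrow : ∀ i, (bidAlg n m bw θ a).run P (2 + 4 * t) (Sum.inr i) = NodeState.rowHalt :=
    fun i => by
      rw [h.run_eq_nodesReport hE hbw]
      exact if_neg (hresidual i)
  have hout : ∀ j, (bidAlg n m bw θ a).output ((bidAlg n m bw θ a).run P (2 + 4 * t)
      (Sum.inl j)) = some ((P.bidRun θ a t).x j) := fun j => congrArg NodeState.out (hvar j)
  refine ⟨?_, hout⟩
  rintro (j | i)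
  · rw [hout]
    rfl
  · rw [hrow]
    rfl

end CoveringILP

/-! ### Encoded inputs -/

theorem IsShort.lt {k : ℕ} {x : ℝ} (h : IsShort k x) : x < 2 ^ k := by
  obtain ⟨p, q, hp, hq, -, rfl⟩ := h
  exact (div_le_self (Nat.cast_nonneg p) (Nat.one_le_cast.2 hq)).trans_lt (by exact_mod_cast hp)

theorem IsShort.one_le_mul {k : ℕ} {x : ℝ} (h : IsShort k x) (hx : x ≠ 0) : 1 ≤ x * 2 ^ k := by
  obtain ⟨p, q, -, hq, hqk, rfl⟩ := h
  have hp : 1 ≤ p := Nat.one_le_iff_ne_zero.2 fun h0 => hx (by rw [h0, Nat.cast_zero, zero_div])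
  rw [div_mul_eq_mul_div, one_le_div (Nat.cast_pos.2 hq)]
  exact_mod_cast hqk.le.trans (Nat.le_mul_of_pos_left _ hp)

/-- The approximation tolerance `ε`, raised to a threshold below which it makes no difference: for
inputs of `K` bits the costs of different solutions differ by more, relative to the optimum. -/
def tolerance (n K : ℕ) (ε : ℝ) : ℝ := max ε (2⁻¹ ^ (n * K + 3 * K + n))

theorem tolerance_pos (n K : ℕ) (ε : ℝ) : 0 < tolerance n K ε :=
  lt_max_of_lt_right (by positivity)

/-- The parameters of the bidding process for programs with `n` variables, inputs of `K` bits and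
rank `f`. The choice of `β` makes `F / (1 - β)` equal to `F + tolerance n K ε`. -/
def bidParams (n K f : ℕ) (ε : ℝ) : BidParams where
  F := max f 1
  Z := toleranceExp (tolerance n K ε / ((max f 1 : ℕ) + tolerance n K ε))
  K := K
  β := tolerance n K ε / ((max f 1 : ℕ) + tolerance n K ε)

theorem bidParams_Z_le {n K f ℓ : ℕ} (ε : ℝ) (hf : f ≤ 2 ^ ℓ) :
    (bidParams n K f ε).Z ≤ n * K + 3 * K + n + ℓ + 1 := by
  have hδ := tolerance_pos n K ε
  have hδ' : (2 : ℝ)⁻¹ ^ (n * K + 3 * K + n) ≤ tolerance n K ε := le_max_right _ _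
  have hF : ((max f 1 : ℕ) : ℝ) ≤ 2 ^ ℓ := by exact_mod_cast max_le hf Nat.one_le_two_pow
  refine (toleranceExp_le_iff (by positivity)).2 ?_
  rw [le_div_iff₀ (by positivity), mul_add]
  have hleft : (2 : ℝ)⁻¹ ^ (n * K + 3 * K + n + ℓ + 1) * ((max f 1 : ℕ) : ℝ) ≤
      tolerance n K ε / 2 :=
    calc _ ≤ (2 : ℝ)⁻¹ ^ (n * K + 3 * K + n + ℓ + 1) * 2 ^ ℓ := by gcongr
      _ = 2⁻¹ ^ (n * K + 3 * K + n) * (2⁻¹ * 2) ^ ℓ / 2 := by rw [mul_pow]; ring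
      _ ≤ tolerance n K ε / 2 := by
        rw [inv_mul_cancel₀ two_ne_zero, one_pow, mul_one]
        gcongr
  have hright : (2 : ℝ)⁻¹ ^ (n * K + 3 * K + n + ℓ + 1) * tolerance n K ε ≤
      2⁻¹ * tolerance n K ε := by
    gcongr
    exact pow_le_of_le_one (by norm_num) (by norm_num) (Nat.succ_ne_zero _)
  linarith

theorem startReduction_le {K d ℓ : ℕ} {w : ℝ} (hw : IsShort K w) (hw0 : 0 ≤ w) (hd : d ≤ 2 ^ ℓ) :
    startReduction K d w ≤ 2 * K + ℓ + 2 := by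
  refine Nat.clog_le_of_le_pow (Nat.ceil_le.2 ?_)
  rcases hw0.eq_or_lt with rfl | hw0
  · simp
  have hd' : (d : ℝ) ≤ 2 ^ ℓ := by exact_mod_cast hd
  rw [div_le_iff₀ hw0]
  push_cast
  calc (4 : ℝ) * d * 2 ^ K ≤ 4 * 2 ^ ℓ * 2 ^ K := by gcongr
    _ ≤ 4 * 2 ^ ℓ * 2 ^ K * (w * 2 ^ K) :=
      le_mul_of_one_le_right (by positivity) (hw.one_le_mul hw0.ne')
    _ = 2 ^ (2 * K + ℓ + 2) * w := by ring

theorem mul_lt_two_pow {n κ ℓ Z : ℕ} (hn : n ≤ 2 ^ ℓ) (hℓ : 0 < ℓ)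
    (hZ : Z ≤ n * (κ * ℓ) + 3 * (κ * ℓ) + n + ℓ + 1) :
    (Z + 3) * (1 + 2 * n * (κ * ℓ)) < 2 ^ ((2 * κ + 12) * ℓ) := by
  set v := 2 ^ κ * (2 ^ ℓ * 2 ^ ℓ) with hv
  have hκ : κ ≤ 2 ^ κ := Nat.lt_two_pow_self.le
  have hℓ' : ℓ ≤ 2 ^ ℓ := Nat.lt_two_pow_self.le
  have hpow : 2 ^ ℓ ≤ 2 ^ ℓ * 2 ^ ℓ := Nat.le_mul_of_pos_left _ (Nat.two_pow_pos ℓ)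
  have hpow' : 2 ^ ℓ * 2 ^ ℓ ≤ v := Nat.le_mul_of_pos_left _ (Nat.two_pow_pos κ)
  have hnK : n * (κ * ℓ) ≤ v := by
    rw [mul_left_comm]
    exact Nat.mul_le_mul hκ (Nat.mul_le_mul hn hℓ')
  have hK : κ * ℓ ≤ v := Nat.mul_le_mul hκ (hℓ'.trans hpow)
  have hone : 1 ≤ v := Nat.one_le_iff_ne_zero.2 (by positivity)
  have hκℓ : κ ≤ κ * ℓ := Nat.le_mul_of_pos_right _ hℓ
  calc (Z + 3) * (1 + 2 * n * (κ * ℓ)) ≤ (16 * v) * (4 * v) :=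
        Nat.mul_le_mul (by omega) (by rw [mul_assoc]; omega)
    _ = 2 ^ (6 + 2 * κ + 4 * ℓ) := by rw [hv]; ring
    _ < 2 ^ ((2 * κ + 12) * ℓ) := Nat.pow_lt_pow_right one_lt_two (by nlinarith)

namespace CoveringILP

variable {n m : ℕ} {P : CoveringILP m n}

theorem row_card_le_rank (P : CoveringILP m n) (i : Fin m) : (P.row i).card ≤ P.rank := by
  have hcard : (P.row i).card = Set.ncard {j : Fin n | P.A i j ≠ 0} := by
    rw [← Set.ncard_coe_finset]
    simp [row]
  rw [hcard]
  exact Finset.le_sup (f := fun i : Fin m => Set.ncard {j : Fin n | P.A i j ≠ 0})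
    (Finset.mem_univ i)

theorem rank_le (P : CoveringILP m n) : P.rank ≤ n :=
  Finset.sup_le fun i _ => (Set.ncard_le_ncard (Set.subset_univ _)).trans_eq
    (by rw [Set.ncard_univ, Nat.card_fin])

theorem eq_zero_of_rank_eq_zero (h : P.rank = 0) (i : Fin m) (j : Fin n) : P.A i j = 0 := by
  by_contra hij
  have := P.row_card_le_rank i
  have := Finset.card_pos.2 ⟨j, mem_row.2 hij⟩
  omega

theorem InputShort.b_le_mul {K : ℕ} (h : P.InputShort K) {i : Fin m} {j : Fin n}
    (hij : P.A i j ≠ 0) : P.b i ≤ P.A i j * 2 ^ (2 * K) :=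
  calc P.b i ≤ 1 * 2 ^ K := by rw [one_mul]; exact (h.2.1 i).lt.le
    _ ≤ P.A i j * 2 ^ K * 2 ^ K := by
      gcongr
      exact (h.1 i j).one_le_mul hij
    _ = P.A i j * 2 ^ (2 * K) := by ring

theorem InputShort.fits {K : ℕ} (h : P.InputShort K) (ε : ℝ) :
    P.Fits (bidParams n K P.rank ε) := by
  have hδ := tolerance_pos n K ε
  have hF : 0 < max P.rank 1 := lt_max_of_lt_right one_pos
  have hF' : (0 : ℝ) < (max P.rank 1 : ℕ) := Nat.cast_pos.2 hF
  exact
    { F_pos := hF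
      row_card_le := fun i => (P.row_card_le_rank i).trans (le_max_left _ _)
      β_lt := (div_lt_one (add_pos hF' hδ)).2 (lt_add_of_pos_left _ hF')
      Z_le := (toleranceExp_le_iff (div_pos hδ (add_pos hF' hδ))).1 le_rfl
      b_le := fun _ _ => h.b_le_mul
      w_le := fun j => (h.2.2 j).lt.le }

theorem InputShort.fitsBandwidth {κ ℓ : ℕ} (h : P.InputShort (κ * ℓ)) (hn : n ≤ 2 ^ ℓ)
    (hm : m ≤ 2 ^ ℓ) (hℓ : 0 < ℓ) (ε : ℝ) :
    P.FitsBandwidth (bidParams n (κ * ℓ) P.rank ε) ((2 * κ + 12) * ℓ) where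
  short := h.1
  K_lt := by
    change 2 * (κ * ℓ) < _
    linarith
  startReduction_lt j := by
    have hcol : (P.col j).card ≤ 2 ^ ℓ := (card_finset_fin_le _).trans hm
    calc startReduction (κ * ℓ) (P.col j).card (P.w j) ≤ 2 * (κ * ℓ) + ℓ + 2 :=
          startReduction_le (h.2.2 j) (P.w_nonneg j) hcol
      _ ≤ (2 * κ + 12) * ℓ := by linarith
      _ < 2 ^ ((2 * κ + 12) * ℓ) := Nat.lt_two_pow_self
  reduction_lt := mul_lt_two_pow hn hℓ (bidParams_Z_le ε (P.rank_le.trans hn))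

theorem cost_nonneg (P : CoveringILP m n) (x : Fin n → ℕ) : 0 ≤ P.cost x :=
  Finset.sum_nonneg fun j _ => mul_nonneg (P.w_nonneg j) (Nat.cast_nonneg _)

theorem cost_mono (P : CoveringILP m n) : Monotone P.cost := fun _ _ hxy =>
  Finset.sum_le_sum fun j _ => mul_le_mul_of_nonneg_left (Nat.cast_le.2 (hxy j)) (P.w_nonneg j)

theorem cost_start (P : CoveringILP m n) (θ : BidParams) : P.cost (P.start θ).x = 0 := by
  refine Finset.sum_eq_zero fun j _ => ?_
  change P.w j * (startValue θ.K (P.w j) : ℝ) = 0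
  by_cases hw : P.w j = 0
  · rw [hw, zero_mul]
  · rw [startValue, if_neg hw, Nat.cast_zero, mul_zero]

theorem Fits.feasible_min {θ : BidParams} (h : P.Fits θ) {y : Fin n → ℕ} (hy : P.Feasible y) :
    P.Feasible fun j => min (y j) (2 ^ (2 * θ.K)) := fun i =>
  sub_nonpos.1 (not_lt.1 fun hpos =>
    not_lt.2 (sub_nonpos.2 (hy i)) (h.residual_min_pos_iff.1 hpos))

theorem exists_common_denominator {K : ℕ} (hw : ∀ j, IsShort K (P.w j)) :
    ∃ Q : ℕ, 0 < Q ∧ Q ≤ 2 ^ (n * K) ∧ ∀ x, ∃ N : ℕ, Q * P.cost x = N := by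
  choose p q _ hq hqK hpq using hw
  refine ⟨∏ j, q j, Finset.prod_pos fun j _ => hq j, ?_, fun x =>
    ⟨∑ j, p j * (∏ k ∈ Finset.univ.erase j, q k) * x j, ?_⟩⟩
  · calc ∏ j, q j ≤ ∏ _j : Fin n, 2 ^ K := Finset.prod_le_prod' fun j _ => (hqK j).le
      _ = 2 ^ (n * K) := by rw [Finset.prod_const, Finset.card_fin, ← pow_mul, mul_comm]
  · rw [cost, Finset.mul_sum]
    push_cast
    refine Finset.sum_congr rfl fun j _ => ?_
    have hqj : (q j : ℝ) ≠ 0 := Nat.cast_ne_zero.2 (hq j).ne'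
    rw [hpq j, ← Finset.mul_prod_erase _ _ (Finset.mem_univ j)]
    field_simp

theorem cost_le_mul_of_le_add_mul {K k : ℕ} (hw : ∀ j, IsShort K (P.w j)) {δ : ℝ}
    {x z : Fin n → ℕ} (hδ : 2 ^ (n * K) * (δ * P.cost z) < 1)
    (hδ0 : 0 ≤ δ) (hx : P.cost x ≤ (k + δ) * P.cost z) : P.cost x ≤ k * P.cost z := by
  obtain ⟨Q, hQ, hQK, hint⟩ := exists_common_denominator hw
  obtain ⟨N, hN⟩ := hint x
  obtain ⟨N', hN'⟩ := hint z
  have hQ0 : (0 : ℝ) < Q := Nat.cast_pos.2 hQ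
  have hQK' : (Q : ℝ) ≤ 2 ^ (n * K) := by exact_mod_cast hQK
  have hlt : (N : ℝ) < k * N' + 1 :=
    calc (N : ℝ) = Q * P.cost x := hN.symm
      _ ≤ Q * ((k + δ) * P.cost z) := by gcongr
      _ = k * (Q * P.cost z) + Q * (δ * P.cost z) := by ring
      _ ≤ k * (Q * P.cost z) + 2 ^ (n * K) * (δ * P.cost z) := by
        have := mul_nonneg hδ0 (P.cost_nonneg z)
        gcongr
      _ < k * N' + 1 := by rw [hN']; gcongr
  have hle : N ≤ k * N' := Nat.lt_succ_iff.1 (by exact_mod_cast hlt)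
  refine le_of_mul_le_mul_left ?_ hQ0
  rw [mul_left_comm, hN, hN']
  exact_mod_cast hle

theorem InputShort.cost_min_le {K : ℕ} (h : P.InputShort K) (y : Fin n → ℕ) :
    P.cost (fun j => min (y j) (2 ^ (2 * K))) ≤ n * 2 ^ (3 * K) := by
  refine (Finset.sum_le_card_nsmul _ _ ((2 : ℝ) ^ (3 * K)) fun j _ => ?_).trans (by simp)
  have hw := (h.2.2 j).lt.le
  have hy : ((min (y j) (2 ^ (2 * K)) : ℕ) : ℝ) ≤ 2 ^ (2 * K) := by
    exact_mod_cast min_le_right _ _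
  calc _ ≤ (2 : ℝ) ^ K * 2 ^ (2 * K) := by gcongr
    _ = 2 ^ (3 * K) := by ring

theorem InputShort.mul_cost_min_lt_one {K : ℕ} (h : P.InputShort K) (y : Fin n → ℕ) :
    2 ^ (n * K) *
      ((2 : ℝ)⁻¹ ^ (n * K + 3 * K + n) * P.cost fun j => min (y j) (2 ^ (2 * K))) < 1 := by
  have hn : (n : ℝ) < 2 ^ n := by exact_mod_cast Nat.lt_two_pow_self
  calc _ ≤ 2 ^ (n * K) * ((2 : ℝ)⁻¹ ^ (n * K + 3 * K + n) * (n * 2 ^ (3 * K))) := by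
        gcongr
        exact h.cost_min_le y
    _ < 2 ^ (n * K) * (2⁻¹ ^ (n * K + 3 * K + n) * (2 ^ n * 2 ^ (3 * K))) := by gcongr
    _ = (2⁻¹ * 2) ^ (n * K + 3 * K + n) := by rw [mul_pow, pow_add 2, pow_add 2]; ring
    _ = 1 := by norm_num

theorem InputShort.cost_le_add_tolerance_mul {K : ℕ} (h : P.InputShort K) (hr : 0 < P.rank)
    (ε : ℝ) (a : ℕ → ℕ) (t : ℕ) {y : Fin n → ℕ} (hy : P.Feasible y) :
    P.cost (P.bidRun (bidParams n K P.rank ε) a t).x ≤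
      (P.rank + tolerance n K ε) * P.cost y := by
  have hδ := tolerance_pos n K ε
  have hr' : (0 : ℝ) < P.rank := Nat.cast_pos.2 hr
  have hcost := (h.fits ε).cost_le a hy t
  have hF : (bidParams n K P.rank ε).F = P.rank := max_eq_left hr
  have hβ : 1 - (bidParams n K P.rank ε).β = P.rank / (P.rank + tolerance n K ε) := by
    simp only [bidParams, max_eq_left (show 1 ≤ P.rank from hr)]
    field_simp
    ring
  rw [hF, hβ, div_mul_eq_mul_div, div_le_iff₀ (by positivity), mul_assoc] at hcost
  linarith [le_of_mul_le_mul_left hcost hr']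

/-- If `ε` is below the threshold, the error term is smaller than the distance between different
values of the cost, so it is absorbed by rounding. -/
theorem InputShort.cost_le {K : ℕ} (h : P.InputShort K) (hr : 0 < P.rank) {ε : ℝ} (hε : 0 < ε)
    (a : ℕ → ℕ) (t : ℕ) {y : Fin n → ℕ} (hy : P.Feasible y) :
    P.cost (P.bidRun (bidParams n K P.rank ε) a t).x ≤ (P.rank + ε) * P.cost y := by
  have hcost := fun z (hz : P.Feasible z) => h.cost_le_add_tolerance_mul hr ε a t hz
  rcases le_or_gt ((2 : ℝ)⁻¹ ^ (n * K + 3 * K + n)) ε with hle | hlt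
  · rw [tolerance, max_eq_left hle] at hcost
    exact hcost y hy
  · rw [tolerance, max_eq_right hlt.le] at hcost
    calc _ ≤ P.rank * P.cost fun j => min (y j) (2 ^ (2 * K)) :=
          cost_le_mul_of_le_add_mul h.2.2 (h.mul_cost_min_lt_one y) (by positivity)
            (hcost _ ((h.fits ε).feasible_min hy))
      _ ≤ (P.rank + ε) * P.cost y :=
        mul_le_mul (le_add_of_nonneg_right hε.le) (P.cost_mono fun j => min_le_left _ _)
          (P.cost_nonneg _) (by positivity)

/-- The time bound of the algorithm for minimum weight vertex cover, on hypergraphs of the size to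
which covering programs with the rank, the coefficient ratio and the degree of `P` reduce. -/
def vertexCoverTime (P : CoveringILP m n) (γ ε : ℝ) : ℝ :=
  mwhvcTime γ (P.rank * (1 + Real.logb 2 P.maxRatio)) (2 ^ P.rank * P.maxRatio * P.maxDegree) ε

theorem third_le_vertexCoverTime (P : CoveringILP m n) (γ : ℝ) {ε : ℝ} (hε : 0 < ε)
    (hε1 : ε ≤ 1) : 1 / 3 ≤ P.vertexCoverTime γ ε := by
  have hX : 0 ≤ P.rank * (1 + Real.logb 2 P.maxRatio) *
      Real.logb 2 (P.rank * (1 + Real.logb 2 P.maxRatio) / ε) := by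
    rcases P.rank.eq_zero_or_pos with hr | hr
    · rw [hr, Nat.cast_zero, zero_mul, zero_mul]
    · have hF : 1 ≤ P.rank * (1 + Real.logb 2 P.maxRatio) :=
        one_le_mul_of_one_le_of_one_le (Nat.one_le_cast.2 hr)
          (le_add_of_nonneg_right P.logb_maxRatio_nonneg)
      exact mul_nonneg (zero_le_one.trans hF) (logb_div_nonneg hF hε hε1)
  have hthird := third_le_div_logb (2 ^ P.rank * P.maxRatio * P.maxDegree)
  have hD := three_halves_le_logb (2 ^ P.rank * P.maxRatio * P.maxDegree)
  refine hthird.trans ((le_add_of_nonneg_left hX).trans (le_add_of_nonneg_right ?_))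
  exact le_min (by linarith) (mul_nonneg hX (Real.rpow_nonneg (by linarith) _))

theorem maxDegree_eq_zero_of_rank_eq_zero (h : P.rank = 0) : P.maxDegree = 0 := by
  simp [maxDegree, eq_zero_of_rank_eq_zero h]

theorem vertexCoverTime_le_simplifiedTime (P : CoveringILP m n) {γ ε : ℝ} (hε : 0 < ε)
    (hε1 : ε ≤ 1) (hγ : γ ≤ 0.001) :
    P.vertexCoverTime γ ε ≤ 1000 * simplifiedTime P.rank P.maxDegree P.maxRatio ε := by
  rcases P.rank.eq_zero_or_pos with hr | hr
  · have hthird := third_le_div_logb 0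
    have hL : 0 ≤ Real.logb 2 (max 3 0) := by linarith [three_halves_le_logb 0]
    simp only [vertexCoverTime, mwhvcTime, simplifiedTime, hr,
      maxDegree_eq_zero_of_rank_eq_zero hr, Nat.cast_zero, zero_mul, mul_zero, zero_add,
      min_eq_right hL, add_zero, Real.zero_rpow (by norm_num : (1.01 : ℝ) ≠ 0)]
    linarith
  · exact mwhvcTime_le_simplifiedTime hr (Nat.cast_nonneg _) P.one_le_maxRatio hε hε1 hγ

theorem exists_feasible_bidRun_of_rank_pos {γ : ℝ} (hγ : 0 < γ) :
    ∃ C : ℝ, 0 < C ∧ ∀ (n m : ℕ) (P : CoveringILP m n) (ε : ℝ) (K : ℕ), 0 < ε → ε ≤ 1 →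
      P.InputShort K → (∃ y, P.Feasible y) → 0 < P.rank →
      ∃ τ : ℕ, P.Feasible (P.bidRun (bidParams n K P.rank ε) (raiseExp (min γ (1 / 2))) τ).x ∧
        (τ : ℝ) ≤ C * P.vertexCoverTime γ ε + 1 := by
  obtain ⟨C, hC, hactive⟩ := exists_le_mul_mwhvcTime hγ
  refine ⟨C, hC, fun n m P ε K hε hε1 hP ⟨y, hy⟩ hr => ?_⟩
  have hF : (bidParams n K P.rank ε).F = P.rank := max_eq_left hr
  have hT : 0 ≤ P.vertexCoverTime γ ε := by
    linarith [P.third_le_vertexCoverTime γ hε hε1]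
  refine ⟨⌊C * P.vertexCoverTime γ ε⌋₊ + 1, fun i => ?_, ?_⟩
  · rcases (P.row i).eq_empty_or_nonempty with hi | hi
    · have hb := P.residual_congr (x := y)
        (y := (P.bidRun (bidParams n K P.rank ε) (raiseExp (min γ (1 / 2)))
          (⌊C * P.vertexCoverTime γ ε⌋₊ + 1)).x) (i := i) (by simp [hi])
      exact sub_nonpos.1 (hb.symm.le.trans (sub_nonpos.2 (hy i)))
    · by_contra! hlt
      have hτ := hactive n m P _ ε _ (hP.fits ε) hε hε1 (le_max_left _ _) rfl i _ hi
        (sub_pos.2 hlt)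
      rw [expandedRank, hF] at hτ
      push_cast at hτ
      exact (Nat.lt_floor_add_one _).not_ge hτ
  · push_cast
    linarith [Nat.floor_le (mul_nonneg hC.le hT)]

theorem exists_isApprox_bidRun {γ : ℝ} (hγ : 0 < γ) :
    ∃ C : ℝ, 0 < C ∧ ∀ (n m : ℕ) (P : CoveringILP m n) (ε : ℝ) (K : ℕ), 0 < ε → ε ≤ 1 →
      P.InputShort K → (∃ y, P.Feasible y) →
      ∃ τ : ℕ, P.IsApprox (P.rank + ε)
          (P.bidRun (bidParams n K P.rank ε) (raiseExp (min γ (1 / 2))) τ).x ∧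
        (τ : ℝ) ≤ C * P.vertexCoverTime γ ε + 1 := by
  obtain ⟨C, hC, hfeasible⟩ := exists_feasible_bidRun_of_rank_pos hγ
  refine ⟨C, hC, fun n m P ε K hε hε1 hP hy => ?_⟩
  rcases P.rank.eq_zero_or_pos with hr | hr
  · have hT : 0 ≤ P.vertexCoverTime γ ε := by
      linarith [P.third_le_vertexCoverTime γ hε hε1]
    obtain ⟨y, hy⟩ := hy
    refine ⟨0, ⟨fun i => ?_, fun z _ => ?_⟩, by push_cast; positivity⟩
    · simpa only [eq_zero_of_rank_eq_zero hr, zero_mul] using hy i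
    · exact (P.cost_start _).trans_le (mul_nonneg (by positivity) (P.cost_nonneg z))
  · obtain ⟨τ, hτ, hτT⟩ := hfeasible n m P ε K hε hε1 hP hy hr
    exact ⟨τ, ⟨hτ, fun z hz => hP.cost_le hr hε _ τ hz⟩, hτT⟩

theorem InputShort.haltsWith_bidAlg {κ : ℕ} (h : P.InputShort (κ * (Nat.log 2 (n + m) + 1)))
    (ε : ℝ) {a : ℕ → ℕ} {τ : ℕ}
    (hτ : P.Feasible
      (P.bidRun (bidParams n (κ * (Nat.log 2 (n + m) + 1)) P.rank ε) a τ).x) :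
    (bidAlg n m ((8 * κ + 48) * (Nat.log 2 (n + m) + 1))
        (bidParams n (κ * (Nat.log 2 (n + m) + 1)) P.rank ε) a).HaltsWith P (2 + 4 * τ)
      (P.bidRun (bidParams n (κ * (Nat.log 2 (n + m) + 1)) P.rank ε) a τ).x := by
  have hlt : n + m < 2 ^ (Nat.log 2 (n + m) + 1) := Nat.lt_pow_succ_log_self one_lt_two _
  exact (h.fits ε).haltsWith
    (h.fitsBandwidth (by omega) (by omega) (Nat.succ_pos _) ε) (by linarith) hτ

end CoveringILP

theorem le_mul_one_add_div_logb_mul {t C T n : ℝ} (f : ℕ) (ht : 0 ≤ t) (h : t ≤ C * T) :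
    t ≤ C * (1 + f / Real.logb 2 (max 2 n)) * T := by
  have hlog : 0 ≤ Real.logb 2 (max 2 n) :=
    Real.logb_nonneg one_lt_two (one_le_two.trans (le_max_left _ _))
  rw [mul_right_comm]
  exact h.trans (le_mul_of_one_le_right (ht.trans h) (le_add_of_nonneg_right (by positivity)))

end

theorem mainTheorem7_general (κ : ℕ) {γ : ℝ} (hγ : 0 < γ) :
    ∃ (B : ℕ) (C : ℝ)
      (alg : ∀ n m _f : ℕ, ∀ _ε : ℝ, CongestAlg n m (B * (Nat.log 2 (n + m) + 1))),
      ∀ (n m : ℕ) (P : CoveringILP m n) (ε : ℝ), 0 < ε → ε ≤ 1 →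
        P.InputShort (κ * (Nat.log 2 (n + m) + 1)) →
        (∃ y, P.Feasible y) →
        ∃ (t : ℕ) (x : Fin n → ℕ),
          (alg n m P.rank ε).HaltsWith P t x ∧
          P.IsApprox ((P.rank : ℝ) + ε) x ∧
          (t : ℝ) ≤ C * mwhvcTime γ ((P.rank : ℝ) * (1 + Real.logb 2 P.maxRatio))
            (2 ^ P.rank * P.maxRatio * (P.maxDegree : ℝ)) ε ∧
          (γ ≤ 0.001 →
            (t : ℝ) ≤ C * simplifiedTime (P.rank : ℝ) (P.maxDegree : ℝ) P.maxRatio ε) := by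
  obtain ⟨C, hC, hbidRun⟩ := CoveringILP.exists_isApprox_bidRun hγ
  refine ⟨8 * κ + 48, 1000 * (18 + 4 * C), fun n m f ε => bidAlg n m _
    (bidParams n (κ * (Nat.log 2 (n + m) + 1)) f ε) (raiseExp (min γ (1 / 2))), ?_⟩
  intro n m P ε hε hε1 hP hy
  obtain ⟨τ, hτ, hτT⟩ := hbidRun n m P ε _ hε hε1 hP hy
  have hT := P.third_le_vertexCoverTime γ hε hε1
  have ht : ((2 + 4 * τ : ℕ) : ℝ) ≤ (18 + 4 * C) * P.vertexCoverTime γ ε := by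
    push_cast
    linarith
  refine ⟨2 + 4 * τ, _, hP.haltsWith_bidAlg ε hτ.1, hτ, ht.trans ?_, fun hγ1 => ht.trans ?_⟩
  · rw [mul_assoc]
    exact le_mul_of_one_le_left (by positivity) (by norm_num)
  · rw [mul_comm 1000, mul_assoc]
    gcongr
    exact P.vertexCoverTime_le_simplifiedTime hε hε1 hγ1

theorem mainTheorem7 (κ : ℕ) (γ : ℝ) (hγ : 0 < γ) :
    ∃ (B : ℕ) (C : ℝ)
      (alg : ∀ n m _f : ℕ, ∀ _ε : ℝ, CongestAlg n m (B * (Nat.log 2 (n + m) + 1))),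
      ∀ (n m : ℕ) (P : CoveringILP m n) (ε : ℝ), 0 < ε → ε ≤ 1 →
        P.InputShort (κ * (Nat.log 2 (n + m) + 1)) →
        (∃ y, P.Feasible y) →
        ∃ (t : ℕ) (x : Fin n → ℕ),
          (alg n m P.rank ε).HaltsWith P t x ∧
          P.IsApprox ((P.rank : ℝ) + ε) x ∧
          (t : ℝ) ≤ C * (1 + (P.rank : ℝ) / Real.logb 2 (max 2 (n : ℝ))) *
            mwhvcTime γ ((P.rank : ℝ) * (1 + Real.logb 2 P.maxRatio))
              (2 ^ P.rank * P.maxRatio * (P.maxDegree : ℝ)) ε ∧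
          (γ ≤ 0.001 →
            (t : ℝ) ≤ C * (1 + (P.rank : ℝ) / Real.logb 2 (max 2 (n : ℝ))) *
              simplifiedTime (P.rank : ℝ) (P.maxDegree : ℝ) P.maxRatio ε) := by
  obtain ⟨B, C, alg, h⟩ := mainTheorem7_general κ hγ
  refine ⟨B, C, alg, fun n m P ε hε hε1 hP hy => ?_⟩
  obtain ⟨t, x, hhalts, happrox, ht, ht'⟩ := h n m P ε hε hε1 hP hy
  exact ⟨t, x, hhalts, happrox, le_mul_one_add_div_logb_mul _ t.cast_nonneg ht,
    fun hγ1 => le_mul_one_add_div_logb_mul _ t.cast_nonneg (ht' hγ1)⟩
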